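/- Let $A=\{a_1,\dots,a_n\}$ ($n\ge 1$) be a set of agents and let $\ell\ge 1$ be the number of layers; in each layer $i\in[\ell]$ every agent $a\in A$ approves a set $T_a^i\subseteq A$. A matching $M$ is a set of pairs of distinct agents in which every agent occurs in at most one pair; $M(a)$ is the partner of $a$, and $M(a)=\square$ if $a$ is unmatched. Agent $a$ is happy in layer $i$ if $M(a)\in T_a^i$. For $x,y\in A\cup\{\square\}$, agent $a$ prefers $x$ to $y$ in layer $i$ if $x\in T_a^i$ and $y\notin T_a^i$, and is indifferent between them if both or neither belong to $T_a^i$ (where $\square\notin T_a^i$). A pair $\{a,a'\}\notin M$ of distinct agents blocks $M$ in layer $i$ - under weak stability if $a$ prefers $a'$ to $M(a)$ and $a'$ prefers $a$ to $M(a')$; - under strong stability if, for $(b,b')=(a,a')$ or $(b,b')=(a',a)$, $b$ prefers $b'$ to $M(b)$, and $b'$ prefers $b$ to $M(b')$ or is indifferent between them; - under super stability if each of the two agents prefers the other one to its partner in $M$ or is indifferent between them. $M$ is stable in a layer if no pair blocks it there. For $\alpha\in[\ell]$, $M$ is $\alpha$-globally weakly/strongly/super stable if there are $\alpha$ layers in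 each of which it is weakly/strongly/super stable; $\alpha$-pair weakly/strongly/super stable if for every pair of agents there are at least $\alpha$ layers in which the pair does not block $M$ under weak/strong/super stability; and $\alpha$-individually weakly (super) stable if for every pair $\{a,a'\}\notin M$ of distinct agents one can name the two agents $b,b'$ so that there are $\alpha$ layers in which $b$ does not approve $b'$ or $b$ is happy (in which $b$ does not approve $b'$ and $b$ is happy). Two agents $a,a'$ are of the same type if for all $i\in[\ell]$: $T_a^i\setminus\{a'\}=T_{a'}^i\setminus\{a\}$; $a'\in T_a^i$ if and only if $a\in T_{a'}^i$; and for all $b\in A\setminus\{a,a'\}$, $a\in T_b^i$ if and only if $a'\in T_b^i$. This is an equivalence relation; let $\tau$ be the number of its classes. Theorem. For each of the eight notions (global and pair: weak, strong, super; individual: weak, super), the problem of deciding, given $n,\ell,\alpha\in[\ell]$ and the approval sets, whether an $\alpha$-stable matching exists is solvable in $\mathcal O\bigl(2^{(\tau+1)^2}\cdot n^4\cdot \ell\bigr)$ time. Here time is the number of steps of a word RAM with words of $\Theta(\log(n\ell)+1)$ bits, which receives $n,\ell,\alpha$ in registers and the approval sets as $0/1$ matrices in memory: there are a program and constants $c,C$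 such that on every instance, and for every word length of at least $c(\lfloor\log_2(n\ell)\rfloor+1)$ bits, the program halts without overflow with the correct answer after at most $C\cdot 2^{(\tau+1)^2}n^4\ell$ steps. -/

import Mathlib

namespace MultilayerMatching

/-! ### Multilayer approval preferences, agent types, matchings -/

/-- Approval preferences of the agents `a_1, …, a_n` in `ℓ` layers: `T a i` is the set of agents that
agent `a` approves in layer `i`. -/
abbrev Profile (n ℓ : ℕ) : Type := Fin n → Fin ℓ → Finset (Fin n)

variable {n ℓ : ℕ}

/-- Agents `a` and `a'` are of the same type: in every layer they approve the same agents (up to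
exchanging `a` and `a'`) and are approved by the same other agents. -/
def SameType (T : Profile n ℓ) (a a' : Fin n) : Prop :=
  ∀ i : Fin ℓ,
    T a i \ {a'} = T a' i \ {a} ∧
    (a' ∈ T a i ↔ a ∈ T a' i) ∧
    ∀ b : Fin n, b ≠ a → b ≠ a' → (a ∈ T b i ↔ a' ∈ T b i)

theorem SameType.symm {T : Profile n ℓ} {a b : Fin n} (h : SameType T a b) : SameType T b a :=
  fun i => ⟨(h i).1.symm, (h i).2.1.symm, fun c hb ha => ((h i).2.2 c ha hb).symm⟩

theorem SameType.trans {T : Profile n ℓ} {a b c : Fin n} (h₁ : SameType T a b)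
    (h₂ : SameType T b c) : SameType T a c := by
  by_cases hab : a = b
  · exact hab ▸ h₂
  by_cases hbc : b = c
  · exact hbc ▸ h₁
  by_cases hac : a = c
  · subst hac
    exact fun i => ⟨rfl, Iff.rfl, fun _ _ _ => Iff.rfl⟩
  intro i
  obtain ⟨p₁, q₁, r₁⟩ := h₁ i
  obtain ⟨p₂, q₂, r₂⟩ := h₂ i
  have e₁ : ∀ x, (x ∈ T a i ∧ x ≠ b) ↔ (x ∈ T b i ∧ x ≠ a) := fun x => by
    simpa using Finset.ext_iff.1 p₁ x
  have e₂ : ∀ x, (x ∈ T b i ∧ x ≠ c) ↔ (x ∈ T c i ∧ x ≠ b) := fun x => by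
    simpa using Finset.ext_iff.1 p₂ x
  have ra := r₂ a hab hac
  have rc := r₁ c (Ne.symm hac) (Ne.symm hbc)
  refine ⟨?_, ?_, ?_⟩
  · ext x
    simp only [Finset.mem_sdiff, Finset.mem_singleton]
    have := e₁ x
    have := e₂ x
    have := e₁ a
    have := e₁ c
    have := e₂ a
    have := e₂ c
    grind
  · have := e₁ c
    have := e₂ a
    grind
  · intro x hxa hxc
    by_cases hxb : x = b
    · subst hxb
      have := e₁ c
      have := e₂ a
      grind
    · exact (r₁ x hxa hxb).trans (r₂ x hxb hxc)

/-- Being of the same type is an equivalence relation; its classes are the agent types. -/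
def typeSetoid (T : Profile n ℓ) : Setoid (Fin n) where
  r := SameType T
  iseqv := ⟨fun _ _ => ⟨rfl, Iff.rfl, fun _ _ _ => Iff.rfl⟩, SameType.symm, SameType.trans⟩

/-- The number of agent types. -/
noncomputable def numTypes (T : Profile n ℓ) : ℕ := Nat.card (Quotient (typeSetoid T))

/-- A matching, given by its partner map: `M.partner a = some b` means that `{a, b}` is a pair of the
matching, and `M.partner a = none` that `a` is unmatched. -/
structure Matching (n : ℕ) where
  partner : Fin n → Option (Fin n)
  symm : ∀ a b, partner a = some b → partner b = some a
  irrefl : ∀ a, partner a ≠ some a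

/-! ### Preferences, blocking pairs, stability -/

/-- `x` is an agent approved by `a` in layer `i` (being unmatched, `none`, is not approved). -/
def Approves (T : Profile n ℓ) (i : Fin ℓ) (a : Fin n) (x : Option (Fin n)) : Prop :=
  ∃ b, x = some b ∧ b ∈ T a i

/-- `a` prefers `x` to `y` in layer `i`. -/
def Prefers (T : Profile n ℓ) (i : Fin ℓ) (a : Fin n) (x y : Option (Fin n)) : Prop :=
  Approves T i a x ∧ ¬ Approves T i a y

/-- `a` is indifferent between `x` and `y` in layer `i`. -/
def Indifferent (T : Profile n ℓ) (i : Fin ℓ) (a : Fin n) (x y : Option (Fin n)) : Prop :=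
  (Approves T i a x ∧ Approves T i a y) ∨ (¬ Approves T i a x ∧ ¬ Approves T i a y)

/-- `a` is happy in `M` in layer `i`: it approves its partner. -/
def Happy (T : Profile n ℓ) (i : Fin ℓ) (M : Matching n) (a : Fin n) : Prop :=
  Approves T i a (M.partner a)

/-- The three single-layer stability criteria. -/
inductive Criterion
  | weak
  | strong
  | super

/-- The pair `{a, b}` of distinct agents, not matched to each other, blocks `M` in layer `i`. -/
def Blocks (T : Profile n ℓ) (i : Fin ℓ) (M : Matching n) (κ : Criterion) (a b : Fin n) : Prop :=
  a ≠ b ∧ M.partner a ≠ some b ∧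
  match κ with
  | .weak => Prefers T i a (some b) (M.partner a) ∧ Prefers T i b (some a) (M.partner b)
  | .strong =>
      (Prefers T i a (some b) (M.partner a) ∧
        (Prefers T i b (some a) (M.partner b) ∨ Indifferent T i b (some a) (M.partner b))) ∨
      (Prefers T i b (some a) (M.partner b) ∧
        (Prefers T i a (some b) (M.partner a) ∨ Indifferent T i a (some b) (M.partner a)))
  | .super =>
      (Prefers T i a (some b) (M.partner a) ∨ Indifferent T i a (some b) (M.partner a)) ∧
      (Prefers T i b (some a) (M.partner b) ∨ Indifferent T i b (some a) (M.partner b))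

/-- `M` is weakly/strongly/super stable in layer `i`. -/
def StableInLayer (T : Profile n ℓ) (i : Fin ℓ) (M : Matching n) (κ : Criterion) : Prop :=
  ∀ a b, ¬ Blocks T i M κ a b

/-- `M` is `α`-globally stable: there are `α` layers in each of which `M` is stable. -/
def GloballyStable (T : Profile n ℓ) (α : ℕ) (M : Matching n) (κ : Criterion) : Prop :=
  ∃ S : Finset (Fin ℓ), S.card = α ∧ ∀ i ∈ S, StableInLayer T i M κ

/-- `M` is `α`-pair stable: for each pair of agents there are at least `α` layers in which the pair is
not blocking. -/
def PairStable (T : Profile n ℓ) (α : ℕ) (M : Matching n) (κ : Criterion) : Prop :=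
  ∀ a b, a ≠ b → ∃ S : Finset (Fin ℓ), α ≤ S.card ∧ ∀ i ∈ S, ¬ Blocks T i M κ a b

/-- `M` is `α`-individually weakly stable: for each unmatched pair, one of its two agents, in `α`
layers, does not approve the other one or is happy. -/
def IndividuallyWeaklyStable (T : Profile n ℓ) (α : ℕ) (M : Matching n) : Prop :=
  ∀ a a', a ≠ a' → M.partner a ≠ some a' →
    ∃ b b', ((b = a ∧ b' = a') ∨ (b = a' ∧ b' = a)) ∧
      ∃ S : Finset (Fin ℓ), α ≤ S.card ∧ ∀ i ∈ S, b' ∉ T b i ∨ Happy T i M b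

/-- `M` is `α`-individually super stable: for each unmatched pair, one of its two agents, in `α`
layers, does not approve the other one and is happy. -/
def IndividuallySuperStable (T : Profile n ℓ) (α : ℕ) (M : Matching n) : Prop :=
  ∀ a a', a ≠ a' → M.partner a ≠ some a' →
    ∃ b b', ((b = a ∧ b' = a') ∨ (b = a' ∧ b' = a)) ∧
      ∃ S : Finset (Fin ℓ), α ≤ S.card ∧ ∀ i ∈ S, b' ∉ T b i ∧ Happy T i M b

/-- The eight multilayer stability notions with a degree `α` (there is no individual strong
stability). -/
inductive StabilityNotion
  | global (κ : Criterion)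
  | pair (κ : Criterion)
  | individualWeak
  | individualSuper

/-- `M` is stable to degree `α` with respect to the given notion. -/
def StabilityNotion.IsStable (σ : StabilityNotion) (T : Profile n ℓ) (α : ℕ) (M : Matching n) :
    Prop :=
  match σ with
  | .global κ => GloballyStable T α M κ
  | .pair κ => PairStable T α M κ
  | .individualWeak => IndividuallyWeaklyStable T α M
  | .individualSuper => IndividuallySuperStable T α M

/-! ### The machine model: structured programs on a word RAM, with a step count -/

/-- The contents of the registers and of the random access memory. -/
structure State where
  reg : ℕ → ℕ
  mem : ℕ → ℕ

/-- Arithmetic operations (`sub` is truncated, `div` and `mod` are division with remainder). -/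
inductive ArithOp
  | add
  | sub
  | mul
  | div
  | mod

def ArithOp.eval : ArithOp → ℕ → ℕ → ℕ
  | .add, x, y => x + y
  | .sub, x, y => x - y
  | .mul, x, y => x * y
  | .div, x, y => x / y
  | .mod, x, y => x % y

/-- Elementary instructions; `r`, `x`, `y` are names of registers. -/
inductive Instr
  /-- `r := k` -/
  | const (r k : ℕ)
  /-- `r := x` -/
  | copy (r x : ℕ)
  /-- `r := x op y` -/
  | arith (op : ArithOp) (r x y : ℕ)
  /-- `r := mem[x]` -/
  | load (r x : ℕ)
  /-- `mem[x] := y` -/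
  | store (x y : ℕ)

/-- Put the value `v` into register `r`; undefined if `v` does not fit into a word of `w` bits. -/
def State.setReg (w : ℕ) (s : State) (r v : ℕ) : Option State :=
  if v < 2 ^ w then some { s with reg := Function.update s.reg r v } else none

/-- The effect of an instruction on a machine with words of `w` bits (`none` on overflow). -/
def Instr.run (w : ℕ) (s : State) : Instr → Option State
  | .const r k => s.setReg w r k
  | .copy r x => s.setReg w r (s.reg x)
  | .arith op r x y => s.setReg w r (op.eval (s.reg x) (s.reg y))
  | .load r x => s.setReg w r (s.mem (s.reg x))
  | .store x y => some { s with mem := Function.update s.mem (s.reg x) (s.reg y) }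

/-- Programs; the tests compare the contents of the registers `x` and `y`. -/
inductive Prog
  /-- do nothing -/
  | skip
  /-- a single instruction -/
  | instr (i : Instr)
  /-- first `p`, then `q` -/
  | seq (p q : Prog)
  /-- if `x < y` then `p` else `q` -/
  | ite (x y : ℕ) (p q : Prog)
  /-- while `x < y` do `p` -/
  | loop (x y : ℕ) (p : Prog)

/-- `Exec w p s t s'`: on a machine with words of `w` bits, the program `p` started in state `s` halts
after exactly `t` steps in state `s'`, without an overflow. Every instruction and every evaluation of a
test is one step. -/
inductive Exec (w : ℕ) : Prog → State → ℕ → State → Prop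
  | skip (s : State) : Exec w .skip s 1 s
  | instr {i : Instr} {s s' : State} : i.run w s = some s' → Exec w (.instr i) s 1 s'
  | seq {p q : Prog} {s s' s'' : State} {t t' : ℕ} :
      Exec w p s t s' → Exec w q s' t' s'' → Exec w (.seq p q) s (t + t') s''
  | ite_true {x y : ℕ} {p q : Prog} {s s' : State} {t : ℕ} :
      s.reg x < s.reg y → Exec w p s t s' → Exec w (.ite x y p q) s (t + 1) s'
  | ite_false {x y : ℕ} {p q : Prog} {s s' : State} {t : ℕ} :
      ¬ s.reg x < s.reg y → Exec w q s t s' → Exec w (.ite x y p q) s (t + 1) s'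
  | loop_true {x y : ℕ} {p : Prog} {s s' s'' : State} {t t' : ℕ} :
      s.reg x < s.reg y → Exec w p s t s' → Exec w (.loop x y p) s' t' s'' →
      Exec w (.loop x y p) s (t + t' + 1) s''
  | loop_false {x y : ℕ} {p : Prog} {s : State} :
      ¬ s.reg x < s.reg y → Exec w (.loop x y p) s 1 s

open Classical in
/-- The input: registers 0, 1, 2 hold `n`, `ℓ`, `α`; the memory holds the approval matrices of the
layers, one after the other and row by row; everything else is 0. -/
noncomputable def inputState (T : Profile n ℓ) (α : ℕ) : State where
  reg r := if r = 0 then n else if r = 1 then ℓ else if r = 2 then α else 0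
  mem x := if ∃ (i : Fin ℓ) (a b : Fin n),
      x = ((i : ℕ) * n + (a : ℕ)) * n + (b : ℕ) ∧ b ∈ T a i then 1 else 0

open Classical in
/-- The decision problem of the stability notion `σ` (is there a matching that is stable to degree
`α`?) is solvable in time `O(bound)`: for some program and some constants `c` and `C`, on every
instance with `n ≥ 1` and `1 ≤ α ≤ ℓ` and for all words of at least `c * (⌊log₂ (n * ℓ)⌋ + 1)` bits, the
program halts after at most `C * bound` steps with the answer (1 for yes, 0 for no) in register 0. -/
def SolvableInTime (σ : StabilityNotion) (bound : ∀ {n ℓ : ℕ}, Profile n ℓ → ℕ) : Prop :=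
  ∃ (p : Prog) (c C : ℕ), ∀ (n ℓ : ℕ) (T : Profile n ℓ) (α w : ℕ),
    1 ≤ n → 1 ≤ α → α ≤ ℓ → c * (Nat.log 2 (n * ℓ) + 1) ≤ w →
    ∃ (t : ℕ) (s : State), Exec w p (inputState T α) t s ∧
      t ≤ C * bound T ∧
      s.reg 0 = if ∃ M : Matching n, σ.IsStable T α M then 1 else 0

end MultilayerMatching

namespace MultilayerMatching

/-! ### Total correctness with time bounds -/

/-! Reduction to patterns. Give every agent a dummy, all dummies having one extra type that stands
for being unmatched. An unmatched agent is paired with its own dummy, and the dummies of two matched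
agents are paired with each other. A matching thus becomes a fixed-point-free involution on `2 n`
points with `τ + 1` types. Its pattern `D` records for each unordered pair of types whether it is
realized by no, exactly one, or several pairs. Whether two agents with given partners violate a
stability condition depends only on the four types (`SameType.mem_iff`), and two different pairs
with the same types need multiplicity above one. Hence all eight notions can be read off from the
pattern (`exists_isStable_iff`).

Realizability of patterns. The pairs of multiplicity one use up a known number of points of each
type. The remaining points have to be matched perfectly along the type pairs with `D P Q = 2`. This
is not a bipartite problem, but every pairing has a two-colouring that separates partners and is
balanced on each type (`exists_balanced_coloring`), because a union of two matchings has only even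
cycles. So it suffices to guess for each type which side gets the larger half, and to test Hall's
condition between the two sides. Neighbourhoods depend only on types, so only sets of types have to
be tested (`exists_pairing_of_feasible`, `exists_feasible_of_pairing`). A pairing that uses a type
pair with `D P Q = 2` less often than twice does no harm, since it has fewer combinations to check.

Running time. Multiplicities and rounding choices form one ternary array of length `(τ + 2) (τ + 3)
/ 2`; the sets in Hall's condition are coded by ternary arrays of length `τ + 1`. Every stability
test takes `O(n^4 ℓ)` steps. Since `3 ^ 5 ≤ 2 ^ 8`, the exponent to base 2 is about `4/5` of `τ ^
2`, so that `(τ + 1) ^ 2` absorbs it together with all linear terms (`three_pow_mul_le`).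

The algorithm is written as an expression with bounded sums and quantifiers over ternary arrays. A
compiler to the word RAM is verified once (`compile_runs`); value bounds (`eval_le`) and running
times (`Sizes.cost_le`) follow by structural induction. -/

/-- `p` halts from `s` within `T` steps in a state satisfying `Q`. -/
def Runs (w : ℕ) (p : Prog) (s : State) (T : ℕ) (Q : State → Prop) : Prop :=
  ∃ t s', Exec w p s t s' ∧ t ≤ T ∧ Q s'

namespace Runs

variable {w : ℕ} {p q : Prog} {s s' : State} {T T' : ℕ} {Q Q' : State → Prop}

theorem mono (h : Runs w p s T Q) (hT : T ≤ T') (hQ : ∀ s', Q s' → Q' s') : Runs w p s T' Q' := by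
  obtain ⟨t, s', h₁, h₂, h₃⟩ := h
  exact ⟨t, s', h₁, h₂.trans hT, hQ _ h₃⟩

theorem instr {i : Instr} (hi : i.run w s = some s') (hT : 1 ≤ T) (hQ : Q s') :
    Runs w (.instr i) s T Q :=
  ⟨1, s', .instr hi, hT, hQ⟩

/-- The unused budget is handed on inside the postcondition, so straight-line code is verified from
front to back. -/
theorem seq (h : Runs w p s T' fun s' => Runs w q s' (T - T') Q) (hT : T' ≤ T) :
    Runs w (.seq p q) s T Q := by
  obtain ⟨t, s', h₁, h₂, t', s'', h₃, h₄, h₅⟩ := h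
  exact ⟨t + t', s'', .seq h₁ h₃, by omega, h₅⟩

theorem seq_instr {i : Instr} (hi : i.run w s = some s') (hT : 1 ≤ T)
    (h : Runs w q s' (T - 1) Q) : Runs w (.seq (.instr i) q) s T Q :=
  seq (instr hi le_rfl h) hT

theorem ite {x y : ℕ} (hT : 1 ≤ T) (h₁ : s.reg x < s.reg y → Runs w p s (T - 1) Q)
    (h₂ : ¬ s.reg x < s.reg y → Runs w q s (T - 1) Q) : Runs w (.ite x y p q) s T Q := by
  by_cases h : s.reg x < s.reg y
  · obtain ⟨t, s', a, b, c⟩ := h₁ h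
    exact ⟨t + 1, s', .ite_true h a, by omega, c⟩
  · obtain ⟨t, s', a, b, c⟩ := h₂ h
    exact ⟨t + 1, s', .ite_false h a, by omega, c⟩

theorem skip (hT : 1 ≤ T) (hQ : Q s) : Runs w .skip s T Q := ⟨1, s, .skip s, hT, hQ⟩

theorem loop_step {x y : ℕ} (h : s.reg x < s.reg y)
    (hb : Runs w p s T' fun s' => Runs w (.loop x y p) s' (T - T' - 1) Q) (hT : T' + 1 ≤ T) :
    Runs w (.loop x y p) s T Q := by
  obtain ⟨t, s', h₁, h₂, t', s'', h₃, h₄, h₅⟩ := hb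
  exact ⟨t + t' + 1, s'', .loop_true h h₁ h₃, by omega, h₅⟩

theorem loop_exit {x y : ℕ} (h : ¬ s.reg x < s.reg y) (hT : 1 ≤ T) (hQ : Q s) :
    Runs w (.loop x y p) s T Q :=
  ⟨1, s, .loop_false h, hT, hQ⟩

/-- A loop whose body, started with counter `j`, re-establishes the invariant with counter `j + 1`. -/
theorem for_loop {x y N B : ℕ} {I : ℕ → State → Prop}
    (hI : ∀ j s, I j s → s.reg x = j ∧ s.reg y = N)
    (hbody : ∀ j s, j < N → I j s → Runs w p s B (I (j + 1)))
    (j : ℕ) (hj : j ≤ N) (s : State) (hs : I j s) :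
    Runs w (.loop x y p) s ((N - j) * (B + 1) + 1) (I N) := by
  induction h : N - j generalizing j s with
  | zero =>
    obtain rfl : j = N := by omega
    obtain ⟨h₁, h₂⟩ := hI _ _ hs
    exact loop_exit (by omega) (by omega) hs
  | succ m ih =>
    obtain ⟨h₁, h₂⟩ := hI _ _ hs
    -- A round costs the body and one test; the final `+ 1` of the bound is the failing test.
    refine loop_step (T' := B) (by omega) ?_ (by rw [add_mul]; omega)
    refine (hbody j s (by omega) hs).mono le_rfl fun s' hs' => ?_
    refine (ih (j + 1) (by omega) s' hs' (by omega)).mono ?_ fun _ h => h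
    rw [add_mul (m)]; omega

end Runs

theorem State.setReg_eq {w r v : ℕ} (s : State) (h : v < 2 ^ w) :
    s.setReg w r v = some ⟨Function.update s.reg r v, s.mem⟩ := by
  simp [State.setReg, h]

/-! ### Expressions -/

/-- Overwrite the `l` cells of `μ` from address `o` on by `d`. -/
def overlay (μ : ℕ → ℕ) (o l : ℕ) (d : ℕ → ℕ) (x : ℕ) : ℕ :=
  if o ≤ x ∧ x < o + l then d (x - o) else μ x

/-- Expressions that are evaluated in a memory and in an environment of named variables. -/
inductive Expression
  | const (k : ℕ)
  | var (x : ℕ)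
  | arith (op : ArithOp) (a b : Expression)
  /-- if `a < b` then `c` else `d` -/
  | ite (a b c d : Expression)
  | load (a : Expression)
  /-- the sum of `body` over the values of `y` less than the value of `x` -/
  | sum (y x : ℕ) (body : Expression)
  /-- whether `body` is positive for some ternary array of length `l` at address `o` -/
  | any (o l : ℕ) (body : Expression)

namespace Expression

open Classical in
noncomputable def eval : Expression → (ℕ → ℕ) → (ℕ → ℕ) → ℕ
  | const k, _, _ => k
  | var x, _, ρ => ρ x
  | arith op a b, μ, ρ => op.eval (a.eval μ ρ) (b.eval μ ρ)
  | ite a b c d, μ, ρ => if a.eval μ ρ < b.eval μ ρ then c.eval μ ρ else d.eval μ ρ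
  | load a, μ, ρ => μ (a.eval μ ρ)
  | sum y x body, μ, ρ => ∑ j ∈ Finset.range (ρ x), body.eval μ (Function.update ρ y j)
  | any o l body, μ, ρ =>
      if ∃ d : ℕ → ℕ, (∀ j, d j < 3) ∧ 0 < body.eval (overlay μ (ρ o) (ρ l) d) ρ then 1 else 0

/-- Registers from 24 on are temporary; loop bounds and array positions are held by registers below
10, loop variables by registers from 10 to 23. -/
def WellFormed : Expression → Bool
  | const _ => true
  | var x => x < 24
  | arith _ a b => a.WellFormed && b.WellFormed
  | ite a b c d => a.WellFormed && b.WellFormed && c.WellFormed && d.WellFormed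
  | load a => a.WellFormed
  | sum y x body => 10 ≤ y && y < 24 && x < 10 && body.WellFormed
  | any o l body => o < 10 && l < 10 && body.WellFormed

/-- The arrays over which an expression quantifies are all zero before the evaluation. -/
def ScratchFree : Expression → (ℕ → ℕ) → (ℕ → ℕ) → Prop
  | const _, _, _ => True
  | var _, _, _ => True
  | arith _ a b, μ, ρ => a.ScratchFree μ ρ ∧ b.ScratchFree μ ρ
  | ite a b c d, μ, ρ =>
      a.ScratchFree μ ρ ∧ b.ScratchFree μ ρ ∧ c.ScratchFree μ ρ ∧ d.ScratchFree μ ρ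
  | load a, μ, ρ => a.ScratchFree μ ρ
  | sum _ _ body, μ, ρ => body.ScratchFree μ ρ
  | any o l body, μ, ρ => (∀ j < ρ l, μ (ρ o + j) = 0) ∧
      ∀ d : ℕ → ℕ, (∀ j, d j < 3) → body.ScratchFree (overlay μ (ρ o) (ρ l) d) ρ

/-- An exponent bounding all values that occur in the evaluation. -/
def width : Expression → ℕ
  | const k => k + 2
  | var _ => 8
  | arith .mul a b => a.width + b.width
  | arith _ a b => max a.width b.width + 1
  | ite a b c d => max (max a.width b.width) (max c.width d.width)
  | load a => max 8 a.width
  | sum _ _ body => 8 + body.width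
  | any _ _ body => max 10 body.width

/-- An upper bound for the running time. -/
def cost (ρ : ℕ → ℕ) : Expression → ℕ
  | const _ => 1
  | var _ => 1
  | arith _ a b => a.cost ρ + b.cost ρ + 1
  | ite a b c d => a.cost ρ + b.cost ρ + (c.cost ρ + d.cost ρ) + 1
  | load a => a.cost ρ + 1
  | sum _ x body => ρ x * (body.cost ρ + 3) + 7
  | any _ l body => 3 ^ ρ l * (body.cost ρ + 8 * ρ l + 7) + 6

/-- Add one to a ternary counter of length `l` at address `o`; register `k + 1` tells whether there
was no overflow of the counter. -/
def incrementLoop (o k : ℕ) : Prog :=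
  .loop (k + 5) (k + 6) <|
    .seq (.instr (.arith .add (k + 7) o (k + 5))) <|
    .seq (.instr (.load (k + 8) (k + 7))) <|
    .ite (k + 8) (k + 4)
      (.seq (.instr (.arith .add (k + 8) (k + 8) (k + 3))) <|
        .seq (.instr (.store (k + 7) (k + 8))) <|
        .seq (.instr (.const (k + 1) 1)) <|
        .instr (.const (k + 6) 0))
      (.seq (.instr (.store (k + 7) (k + 2))) <|
        .instr (.arith .add (k + 5) (k + 5) (k + 3)))

/-- The loop of the quantification over ternary arrays; `p` leaves its value in register `k + 8`. -/
def anyLoop (o l k : ℕ) (p : Prog) : Prog :=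
  .loop (k + 2) (k + 1) <|
    .seq p <|
    .seq (.ite (k + 2) (k + 8) (.instr (.const k 1)) .skip) <|
    .seq (.instr (.const (k + 1) 0)) <|
    .seq (.instr (.const (k + 5) 0)) <|
    .seq (.instr (.copy (k + 6) l)) <|
    incrementLoop o k

/-- The program that puts the value of an expression into register `k`, using only registers from `k`
on and (temporarily) loop variables. -/
def compile : Expression → ℕ → Prog
  | const c, k => .instr (.const k c)
  | var x, k => .instr (.copy k x)
  | arith op a b, k =>
      .seq (a.compile k) <| .seq (b.compile (k + 1)) <| .instr (.arith op k k (k + 1))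
  | ite a b c d, k =>
      .seq (a.compile k) <| .seq (b.compile (k + 1)) <| .ite k (k + 1) (c.compile k) (d.compile k)
  | load a, k => .seq (a.compile k) <| .instr (.load k k)
  | sum y x body, k =>
      .seq (.instr (.copy k y)) <|
      .seq (.instr (.const (k + 1) 0)) <|
      .seq (.instr (.const (k + 2) 1)) <|
      .seq (.instr (.const y 0)) <|
      .seq (.loop y x (.seq (body.compile (k + 3)) <|
        .seq (.instr (.arith .add (k + 1) (k + 1) (k + 3))) <|
        .instr (.arith .add y y (k + 2)))) <|
      .seq (.instr (.copy y k)) <|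
      .instr (.copy k (k + 1))
  | any o l body, k =>
      .seq (.instr (.const k 0)) <|
      .seq (.instr (.const (k + 1) 1)) <|
      .seq (.instr (.const (k + 2) 0)) <|
      .seq (.instr (.const (k + 3) 1)) <|
      .seq (.instr (.const (k + 4) 2)) <|
      anyLoop o l k (body.compile (k + 8))

end Expression

/-! ### The ternary counter -/

/-- The `j`-th ternary digit. -/
def ternary (v j : ℕ) : ℕ := v / 3 ^ j % 3

theorem ternary_lt (v j : ℕ) : ternary v j < 3 := Nat.mod_lt _ (by norm_num)

theorem mod_pow_succ_eq_ternary (v j : ℕ) : v % 3 ^ (j + 1) = v % 3 ^ j + 3 ^ j * ternary v j := by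
  rw [pow_succ, Nat.mod_mul, ternary]

/-- The hypothesis says that the lowest `j` digits of `v` are all 2. Then `3 ^ j` divides `v + 1`,
and the carry clears these digits. -/
theorem ternary_succ_of_lt {v j i : ℕ} (h : v % 3 ^ j = 3 ^ j - 1) (hi : i < j) :
    ternary (v + 1) i = 0 := by
  have h3 : 0 < 3 ^ j := by positivity
  have hd : 3 ^ j ∣ v + 1 := (Nat.dvd_iff_mod_eq_zero).2 (by
    rw [Nat.add_mod, h]
    rcases Nat.lt_or_ge 1 (3 ^ j) with h1 | h1
    · rw [Nat.mod_eq_of_lt h1, Nat.sub_add_cancel h3, Nat.mod_self]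
    · have : 3 ^ j = 1 := by omega
      simp [this])
  have hd' : 3 ^ (i + 1) ∣ v + 1 := (pow_dvd_pow 3 hi).trans hd
  obtain ⟨c, hc⟩ := hd'
  rw [ternary, hc, pow_succ, mul_assoc, Nat.mul_div_cancel_left _ (by positivity),
    Nat.mul_mod_right]

/-- The carry is absorbed by digit `j`, which is not 2, so the quotient by `3 ^ (j + 1)` does not
change. -/
theorem ternary_succ_of_ge {v j i : ℕ} (h : v % 3 ^ j = 3 ^ j - 1) (hj : ternary v j < 2)
    (hi : j < i) : ternary (v + 1) i = ternary v i := by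
  have h3 : 0 < 3 ^ j := by positivity
  have h1 : v % 3 ^ (j + 1) + 1 < 3 ^ (j + 1) := by
    rw [mod_pow_succ_eq_ternary, h, pow_succ]
    have : 3 ^ j * ternary v j ≤ 3 ^ j * 1 := Nat.mul_le_mul_left _ (by omega)
    omega
  have h2 : (v + 1) / 3 ^ (j + 1) = v / 3 ^ (j + 1) := by
    rw [Nat.succ_div_of_not_dvd]
    intro hd
    have := Nat.mod_add_div v (3 ^ (j + 1))
    obtain ⟨c, hc⟩ := hd
    have h4 : (v + 1) % 3 ^ (j + 1) = v % 3 ^ (j + 1) + 1 := by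
      rw [← Nat.mod_add_mod, Nat.mod_eq_of_lt h1]
    rw [hc, Nat.mul_mod_right] at h4
    omega
  obtain ⟨e, rfl⟩ : ∃ e, i = j + 1 + e := ⟨i - (j + 1), by omega⟩
  rw [ternary, ternary, pow_add, ← Nat.div_div_eq_div_mul, ← Nat.div_div_eq_div_mul, h2]

theorem ternary_succ_self {v j : ℕ} (h : v % 3 ^ j = 3 ^ j - 1) (hj : ternary v j < 2) :
    ternary (v + 1) j = ternary v j + 1 := by
  have h3 : 0 < 3 ^ j := by positivity
  have h2 : (v + 1) / 3 ^ j = v / 3 ^ j + 1 := by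
    rw [Nat.succ_div_of_dvd]
    refine ⟨v / 3 ^ j + 1, ?_⟩
    have := Nat.mod_add_div v (3 ^ j)
    rw [mul_add, mul_one]
    omega
  rw [ternary, ternary, h2] at *
  omega

/-- This is what makes counting from 0 to `3 ^ L - 1` an exhaustive search through all ternary
arrays. -/
theorem exists_ternary (L : ℕ) (d : ℕ → ℕ) (hd : ∀ j, d j < 3) :
    ∃ v < 3 ^ L, ∀ j < L, ternary v j = d j := by
  induction L with
  | zero => exact ⟨0, by norm_num, by simp⟩
  | succ L ih =>
    obtain ⟨v, hv, h⟩ := ih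
    refine ⟨v + 3 ^ L * d L, ?_, ?_⟩
    · have : 3 ^ L * d L ≤ 3 ^ L * 2 := Nat.mul_le_mul_left _ (by have := hd L; omega)
      rw [pow_succ]; omega
    · intro j hj
      rcases Nat.lt_succ_iff_lt_or_eq.1 hj with hj | rfl
      · rw [← h j hj, ternary, ternary]
        obtain ⟨e, rfl⟩ : ∃ e, L = j + 1 + e := ⟨L - (j + 1), by omega⟩
        rw [pow_add, pow_succ, mul_assoc, mul_assoc, Nat.add_mul_div_left _ _ (by positivity),
          Nat.add_mul_mod_self_left]
      · rw [ternary, Nat.add_mul_div_left _ _ (by positivity), Nat.div_eq_of_lt hv, zero_add,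
          Nat.mod_eq_of_lt (hd j)]

theorem overlay_congr {μ : ℕ → ℕ} {o l : ℕ} {d d' : ℕ → ℕ} (h : ∀ j < l, d j = d' j) :
    overlay μ o l d = overlay μ o l d' := by
  funext x
  unfold overlay
  split_ifs with hx
  · exact h _ (by omega)
  · rfl

theorem update_overlay {μ : ℕ → ℕ} {o l j v : ℕ} {d : ℕ → ℕ} (h : j < l) :
    Function.update (overlay μ o l d) (o + j) v = overlay μ o l (Function.update d j v) := by
  funext x
  by_cases hx : x = o + j
  · subst hx
    simp [overlay, h]
  · rw [Function.update_of_ne hx]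
    unfold overlay
    split_ifs with h'
    · rw [Function.update_of_ne (by omega)]
    · rfl

theorem overlay_apply {μ : ℕ → ℕ} {o l j : ℕ} {d : ℕ → ℕ} (h : j < l) :
    overlay μ o l d (o + j) = d j := by
  simp [overlay, h]

/-- Used with zero digits at both ends of an enumeration: the array is zero at the start and again
after the counter has overflowed, so the memory is restored. -/
theorem overlay_zero {μ : ℕ → ℕ} {o l : ℕ} {d : ℕ → ℕ} (h : ∀ j < l, μ (o + j) = d j) :
    overlay μ o l d = μ := by
  funext x
  unfold overlay
  split_ifs with hx
  · rw [← h _ (by omega)]; congr 1; omega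
  · rfl

end MultilayerMatching

/-! ### Bounds for values, and correctness of the counter increment. -/

namespace MultilayerMatching
namespace Expression

/-- The first 24 values of `ρ` and all values of `μ` are at most `V ^ 8`. -/
structure Bounded (V : ℕ) (μ ρ : ℕ → ℕ) : Prop where
  two_le : 2 ≤ V
  env : ∀ r < 24, ρ r ≤ V ^ 8
  mem : ∀ x, μ x ≤ V ^ 8

namespace Bounded

variable {V : ℕ} {μ ρ : ℕ → ℕ}

theorem two_pow_le (h : Bounded V μ ρ) (j : ℕ) : 2 ^ j ≤ V ^ j := Nat.pow_le_pow_left h.two_le j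

theorem pow_le_pow (h : Bounded V μ ρ) {i j : ℕ} (hij : i ≤ j) : V ^ i ≤ V ^ j :=
  Nat.pow_le_pow_right (by have := h.two_le; omega) hij

theorem update (h : Bounded V μ ρ) {j : ℕ} (y : ℕ) (hj : j ≤ V ^ 8) :
    Bounded V μ (Function.update ρ y j) :=
  ⟨h.two_le, fun r hr => by
    rw [Function.update_apply]; split_ifs
    · exact hj
    · exact h.env r hr, h.mem⟩

theorem overlay (h : Bounded V μ ρ) (o l : ℕ) {d : ℕ → ℕ} (hd : ∀ j, d j < 3) :
    Bounded V (overlay μ o l d) ρ :=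
  ⟨h.two_le, h.env, fun x => by
    unfold MultilayerMatching.overlay; split_ifs
    · have := hd (x - o)
      have := h.two_pow_le 8
      omega
    · exact h.mem x⟩

end Bounded

/-- All atoms are at most `V ^ 8` or `V ^ k`. A product adds exponents, an addition costs a factor
`2 ≤ V`, and a sum has at most `V ^ 8` terms. This rules out overflow. -/
theorem eval_le {V : ℕ} (e : Expression) : ∀ {μ ρ : ℕ → ℕ}, Bounded V μ ρ → e.WellFormed →
    e.eval μ ρ ≤ V ^ e.width := by
  induction e with
  | const k =>
    intro μ ρ h _
    have h1 : k < 2 ^ k := Nat.lt_two_pow_self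
    have h2 := h.two_pow_le k
    have h3 : V ^ k ≤ V ^ (k + 2) := h.pow_le_pow (by omega)
    simp only [eval, width]; omega
  | var x =>
    intro μ ρ h hw
    exact h.env x (by simpa [WellFormed] using hw)
  | arith op a b iha ihb =>
    intro μ ρ h hw
    simp only [WellFormed, Bool.and_eq_true] at hw
    have ha := iha h hw.1
    have hb := ihb h hw.2
    have h1 : V ^ a.width ≤ V ^ max a.width b.width := h.pow_le_pow (le_max_left _ _)
    have h2 : V ^ b.width ≤ V ^ max a.width b.width := h.pow_le_pow (le_max_right _ _)
    have h3 : V ^ max a.width b.width * 2 ≤ V ^ (max a.width b.width + 1) := by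
      rw [pow_succ]; exact Nat.mul_le_mul_left _ h.two_le
    cases op with
    | add => simp only [eval, ArithOp.eval, width]; omega
    | sub => simp only [eval, ArithOp.eval, width]; omega
    | mul =>
      simp only [eval, ArithOp.eval, width]
      rw [pow_add]; exact Nat.mul_le_mul ha hb
    | div =>
      simp only [eval, ArithOp.eval, width]
      have := Nat.div_le_self (a.eval μ ρ) (b.eval μ ρ); omega
    | mod =>
      simp only [eval, ArithOp.eval, width]
      have := Nat.mod_le (a.eval μ ρ) (b.eval μ ρ); omega
  | ite a b c d iha ihb ihc ihd =>
    intro μ ρ h hw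
    simp only [WellFormed, Bool.and_eq_true] at hw
    simp only [eval, width]
    split_ifs
    · exact (ihc h hw.1.2).trans (h.pow_le_pow (by simp))
    · exact (ihd h hw.2).trans (h.pow_le_pow (by simp))
  | load a iha =>
    intro μ ρ h hw
    exact (h.mem _).trans (h.pow_le_pow (by simp [width]))
  | sum y x body ih =>
    intro μ ρ h hw
    simp only [WellFormed, Bool.and_eq_true, decide_eq_true_eq] at hw
    have hx := h.env x (by omega)
    simp only [eval, width]
    calc _ ≤ ∑ j ∈ Finset.range (ρ x), V ^ body.width :=
          Finset.sum_le_sum fun j hj => ih (h.update y (by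
            have := Finset.mem_range.1 hj; omega)) hw.2
      _ = ρ x * V ^ body.width := by simp
      _ ≤ V ^ (8 + body.width) := by rw [pow_add]; exact Nat.mul_le_mul_right _ hx
  | any o l body ih =>
    intro μ ρ h hw
    have : 1 ≤ V ^ (any o l body).width := Nat.one_le_pow _ _ (by have := h.two_le; omega)
    simp only [eval]
    split_ifs <;> omega

/-- Adding one to the counter. -/
theorem incrementLoop_runs {w o k L O v : ℕ} {μ : ℕ → ℕ} (ho : o < k) (hv : v < 3 ^ L)
    (hO : O + L + 3 < 2 ^ w) (j : ℕ) (hj : j ≤ L) (hvj : v % 3 ^ j = 3 ^ j - 1) (s : State)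
    (hs : s.reg o = O ∧ s.reg (k + 1) = 0 ∧ s.reg (k + 2) = 0 ∧ s.reg (k + 3) = 1 ∧
      s.reg (k + 4) = 2 ∧ s.reg (k + 5) = j ∧ s.reg (k + 6) = L)
    (hmem : s.mem = overlay μ O L fun i => if i < j then 0 else ternary v i) :
    Runs w (incrementLoop o k) s (8 * (L - j) + 1) fun s' =>
      s'.mem = overlay μ O L (ternary (v + 1)) ∧
      s'.reg (k + 1) = (if v + 1 < 3 ^ L then 1 else 0) ∧
      ∀ r, r < k + 1 ∨ (k + 1 < r ∧ r < k + 5) → s'.reg r = s.reg r := by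
  -- Induction on the positions left: the lowest `j` digits were all 2 and have already been
  -- replaced by 0. A position costs at most 7 steps and one test.
  induction h : L - j generalizing j s with
  | zero =>
    obtain rfl : j = L := by omega
    obtain ⟨-, h1, -, -, -, h5, h6⟩ := hs
    -- Every digit was 2: the counter wraps around to zero and the flag in register `k + 1` stays 0.
    refine Runs.loop_exit (by omega) (by omega) ⟨?_, ?_, fun _ _ => rfl⟩
    · rw [hmem]
      exact overlay_congr fun i hi => by rw [if_pos hi, ternary_succ_of_lt hvj hi]
    · rw [Nat.mod_eq_of_lt hv] at hvj
      rw [h1, if_neg (by omega)]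
  | succ m ih =>
    obtain ⟨h0, h1, h2, h3, h4, h5, h6⟩ := hs
    have hread : s.mem (O + j) = ternary v j := by
      rw [hmem, overlay_apply (by omega)]; simp
    have ht := ternary_lt v j
    unfold incrementLoop
    refine Runs.loop_step (T' := 7) (by omega) ?_ (by omega)
    refine Runs.seq_instr (i := .arith .add (k + 7) o (k + 5))
      (State.setReg_eq (w := w) s (v := O + j) (by omega) |> fun h => by
        simpa [Instr.run, ArithOp.eval, h0, h5] using h) (by omega) ?_
    refine Runs.seq_instr (i := .load (k + 8) (k + 7))
      (State.setReg_eq (w := w) _ (v := ternary v j) (by omega) |> fun h => by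
        simpa [Instr.run, hread] using h) (by omega) ?_
    refine Runs.ite (by omega) (fun hlt => ?_) (fun hlt => ?_)
    · replace hlt : ternary v j < 2 := by simpa [h4] using hlt
      refine Runs.seq_instr (i := .arith .add (k + 8) (k + 8) (k + 3))
        (State.setReg_eq (w := w) _ (v := ternary v j + 1) (by omega) |> fun h => by
          simpa [Instr.run, ArithOp.eval, h3, Function.update_apply] using h) (by omega) ?_
      refine Runs.seq_instr (i := .store (k + 7) (k + 8)) rfl (by omega) ?_
      refine Runs.seq_instr (i := .const (k + 1) 1) (State.setReg_eq (w := w) _ (by omega)) (by omega) ?_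
      refine Runs.instr (i := .const (k + 6) 0) (State.setReg_eq (w := w) _ (by omega)) (by omega) ?_
      -- The carry has been absorbed; setting the loop bound in register `k + 6` to 0 ends the loop.
      refine Runs.loop_exit (by simp) (by omega) ⟨?_, ?_, ?_⟩
      · simp only [hmem]
        norm_num [Function.update_apply]
        rw [update_overlay (by omega)]
        refine overlay_congr fun i hi => ?_
        rw [Function.update_apply]
        rcases lt_trichotomy i j with hij | rfl | hij
        · rw [if_neg (by omega), if_pos hij, ternary_succ_of_lt hvj hij]
        · rw [if_pos rfl, ternary_succ_self hvj hlt]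
        · rw [if_neg (by omega), if_neg (by omega), ternary_succ_of_ge hvj hlt hij]
      -- If `v + 1` were `3 ^ L`, its digit `j` would be 0, but it has just been increased.
      · have h7 : v + 1 < 3 ^ L := by
          by_contra hcon
          have h8 := ternary_succ_self hvj hlt
          rw [show v + 1 = 3 ^ L by omega, ternary,
            Nat.pow_div (by omega) (by norm_num), show L - j = (L - j - 1) + 1 by omega, pow_succ,
            Nat.mul_mod_left] at h8
          omega
        simp [h7]
      · intro r hr
        simp only [Function.update_apply]
        rw [if_neg (by omega), if_neg (by omega), if_neg (by omega), if_neg (by omega),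
          if_neg (by omega)]
    · simp [h4] at hlt
      refine Runs.seq_instr (i := .store (k + 7) (k + 2)) rfl (by omega) ?_
      refine Runs.instr (i := .arith .add (k + 5) (k + 5) (k + 3))
        (State.setReg_eq (w := w) _ (v := j + 1) (by omega) |> fun h => by
          simpa [Instr.run, ArithOp.eval, h3, h5, Function.update_apply] using h) (by omega) ?_
      refine (ih (j + 1) (by omega) ?_ _ ?_ ?_ (by omega)).mono (by omega) ?_
      · rw [mod_pow_succ_eq_ternary, hvj, show ternary v j = 2 by omega, pow_succ]
        have : 0 < 3 ^ j := by positivity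
        omega
      · simp only [Function.update_apply]
        have : o ≠ k + 5 := by omega
        have : o ≠ k + 7 := by omega
        have : o ≠ k + 8 := by omega
        simp [*]
      · norm_num [h2, hmem]
        rw [update_overlay (by omega)]
        refine overlay_congr fun i hi => ?_
        rw [Function.update_apply]
        split_ifs <;> first | rfl | omega
      · rintro s' ⟨e1, e2, e3⟩
        refine ⟨e1, e2, fun r hr => ?_⟩
        rw [e3 r hr]
        simp only [Function.update_apply]
        rw [if_neg (by omega), if_neg (by omega), if_neg (by omega)]

end Expression
end MultilayerMatching

/-! ### Correctness of the compiler. -/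

namespace MultilayerMatching
namespace Expression

/-- Induction on the number of arrays left. At counter value `v` the array holds the digits of `v`,
and register `k` tells whether an earlier array made the body positive; `g` is the value of the body
as a function of the array. -/
theorem anyLoop_runs {w o l k L O B : ℕ} {μ ρ : ℕ → ℕ} {p : Prog} {g : (ℕ → ℕ) → ℕ}
    (ho : o < k) (hl : l < k) (hρo : ρ o = O) (hρl : ρ l = L) (hO : O + L + 3 < 2 ^ w)
    (hp : ∀ (s : State) (d : ℕ → ℕ), (∀ j, d j < 3) → s.mem = overlay μ O L d →
      (∀ r < k, s.reg r = ρ r) → Runs w p s B fun s' =>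
        s'.mem = s.mem ∧ (∀ r < k + 8, s'.reg r = s.reg r) ∧ s'.reg (k + 8) = g d)
    (v : ℕ) (hv : v < 3 ^ L) (s : State) (hs : ∀ r < k, s.reg r = ρ r)
    (h0 : s.reg k = 0 ∨ s.reg k = 1)
    (hk : s.reg (k + 1) = 1 ∧ s.reg (k + 2) = 0 ∧ s.reg (k + 3) = 1 ∧ s.reg (k + 4) = 2)
    (hmem : s.mem = overlay μ O L (ternary v)) :
    Runs w (anyLoop o l k p) s ((3 ^ L - v) * (B + 8 * L + 7) + 1) fun s' =>
      s'.mem = overlay μ O L (ternary (3 ^ L)) ∧ (∀ r < k, s'.reg r = ρ r) ∧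
      (s'.reg k = 0 ∨ s'.reg k = 1) ∧
      (s'.reg k = 1 ↔ s.reg k = 1 ∨ ∃ u < 3 ^ L, v ≤ u ∧ 0 < g (ternary u)) := by
  induction h : 3 ^ L - v generalizing v s with
  | zero => omega
  | succ m ih =>
    obtain ⟨k1, k2, k3, k4⟩ := hk
    have hT : (m + 1) * (B + 8 * L + 7) = m * (B + 8 * L + 7) + (B + 8 * L + 7) := by ring
    rw [hT]
    generalize hX : m * (B + 8 * L + 7) = X at *
    unfold anyLoop
    refine Runs.loop_step (T' := B + 8 * L + 6) (by omega) ?_ (by omega)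
    refine Runs.seq (T' := B) ?_ (by omega)
    refine (hp s _ (ternary_lt v) hmem hs).mono le_rfl ?_
    rintro s₁ ⟨m₁, r₁, g₁⟩
    refine Runs.seq (T' := 2) ?_ (by omega)
    have key : Runs w (.ite (k + 2) (k + 8) (.instr (.const k 1)) .skip) s₁ 2 fun s₂ =>
        s₂.mem = s.mem ∧ (∀ r < k + 8, r ≠ k → s₂.reg r = s.reg r) ∧
        (s₂.reg k = 0 ∨ s₂.reg k = 1) ∧
        (s₂.reg k = 1 ↔ s.reg k = 1 ∨ 0 < g (ternary v)) := by
      have a1 := r₁ (k + 2) (by omega)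
      have a2 := r₁ k (by omega)
      refine Runs.ite (by omega) (fun hlt => ?_) (fun hlt => ?_)
      · refine Runs.instr (i := .const k 1) (State.setReg_eq (w := w) _ (by omega)) (by omega) ?_
        refine ⟨m₁, fun r hr hr' => ?_, ?_⟩
        · simp only
          rw [Function.update_of_ne hr', r₁ r hr]
        · simp; right; omega
      · refine Runs.skip (by omega) ⟨m₁, fun r hr _ => r₁ r hr, ?_, ?_⟩
        · rw [a2]; exact h0
        · have : ¬ 0 < g (ternary v) := by omega
          simp [a2, this]
    refine key.mono le_rfl ?_
    rintro s₂ ⟨m₂, r₂, b₂, c₂⟩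
    refine Runs.seq_instr (i := .const (k + 1) 0) (State.setReg_eq (w := w) _ (by omega))
      (by omega) ?_
    refine Runs.seq_instr (i := .const (k + 5) 0) (State.setReg_eq (w := w) _ (by omega))
      (by omega) ?_
    refine Runs.seq_instr (i := .copy (k + 6) l)
      (State.setReg_eq (w := w) _ (v := L) (by omega) |> fun h => by
        have h1 : l ≠ k + 1 := by omega
        have h5 : l ≠ k + 5 := by omega
        have := r₂ l (by omega) (by omega)
        simpa [Instr.run, Function.update_apply, h1, h5, this, hs l hl, hρl] using h)
      (by omega) ?_
    refine (incrementLoop_runs (L := L) (O := O) (v := v) (μ := μ) ho hv hO 0 (by omega)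
      (by simp [Nat.mod_one]) _ ?_ ?_).mono (by omega) ?_
    · have h1 : o ≠ k + 1 := by omega
      have h5 : o ≠ k + 5 := by omega
      have h6 : o ≠ k + 6 := by omega
      have := r₂ o (by omega) (by omega)
      have := r₂ (k + 2) (by omega) (by omega)
      have := r₂ (k + 3) (by omega) (by omega)
      have := r₂ (k + 4) (by omega) (by omega)
      simp [*]
    · simp [m₂, hmem]
    rintro s₃ ⟨m₃, g₃, r₃⟩
    have e₃ : ∀ r < k, s₃.reg r = ρ r := fun r hr => by
      rw [r₃ r (by omega)]
      simp only [Function.update_apply]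
      rw [if_neg (by omega), if_neg (by omega), if_neg (by omega), r₂ r (by omega) (by omega),
        hs r hr]
    have f₃ : s₃.reg k = s₂.reg k := by
      rw [r₃ k (by omega)]; simp
    have i₃ : ∀ i, 1 < i → i < 5 → s₃.reg (k + i) = s.reg (k + i) := fun i h1 h2 => by
      rw [r₃ _ (by omega)]
      simp only [Function.update_apply]
      rw [if_neg (by omega), if_neg (by omega), if_neg (by omega), r₂ _ (by omega) (by omega)]
    have hX' : X + (B + 8 * L + 7) + 1 - (B + 8 * L + 6) - 1 = X + 1 := by omega
    -- The overflow flag decides whether another round follows; in the other case `v` was the last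
    -- array.
    by_cases hv' : v + 1 < 3 ^ L
    · refine (ih (v + 1) hv' s₃ e₃ (by rw [f₃]; exact b₂) ⟨by simp [g₃, hv'], ?_, ?_, ?_⟩ m₃
        (by omega)).mono (by omega) ?_
      · rw [i₃ 2 (by omega) (by omega), k2]
      · rw [i₃ 3 (by omega) (by omega), k3]
      · rw [i₃ 4 (by omega) (by omega), k4]
      · rintro s' ⟨a1, a2, a3, a4⟩
        refine ⟨a1, a2, a3, a4.trans ?_⟩
        rw [f₃, c₂, or_assoc]
        refine or_congr_right ⟨?_, ?_⟩
        · rintro (h | ⟨u, h1, h2, h3⟩)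
          · exact ⟨v, hv, le_rfl, h⟩
          · exact ⟨u, h1, by omega, h3⟩
        · rintro ⟨u, h1, h2, h3⟩
          rcases h2.eq_or_lt with rfl | h2
          · exact Or.inl h3
          · exact Or.inr ⟨u, h1, h2, h3⟩
    · have hv3 : v + 1 = 3 ^ L := by omega
      refine Runs.loop_exit (by simp [g₃, hv', i₃]) (by omega) ⟨by rw [m₃, hv3], e₃,
        by rw [f₃]; exact b₂, ?_⟩
      rw [f₃, c₂]
      refine or_congr_right ⟨fun h => ⟨v, hv, le_rfl, h⟩, ?_⟩
      rintro ⟨u, h1, h2, h3⟩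
      obtain rfl : u = v := by omega
      exact h3

/-- The compiled program computes the value of the expression within the time bound, restores the
memory, and leaves all registers below the target register unchanged. -/
theorem compile_runs {w V : ℕ} {ρ₀ : ℕ → ℕ} (e : Expression) : ∀ (k : ℕ) (s : State) (ρ : ℕ → ℕ),
    e.WellFormed → 24 ≤ k → (∀ r < 24, s.reg r = ρ r) → (∀ r < 10, ρ r = ρ₀ r) →
    Bounded V s.mem ρ → e.ScratchFree s.mem ρ₀ → V ^ e.width < 2 ^ w →
    Runs w (e.compile k) s (e.cost ρ₀) fun s' =>
      s'.mem = s.mem ∧ (∀ r < k, s'.reg r = s.reg r) ∧ s'.reg k = e.eval s.mem ρ := by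
  -- The environment `ρ` varies with the loop variables, which lie in registers from 10 on, whereas
  -- `ρ₀` stays fixed. Both agree on the loop bounds and array positions, so cost and scratch space
  -- can be measured in `ρ₀` throughout.
  induction e with
  | const c =>
    intro k s ρ hw hk hs hρ hb hf hV
    refine Runs.instr (i := .const k c) (State.setReg_eq (w := w) s ?_) le_rfl
      ⟨rfl, fun r hr => ?_, ?_⟩
    · exact (eval_le (const c) hb rfl).trans_lt hV
    · simp only
      rw [Function.update_of_ne hr.ne]
    · simp [eval]
  | var x =>
    intro k s ρ hw hk hs hρ hb hf hV
    have hx : x < 24 := by simpa [WellFormed] using hw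
    refine Runs.instr (i := .copy k x) (State.setReg_eq (w := w) s ?_) le_rfl
      ⟨rfl, fun r hr => ?_, ?_⟩
    · rw [hs x hx]
      exact (eval_le (var x) hb hw).trans_lt hV
    · simp only
      rw [Function.update_of_ne hr.ne]
    · simp [eval, hs x hx]
  | arith op a b iha ihb =>
    intro k s ρ hw hk hs hρ hb hf hV
    have hle := (eval_le _ hb hw).trans_lt hV
    simp only [WellFormed, Bool.and_eq_true] at hw
    have hwa : V ^ a.width < 2 ^ w := (hb.pow_le_pow (by cases op <;> simp [width] <;> omega)).trans_lt hV
    have hwb : V ^ b.width < 2 ^ w := (hb.pow_le_pow (by cases op <;> simp [width] <;> omega)).trans_lt hV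
    refine Runs.seq (T' := a.cost ρ₀) ?_ (by simp only [cost]; omega)
    refine (iha k s ρ hw.1 hk hs hρ hb hf.1 hwa).mono le_rfl ?_
    rintro s₁ ⟨m₁, r₁, e₁⟩
    refine Runs.seq (T' := b.cost ρ₀) ?_ (by simp only [cost]; omega)
    refine (ihb (k + 1) s₁ ρ hw.2 (by omega) (fun r hr => by rw [r₁ r (by omega), hs r hr]) hρ
      (m₁ ▸ hb) (m₁ ▸ hf.2) hwb).mono le_rfl ?_
    rintro s₂ ⟨m₂, r₂, e₂⟩
    rw [m₁] at e₂
    have e₁' : s₂.reg k = a.eval s.mem ρ := by rw [r₂ k (by omega), e₁]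
    refine Runs.instr (i := .arith op k k (k + 1)) (State.setReg_eq (w := w) _ ?_)
      (by simp only [cost]; omega) ⟨by simp [m₁, m₂], fun r hr => ?_, ?_⟩
    · rw [e₁', e₂]; exact hle
    · simp only
      rw [Function.update_of_ne hr.ne, r₂ r (by omega), r₁ r hr]
    · simp [e₁', e₂, eval]
  | ite a b c d iha ihb ihc ihd =>
    intro k s ρ hw hk hs hρ hb hf hV
    simp only [WellFormed, Bool.and_eq_true] at hw
    have hwa : V ^ a.width < 2 ^ w := (hb.pow_le_pow (by simp [width])).trans_lt hV
    have hwb : V ^ b.width < 2 ^ w := (hb.pow_le_pow (by simp [width])).trans_lt hV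
    have hwc : V ^ c.width < 2 ^ w := (hb.pow_le_pow (by simp [width])).trans_lt hV
    have hwd : V ^ d.width < 2 ^ w := (hb.pow_le_pow (by simp [width])).trans_lt hV
    refine Runs.seq (T' := a.cost ρ₀) ?_ (by simp only [cost]; omega)
    refine (iha k s ρ hw.1.1.1 hk hs hρ hb hf.1 hwa).mono le_rfl ?_
    rintro s₁ ⟨m₁, r₁, e₁⟩
    refine Runs.seq (T' := b.cost ρ₀) ?_ (by simp only [cost]; omega)
    refine (ihb (k + 1) s₁ ρ hw.1.1.2 (by omega) (fun r hr => by rw [r₁ r (by omega), hs r hr]) hρ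
      (m₁ ▸ hb) (m₁ ▸ hf.2.1) hwb).mono le_rfl ?_
    rintro s₂ ⟨m₂, r₂, e₂⟩
    rw [m₁] at e₂ m₂
    have e₁' : s₂.reg k = a.eval s.mem ρ := by rw [r₂ k (by omega), e₁]
    have hs₂ : ∀ r < 24, s₂.reg r = ρ r := fun r hr => by
      rw [r₂ r (by omega), r₁ r (by omega), hs r hr]
    refine Runs.ite (by simp only [cost]; omega) (fun h => ?_) (fun h => ?_) <;>
      rw [e₁', e₂] at h
    · refine (ihc k s₂ ρ hw.1.2 hk hs₂ hρ (m₂ ▸ hb) (m₂ ▸ hf.2.2.1) hwc).mono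
        (by simp only [cost]; omega) ?_
      rintro s₃ ⟨m₃, r₃, e₃⟩
      refine ⟨by rw [m₃, m₂], fun r hr => by rw [r₃ r hr, r₂ r (by omega), r₁ r hr], ?_⟩
      rw [e₃, m₂, eval, if_pos h]
    · refine (ihd k s₂ ρ hw.2 hk hs₂ hρ (m₂ ▸ hb) (m₂ ▸ hf.2.2.2) hwd).mono
        (by simp only [cost]; omega) ?_
      rintro s₃ ⟨m₃, r₃, e₃⟩
      refine ⟨by rw [m₃, m₂], fun r hr => by rw [r₃ r hr, r₂ r (by omega), r₁ r hr], ?_⟩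
      rw [e₃, m₂, eval, if_neg h]
  | load a iha =>
    intro k s ρ hw hk hs hρ hb hf hV
    have hle := (eval_le _ hb hw).trans_lt hV
    have hwa : V ^ a.width < 2 ^ w := (hb.pow_le_pow (by simp [width])).trans_lt hV
    refine Runs.seq (T' := a.cost ρ₀) ?_ (by simp only [cost]; omega)
    refine (iha k s ρ hw hk hs hρ hb hf hwa).mono le_rfl ?_
    rintro s₁ ⟨m₁, r₁, e₁⟩
    refine Runs.instr (i := .load k k) (State.setReg_eq (w := w) _ ?_)
      (by simp only [cost]; omega) ⟨m₁, fun r hr => ?_, ?_⟩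
    · rw [e₁, m₁]; exact hle
    · simp only
      rw [Function.update_of_ne hr.ne, r₁ r hr]
    · simp [e₁, m₁, eval]
  | sum y x body ih =>
    intro k s ρ hw hk hs hρ hb hf hV
    have hle := (eval_le _ hb hw).trans_lt hV
    simp only [WellFormed, Bool.and_eq_true, decide_eq_true_eq] at hw
    obtain ⟨⟨⟨hy, hy'⟩, hx⟩, hw⟩ := hw
    have h8 : V ^ 8 < 2 ^ w := (hb.pow_le_pow (by simp [width])).trans_lt hV
    have hwb : V ^ body.width < 2 ^ w := (hb.pow_le_pow (by simp [width])).trans_lt hV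
    have hx8 : ρ x ≤ V ^ 8 := hb.env x (by omega)
    have hy8 : ρ y ≤ V ^ 8 := hb.env y (by omega)
    have h2 : 2 ≤ V ^ 8 := by have := hb.two_pow_le 8; omega
    have hcost : (sum y x body).cost ρ₀ = ρ x * (body.cost ρ₀ + 2 + 1) + 1 + 6 := by
      simp only [cost]; rw [← hρ x hx]
    rw [hcost]
    set S : ℕ → ℕ := fun j => ∑ i ∈ Finset.range j, body.eval s.mem (Function.update ρ y i) with hS
    -- Partial sums are bounded by the full sum, so the accumulator never overflows.
    have hSle : ∀ j ≤ ρ x, S j < 2 ^ w := fun j hj => by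
      refine lt_of_le_of_lt ?_ hle
      simp only [hS, eval]
      exact Finset.sum_le_sum_of_subset (by simpa using hj)
    refine Runs.seq_instr (i := .copy k y) (State.setReg_eq (w := w) _ ?_) (by omega) ?_
    · rw [hs y hy']; omega
    refine Runs.seq_instr (i := .const (k + 1) 0) (State.setReg_eq (w := w) _ (by omega))
      (by omega) ?_
    refine Runs.seq_instr (i := .const (k + 2) 1) (State.setReg_eq (w := w) _ (by omega))
      (by omega) ?_
    refine Runs.seq_instr (i := .const y 0) (State.setReg_eq (w := w) _ (by omega))
      (by omega) ?_
    refine Runs.seq (T' := ρ x * (body.cost ρ₀ + 2 + 1) + 1) ?_ (by omega)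
    -- The loop variable `y` is a register below `k` and must not change in the end: its old value
    -- waits in register `k` and is copied back after the loop. Register `k + 1` accumulates the
    -- sum.
    refine (Runs.for_loop (N := ρ x) (B := body.cost ρ₀ + 2)
      (I := fun j s' => s'.mem = s.mem ∧ (∀ r < k, r ≠ y → s'.reg r = s.reg r) ∧ s'.reg y = j ∧
        s'.reg k = ρ y ∧ s'.reg (k + 1) = S j ∧ s'.reg (k + 2) = 1) ?_ ?_ 0 (by omega) _ ?_).mono
        (by simp) ?_
    · rintro j s' ⟨-, h, h', -⟩
      exact ⟨h', by rw [h x (by omega) (by omega), hs x (by omega)]⟩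
    · rintro j s₁ hj ⟨m₁, r₁, y₁, k₁, e₁, f₁⟩
      refine Runs.seq (T' := body.cost ρ₀) ?_ (by omega)
      refine (ih (k + 3) s₁ (Function.update ρ y j) hw (by omega) ?_ ?_ ?_ ?_ hwb).mono le_rfl ?_
      · intro r hr
        rw [Function.update_apply]
        split_ifs with h
        · rw [h, y₁]
        · rw [r₁ r (by omega) h, hs r hr]
      · intro r hr
        rw [Function.update_of_ne (by omega), hρ r hr]
      · rw [m₁]; exact hb.update y (by omega)
      · rw [m₁]; exact hf
      rintro s₂ ⟨m₂, r₂, e₂⟩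
      have hadd : s₂.reg (k + 1) + s₂.reg (k + 3) = S (j + 1) := by
        rw [e₂, r₂ _ (by omega), e₁, m₁]
        simp only [hS]
        rw [Finset.sum_range_succ]
      refine Runs.seq_instr (i := .arith .add (k + 1) (k + 1) (k + 3))
        (State.setReg_eq (w := w) _ ?_) (by omega) ?_
      · simp only [ArithOp.eval]; rw [hadd]; exact hSle _ (by omega)
      have hyk : y ≠ k + 1 := by omega
      have hadd2 : ArithOp.eval .add (Function.update s₂.reg (k + 1) (s₂.reg (k + 1) + s₂.reg (k + 3)) y)
          (Function.update s₂.reg (k + 1) (s₂.reg (k + 1) + s₂.reg (k + 3)) (k + 2)) = j + 1 := by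
        rw [Function.update_of_ne hyk, Function.update_of_ne (by omega), r₂ _ (by omega),
          r₂ _ (by omega), f₁, y₁]
        rfl
      refine Runs.instr (i := .arith .add y y (k + 2))
        (State.setReg_eq (w := w) _ ?_) (by omega) ⟨?_, ?_, ?_, ?_, ?_, ?_⟩
      · simp only [ArithOp.eval] at hadd2 ⊢; rw [hadd2]; omega
      · simp [m₂, m₁]
      · intro r hr hry
        simp only
        rw [Function.update_of_ne hry, Function.update_of_ne (by omega), r₂ r (by omega),
          r₁ r hr hry]
      · simp only [ArithOp.eval, Function.update_self] at hadd2 ⊢; rw [hadd2]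
      · simp only
        rw [Function.update_of_ne (by omega), Function.update_of_ne (by omega), r₂ k (by omega), k₁]
      · simp only
        rw [Function.update_of_ne (by omega), Function.update_self]
        simpa [ArithOp.eval] using hadd
      · simp only
        rw [Function.update_of_ne (by omega), Function.update_of_ne (by omega), r₂ _ (by omega), f₁]
    · have h1 : k ≠ y := by omega
      have h2 : k + 1 ≠ y := by omega
      have h3 : k + 2 ≠ y := by omega
      refine ⟨rfl, fun r hr hry => ?_, ?_⟩
      · simp only [Function.update_apply]
        rw [if_neg hry, if_neg (by omega), if_neg (by omega), if_neg (by omega)]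
      · simp [h1, h2, h3, hs y hy', hS]
    · rintro s₂ ⟨m₂, r₂, y₂, k₂, e₂, f₂⟩
      have hyk : y ≠ k := by omega
      refine Runs.seq_instr (i := .copy y k) (State.setReg_eq (w := w) _ ?_) (by omega) ?_
      · omega
      have h3 : (Function.update s₂.reg y (s₂.reg k)) (k + 1) = S (ρ x) := by
        rw [Function.update_of_ne (by omega), e₂]
      refine Runs.instr (i := .copy k (k + 1)) (State.setReg_eq (w := w) _ ?_) (by omega)
        ⟨?_, ?_, ?_⟩
      · simp only; rw [h3]; exact hSle _ le_rfl
      · exact m₂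
      · intro r hr
        simp only
        rw [Function.update_of_ne hr.ne]
        by_cases h : r = y
        · rw [h, Function.update_self, k₂, hs y hy']
        · rw [Function.update_of_ne h, r₂ r hr h]
      · simp only
        rw [Function.update_self, h3]; rfl
  | any o l body ih =>
    intro k s ρ hw hk hs hρ hb hf hV
    simp only [WellFormed, Bool.and_eq_true, decide_eq_true_eq] at hw
    obtain ⟨⟨ho, hl⟩, hw⟩ := hw
    have h10 : V ^ 10 < 2 ^ w := (hb.pow_le_pow (by simp [width])).trans_lt hV
    have hwb : V ^ body.width < 2 ^ w := (hb.pow_le_pow (by simp [width])).trans_lt hV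
    -- Addresses of array cells stay below `4 * V ^ 8 ≤ V ^ 10`, which is why the width of a
    -- quantification is at least 10.
    have hO : ρ o + ρ l + 3 < 2 ^ w := by
      have h1 := hb.env o (by omega)
      have h2 := hb.env l (by omega)
      have h3 := hb.two_pow_le 8
      have h4 : V ^ 8 * 2 ^ 2 ≤ V ^ 10 := by
        rw [show (10 : ℕ) = 8 + 2 from rfl, pow_add]
        exact Nat.mul_le_mul_left _ (hb.two_pow_le 2)
      omega
    have h1 : 2 < 2 ^ w := by omega
    simp only [cost, ScratchFree] at hf ⊢
    rw [← hρ o ho, ← hρ l hl] at hf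
    rw [← hρ l hl]
    obtain ⟨hz, hf⟩ := hf
    -- All digits of `3 ^ L` below position `L` are 0, so the overflow restores the array.
    have hz' : overlay s.mem (ρ o) (ρ l) (ternary (3 ^ ρ l)) = s.mem :=
      overlay_zero fun j hj => by
        rw [hz j hj, ternary, Nat.pow_div hj.le (by norm_num),
          show ρ l - j = (ρ l - j - 1) + 1 by omega, pow_succ, Nat.mul_mod_left]
    have hz0 : overlay s.mem (ρ o) (ρ l) (ternary 0) = s.mem :=
      overlay_zero fun j hj => by rw [hz j hj, ternary]; simp
    refine Runs.seq_instr (i := .const k 0) (State.setReg_eq (w := w) _ (by omega))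
      (by omega) ?_
    refine Runs.seq_instr (i := .const (k + 1) 1) (State.setReg_eq (w := w) _ (by omega))
      (by omega) ?_
    refine Runs.seq_instr (i := .const (k + 2) 0) (State.setReg_eq (w := w) _ (by omega))
      (by omega) ?_
    refine Runs.seq_instr (i := .const (k + 3) 1) (State.setReg_eq (w := w) _ (by omega))
      (by omega) ?_
    refine Runs.seq_instr (i := .const (k + 4) 2) (State.setReg_eq (w := w) _ (by omega))
      (by omega) ?_
    refine (anyLoop_runs (g := fun d => body.eval (overlay s.mem (ρ o) (ρ l) d) ρ) (ρ := s.reg)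
      (μ := s.mem) (B := body.cost ρ₀)
      (by omega) (by omega) (hs o (by omega)) (hs l (by omega)) hO ?_ 0 (by positivity) _ ?_ ?_ ?_
      ?_).mono ?_ ?_
    · intro s₁ d hd hm hr
      have := ih (k + 8) s₁ ρ hw (by omega)
        (fun r h => by rw [hr r (by omega), hs r h]) hρ
        (by rw [hm]; exact hb.overlay _ _ hd) (by rw [hm]; exact hf d hd) hwb
      rw [hm] at this ⊢
      exact this
    · intro r hr
      simp only [Function.update_apply]
      rw [if_neg (by omega), if_neg (by omega), if_neg (by omega), if_neg (by omega),
        if_neg (by omega)]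
    · simp
    · simp
    · exact hz0.symm
    · rw [Nat.sub_zero]; omega
    · rintro s' ⟨m', r', c', d'⟩
      refine ⟨by rw [m', hz'], r', ?_⟩
      have hiff : s'.reg k = 1 ↔
          ∃ d : ℕ → ℕ, (∀ j, d j < 3) ∧ 0 < body.eval (overlay s.mem (ρ o) (ρ l) d) ρ := by
        rw [d']
        simp
        constructor
        · rintro ⟨u, h1, h2⟩
          exact ⟨_, ternary_lt u, h2⟩
        · rintro ⟨d, hd, h2⟩
          obtain ⟨v, hv, h3⟩ := exists_ternary (ρ l) d hd
          refine ⟨v, hv, ?_⟩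
          rwa [overlay_congr h3]
      rw [eval]
      split_ifs with h
      · exact hiff.2 h
      · rcases c' with c' | c'
        · exact c'
        · exact absurd (hiff.1 c') h

end Expression
end MultilayerMatching

namespace MultilayerMatching

/-! ### Balanced colourings of pairings -/

section Pairing

variable {α : Type*} [Fintype α]

/-- Group the elements of each type into couples, leaving at most one over. The couples and the
pairs of `f` are two matchings, so their union has only even cycles and paths, and it can be
two-coloured. The induction contracts one couple `x`, `y` at a time. -/
theorem exists_balanced_coloring [DecidableEq α] (t : α → ℕ) (m : ℕ) : ∀ (S : Finset α) (f : α → α), S.card = m →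
    (∀ x ∈ S, f x ∈ S ∧ f (f x) = x ∧ f x ≠ x) →
    ∃ col : α → Bool, (∀ x ∈ S, col (f x) = !col x) ∧ ∀ P b,
      (S.filter fun x => t x = P ∧ col x = b).card ≤
        (S.filter fun x => t x = P ∧ col x = !b).card + 1 := by
  induction m using Nat.strong_induction_on with
  | _ m ih =>
  intro S f hm hf
  by_cases h : ∃ x ∈ S, ∃ y ∈ S, x ≠ y ∧ t x = t y
  · obtain ⟨x, hx, y, hy, hxy, hxyt⟩ := h
    set S' := (S.erase x).erase y with hS'
    have hmem : ∀ z, z ∈ S' ↔ z ∈ S ∧ z ≠ x ∧ z ≠ y := fun z => by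
      simp only [hS', Finset.mem_erase]; tauto
    have hS : S = insert x (insert y S') := by
      ext z
      simp only [Finset.mem_insert, hmem]
      by_cases h1 : z = x
      · simp [h1, hx]
      by_cases h2 : z = y
      · simp [h2, hy]
      simp [h1, h2]
    have hcard : S'.card < m := by
      rw [← hm]
      refine Finset.card_lt_card ⟨fun z hz => ((hmem z).1 hz).1, fun h => ?_⟩
      exact ((hmem x).1 (h hx)).2.1 rfl
    -- Two elements of equal type and opposite colours add one to each side of that type and nothing
    -- elsewhere.
    have key : ∀ col : α → Bool, col x = !col y → (∀ P b,
        (S'.filter fun x => t x = P ∧ col x = b).card ≤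
          (S'.filter fun x => t x = P ∧ col x = !b).card + 1) → ∀ P b,
        (S.filter fun x => t x = P ∧ col x = b).card ≤
          (S.filter fun x => t x = P ∧ col x = !b).card + 1 := by
      intro col hcol hb P b
      have hb := hb P b
      have h1 : x ∉ insert y S' := by simp [hmem, hxy]
      have h2 : y ∉ S' := by simp [hmem]
      have hc : ∀ b, (S.filter fun x => t x = P ∧ col x = b).card =
          (if t x = P then 1 else 0) + (S'.filter fun x => t x = P ∧ col x = b).card := by
        intro b
        rw [Finset.card_filter, hS, Finset.sum_insert h1, Finset.sum_insert h2,
          ← Finset.card_filter, ← add_assoc, ← hxyt, hcol]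
        congr 1
        by_cases h3 : t x = P <;> cases b <;> cases col y <;> simp [h3]
      rw [hc, hc]
      omega
    by_cases hyx : y = f x
    · obtain ⟨col, h1, h2⟩ := ih _ hcard S' f rfl (fun z hz => by
        obtain ⟨hz1, hz2, hz3⟩ := (hmem z).1 hz
        obtain ⟨a1, a2, a3⟩ := hf z hz1
        refine ⟨(hmem _).2 ⟨a1, ?_, ?_⟩, a2, a3⟩
        · rintro h; rw [h, ← hyx] at a2; exact hz3 a2.symm
        · rintro h; rw [h, hyx, (hf x hx).2.1] at a2; exact hz2 a2.symm)
      have e : ∀ z ∈ S', Function.update (Function.update col x true) y false z = col z :=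
        fun z hz => by
          rw [Function.update_of_ne ((hmem z).1 hz).2.2,
            Function.update_of_ne ((hmem z).1 hz).2.1]
      refine ⟨Function.update (Function.update col x true) y false, ?_, key _ ?_ ?_⟩
      · intro z hz
        by_cases hzx : z = x
        · rw [hzx, ← hyx]; simp [hxy]
        by_cases hzy : z = y
        · rw [hzy, hyx, (hf x hx).2.1, ← hyx]; simp [hxy]
        have hz' : z ∈ S' := (hmem z).2 ⟨hz, hzx, hzy⟩
        have hfz : f z ∈ S' := (hmem _).2 ⟨(hf z hz).1, fun h => by
          have := (hf z hz).2.1; rw [h, ← hyx] at this; exact hzy this.symm, fun h => by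
          have := (hf z hz).2.1; rw [h, hyx, (hf x hx).2.1] at this; exact hzx this.symm⟩
        rw [e z hz', e _ hfz, h1 z hz']
      · simp [hxy]
      · intro P b
        have h3 : ∀ b, (S'.filter fun z => t z = P ∧ (Function.update (Function.update col x true) y false) z = b) =
            S'.filter fun z => t z = P ∧ col z = b := fun b =>
          Finset.filter_congr fun z hz => by rw [e z hz]
        rw [h3, h3]
        exact h2 P b
    · obtain ⟨fx1, fx2, fx3⟩ := hf x hx
      obtain ⟨fy1, fy2, fy3⟩ := hf y hy
      have hfxy : f x ≠ f y := fun h => hxy (by rw [← fx2, h, fy2])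
      have hfyx : f y ≠ x := fun h => hyx (by rw [← fy2, h])
      -- The path from `f x` over `x` and `y` to `f y` is contracted to the single pair `f x`, `f
      -- y`. These get different colours, so giving `x` and `y` the colours opposite to their
      -- partners separates them too.
      set f' : α → α := fun z => if z = f x then f y else if z = f y then f x else f z with hf'
      have e1 : f' (f x) = f y := by simp [hf']
      have e2 : f' (f y) = f x := by simp [hf', hfxy.symm]
      have e3 : ∀ z, z ≠ f x → z ≠ f y → f' z = f z := fun z h1 h2 => by simp [hf', h1, h2]
      have mx : f x ∈ S' := (hmem _).2 ⟨fx1, fx3, fun h => hyx h.symm⟩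
      have my : f y ∈ S' := (hmem _).2 ⟨fy1, hfyx, fy3⟩
      obtain ⟨col, h1, h2⟩ := ih _ hcard S' f' rfl (fun z hz => by
        obtain ⟨hz1, hz2, hz3⟩ := (hmem z).1 hz
        obtain ⟨a1, a2, a3⟩ := hf z hz1
        by_cases hzx : z = f x
        · rw [hzx, e1, e2]; exact ⟨my, rfl, hfxy.symm⟩
        by_cases hzy : z = f y
        · rw [hzy, e2, e1]; exact ⟨mx, rfl, hfxy⟩
        have b1 : f z ≠ f x := fun h => hz2 (by rw [← a2, h, fx2])
        have b2 : f z ≠ f y := fun h => hz3 (by rw [← a2, h, fy2])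
        rw [e3 z hzx hzy, e3 _ b1 b2]
        refine ⟨(hmem _).2 ⟨a1, ?_, ?_⟩, a2, a3⟩
        · rintro h; exact hzx (by rw [← a2, h])
        · rintro h; exact hzy (by rw [← a2, h]))
      set col' := Function.update (Function.update col x (!col (f x))) y (!col (f y)) with hcol'
      have e : ∀ z ∈ S', col' z = col z :=
        fun z hz => by
          rw [hcol', Function.update_of_ne ((hmem z).1 hz).2.2,
            Function.update_of_ne ((hmem z).1 hz).2.1]
      have cx : col' x = !col (f x) := by simp [hcol', hxy]
      have cy : col' y = !col (f y) := by simp [hcol']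
      refine ⟨col', ?_, key _ ?_ ?_⟩
      · intro z hz
        by_cases hzx : z = x
        · rw [hzx, cx, e _ mx]; simp
        by_cases hzy : z = y
        · rw [hzy, cy, e _ my]; simp
        have hz' : z ∈ S' := (hmem z).2 ⟨hz, hzx, hzy⟩
        by_cases hzx' : z = f x
        · rw [hzx', fx2, cx, e _ mx]
        by_cases hzy' : z = f y
        · rw [hzy', fy2, cy, e _ my]
        have hfz : f z ∈ S' := (hmem _).2 ⟨(hf z hz).1, fun h => hzx' (by rw [← h, (hf z hz).2.1]),
          fun h => hzy' (by rw [← h, (hf z hz).2.1])⟩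
        rw [e z hz', e _ hfz, ← h1 z hz', e3 z hzx' hzy']
      · rw [cx, cy, ← e1, h1 _ mx]; simp
      · intro P b
        have h3 : ∀ b, (S'.filter fun z => t z = P ∧ col' z = b) =
            S'.filter fun z => t z = P ∧ col z = b := fun b =>
          Finset.filter_congr fun z hz => by rw [e z hz]
        rw [h3, h3]
        exact h2 P b
  · push Not at h
    -- Now all types in `S` are different and balance is automatic. The enumeration of `α` only
    -- serves to single out one element of each pair.
    refine ⟨fun x => decide ((Fintype.equivFin α x : ℕ) < Fintype.equivFin α (f x)), ?_, ?_⟩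
    · intro x hx
      obtain ⟨h1, h2, h3⟩ := hf x hx
      have h4 : (Fintype.equivFin α x : ℕ) ≠ Fintype.equivFin α (f x) := fun h => h3
        ((Fintype.equivFin α).injective (Fin.ext h)).symm
      simp only [h2]
      rw [← decide_not]
      exact decide_eq_decide.2 (by omega)
    · intro P b
      refine le_trans (Finset.card_le_one.2 ?_) (Nat.le_add_left 1 _)
      intro x hx y hy
      simp only [Finset.mem_filter] at hx hy
      by_contra hxy
      exact h x hx.1 y hy.1 hxy (by rw [hx.2.1, hy.2.1])

/-! ### Realizability of a pattern of a pairing -/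

/-- The number of agents of type `P` in pairs of multiplicity one. -/
def ends (D : ℕ → ℕ → ℕ) (K P : ℕ) : ℕ :=
  ∑ Q ∈ Finset.range K, if D P Q = 1 then (if P = Q then 2 else 1) else 0

/-- The number of the remaining agents of type `P` on one side. -/
def outs (D : ℕ → ℕ → ℕ) (σ c : ℕ → ℕ) (K P : ℕ) : ℕ := (c P - ends D K P + σ P / 2) / 2

/-- The number of the remaining agents of type `P` on the other side. -/
def ins (D : ℕ → ℕ → ℕ) (σ c : ℕ → ℕ) (K P : ℕ) : ℕ := c P - ends D K P - outs D σ c K P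

/-- There is a pairing of `c P` agents of each type `P < K` in which there are no, exactly one, any
number of pairs with types `P` and `Q` if `D P Q` is 0, 1, 2; the agents in pairs of the last kind
are split into two sides according to `σ`, between which Hall's condition holds. -/
structure Feasible (D : ℕ → ℕ → ℕ) (σ c : ℕ → ℕ) (K : ℕ) : Prop where
  ends_le : ∀ P < K, ends D K P ≤ c P
  sum_eq : ∑ P ∈ Finset.range K, outs D σ c K P = ∑ P ∈ Finset.range K, ins D σ c K P
  hall : ∀ X : ℕ → ℕ, (∀ j, X j < 3) →
    ∑ P ∈ Finset.range K, (if 0 < X P then outs D σ c K P else 0) ≤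
      ∑ Q ∈ Finset.range K, if ∃ P < K, 0 < X P ∧ D P Q = 2 then ins D σ c K Q else 0

theorem ins_add_outs {D : ℕ → ℕ → ℕ} {σ c : ℕ → ℕ} {K P : ℕ} (hσ : σ P < 3)
    (h : ends D K P ≤ c P) : ends D K P + (outs D σ c K P + ins D σ c K P) = c P := by
  unfold ins outs; omega

/-- An abstract paired set with the right number of points of each type is built first: one pair for
each type pair of multiplicity one, and a Hall matching between the two sides for the rest. It is
then transported to `α` along a type-preserving bijection. -/
theorem exists_pairing_of_feasible {t : α → ℕ} {K : ℕ} {D : ℕ → ℕ → ℕ} {σ : ℕ → ℕ}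
    (ht : ∀ x, t x < K) (hD : ∀ P Q, D P Q = D Q P) (hσ : ∀ P, σ P < 3)
    (h : Feasible D σ (fun P => (Finset.univ.filter fun x => t x = P).card) K) :
    ∃ f : α → α, (∀ x, f (f x) = x ∧ f x ≠ x) ∧ (∀ x, 0 < D (t x) (t (f x))) ∧
      ∀ x y, (t x = t y ∧ t (f x) = t (f y)) ∨ (t x = t (f y) ∧ t (f x) = t y) →
        y = x ∨ y = f x ∨ 1 < D (t x) (t (f x)) := by
  classical
  set c : ℕ → ℕ := fun P => (Finset.univ.filter fun x => t x = P).card with hc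
  let R := Σ P : Fin K, Fin (outs D σ c K P)
  let S := Σ P : Fin K, Fin (ins D σ c K P)
  let E := {e : Fin K × Fin K // e.1 ≤ e.2 ∧ D e.1 e.2 = 1}
  let nb : R → Finset S := fun r => Finset.univ.filter fun s => D r.1 s.1 = 2
  obtain ⟨φ, hφ, hφ'⟩ : ∃ φ : R → S, Function.Injective φ ∧ ∀ r, φ r ∈ nb r := by
    refine (Finset.all_card_le_biUnion_card_iff_exists_injective nb).1 fun A => ?_
    -- The neighbours of a set of points depend only on the types that occur in it, so enlarging the
    -- set to full types leaves the right-hand side of Hall's condition unchanged.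
    set X : ℕ → ℕ := fun P => if ∃ r ∈ A, (r.1 : ℕ) = P then 1 else 0 with hX
    have hX' : ∀ P, 0 < X P ↔ ∃ r ∈ A, (r.1 : ℕ) = P := fun P => by
      simp only [hX]; split_ifs with h <;> simp [h]
    have h1 : A.card ≤ ∑ P ∈ Finset.range K, if 0 < X P then outs D σ c K P else 0 := by
      calc A.card ≤ (Finset.univ.filter fun r : R => 0 < X r.1).card :=
            Finset.card_le_card fun r hr => by
              simp only [Finset.mem_filter, Finset.mem_univ, true_and, hX']
              exact ⟨r, hr, rfl⟩
        _ = _ := by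
          rw [Finset.card_filter, Fintype.sum_sigma, Finset.sum_range]
          refine Finset.sum_congr rfl fun P _ => ?_
          split_ifs with h3 <;> simp
    refine h1.trans ((h.hall X fun j => by simp only [hX]; split_ifs <;> omega).trans ?_)
    calc _ = (Finset.univ.filter fun s : S => ∃ P < K, 0 < X P ∧ D P s.1 = 2).card := by
          rw [Finset.card_filter, Fintype.sum_sigma, Finset.sum_range]
          refine Finset.sum_congr rfl fun P _ => ?_
          split_ifs with h3 <;> simp
      _ ≤ _ := Finset.card_le_card fun s hs => by
          simp only [Finset.mem_filter, Finset.mem_univ, true_and, hX'] at hs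
          obtain ⟨P, hP, ⟨r, hr, rfl⟩, h2⟩ := hs
          simp only [Finset.mem_biUnion]
          exact ⟨r, hr, by simp [nb, h2]⟩
  have hcard : Fintype.card R = Fintype.card S := by
    have := h.sum_eq
    simp only [R, S, Fintype.card_sigma, Fintype.card_fin]
    rwa [Finset.sum_range, Finset.sum_range] at this
  let Φ : R ≃ S := Equiv.ofBijective φ ((Fintype.bijective_iff_injective_and_card φ).2 ⟨hφ, hcard⟩)
  -- The Boolean distinguishes the two ends of a pair of multiplicity one.
  let H := (E × Bool) ⊕ (R ⊕ S)
  let u : H → ℕ := Sum.elim (fun e => if e.2 then (e.1.1.2 : ℕ) else e.1.1.1)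
    (Sum.elim (fun r => r.1) fun s => s.1)
  let g : H → H := Sum.elim (fun e => Sum.inl (e.1, !e.2))
    (Sum.elim (fun r => Sum.inr (Sum.inr (Φ r))) fun s => Sum.inr (Sum.inl (Φ.symm s)))
  have hfib : ∀ P, Fintype.card {x // t x = P} = Fintype.card {x // u x = P} := by
    intro P
    rw [Fintype.card_subtype, Fintype.card_subtype]
    by_cases hP : P < K
    · have h0 := ins_add_outs (hσ P) (h.ends_le P hP)
      refine h0.symm.trans ?_
      rw [Finset.card_filter, Fintype.sum_sum_type, Fintype.sum_sum_type]
      congr 1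
      · rw [Fintype.sum_prod_type]
        simp only [u, Sum.elim_inl, Fintype.sum_bool, if_true, Bool.false_eq_true, if_false]
        refine Eq.trans ?_ (Finset.sum_subtype (p := fun e : Fin K × Fin K => e.1 ≤ e.2 ∧ D e.1 e.2 = 1)
          (Finset.univ.filter fun e => e.1 ≤ e.2 ∧ D e.1 e.2 = 1) (by simp)
          (fun e => (if (e.2 : ℕ) = P then 1 else 0) + if (e.1 : ℕ) = P then 1 else 0))
        rw [Finset.sum_filter, Fintype.sum_prod_type, ends, Finset.sum_range]
        -- The two ends are counted separately, so a pair within one type contributes twice, in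
        -- accordance with `ends`.
        have h2 : ∀ p q : Fin K, (if p ≤ q ∧ D p q = 1 then
            (if (q : ℕ) = P then 1 else 0) + (if (p : ℕ) = P then 1 else 0) else 0) =
            (if (⟨P, hP⟩ : Fin K) = q then (if p ≤ q ∧ D p q = 1 then 1 else 0) else 0) +
            (if (⟨P, hP⟩ : Fin K) = p then (if p ≤ q ∧ D p q = 1 then 1 else 0) else 0) := by
          intro p q
          simp only [Fin.ext_iff, eq_comm (a := P)]
          split_ifs <;> rfl
        simp only [h2, Finset.sum_add_distrib, Finset.sum_ite_eq, Finset.mem_univ, if_true]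
        rw [Finset.sum_comm (f := fun p q => if (⟨P, hP⟩ : Fin K) = p then _ else 0)]
        simp only [Finset.sum_ite_eq, Finset.mem_univ, if_true]
        rw [← Finset.sum_add_distrib]
        refine Finset.sum_congr rfl fun Q _ => ?_
        simp only [hD Q P, Fin.le_def]
        split_ifs <;> omega
      · congr 1 <;>
        · rw [Fintype.sum_sigma, Finset.sum_eq_single (⟨P, hP⟩ : Fin K)]
          · simp [u]
          · intro b _ hb
            have : (b : ℕ) ≠ P := fun h => hb (Fin.ext h)
            simp [u, this]
          · simp
    · rw [Finset.card_eq_zero.2, Finset.card_eq_zero.2]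
      · refine Finset.filter_eq_empty_iff.2 ?_
        rintro (⟨e, b⟩ | r | s) _
        · have h1 := e.1.1.2
          have h2 := e.1.2.2
          cases b <;> simp [u] <;> omega
        · have := r.1.2
          simp [u]; omega
        · have := s.1.2
          simp [u]; omega
      · refine Finset.filter_eq_empty_iff.2 fun x _ h => hP (h ▸ ht x)
  -- Each type has as many points in `α` as in `H`; the bijections between the fibres are glued
  -- together.
  let e : α ≃ H := ((Equiv.sigmaFiberEquiv t).symm.trans (Equiv.sigmaCongrRight fun P =>
    Fintype.equivOfCardEq (hfib P))).trans (Equiv.sigmaFiberEquiv u)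
  have he : ∀ x, u (e x) = t x := fun x => by
    exact (Fintype.equivOfCardEq (hfib (t x)) ⟨x, rfl⟩).2
  have hg : ∀ y, g (g y) = y ∧ g y ≠ y := by
    rintro (⟨e, b⟩ | r | s)
    · refine ⟨by simp [g], fun h => ?_⟩
      have h := congrArg Prod.snd (Sum.inl.inj h)
      cases b <;> simp at h
    · exact ⟨by simp [g], fun h => by simp [g] at h; cases h⟩
    · exact ⟨by simp [g], fun h => by simp [g] at h; cases h⟩
  -- Pairs between `R` and `S` have `D = 2`, pairs from `E` have `D = 1`, and the latter are
  -- determined by their unordered pair of types.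
  have hgD : ∀ y, 0 < D (u y) (u (g y)) ∧ ∀ z, (u y = u z ∧ u (g y) = u (g z)) ∨
      (u y = u (g z) ∧ u (g y) = u z) → z = y ∨ z = g y ∨ 1 < D (u y) (u (g y)) := by
    have hR : ∀ r, D (u (Sum.inr (Sum.inl r))) (u (g (Sum.inr (Sum.inl r)))) = 2 := fun r => by
      have := hφ' r
      simp only [nb, Finset.mem_filter, Finset.mem_univ, true_and] at this
      exact this
    have hS : ∀ s, D (u (Sum.inr (Sum.inr s))) (u (g (Sum.inr (Sum.inr s)))) = 2 := fun s => by
      have := hφ' (Φ.symm s)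
      simp only [nb, Finset.mem_filter, Finset.mem_univ, true_and] at this
      rw [hD]
      have h2 : φ (Φ.symm s) = s := Φ.apply_symm_apply s
      rw [h2] at this
      exact this
    have hE : ∀ e b, D (u (Sum.inl (e, b))) (u (g (Sum.inl (e, b)))) = 1 := fun e b => by
      cases b
      · exact e.2.2
      · rw [hD]; exact e.2.2
    rintro (⟨e, b⟩ | r | s)
    · refine ⟨by rw [hE]; norm_num, ?_⟩
      intro z hz
      have hz1 : D (u z) (u (g z)) = 1 := by
        rw [← hE e b]
        rcases hz with ⟨h1, h2⟩ | ⟨h1, h2⟩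
        · rw [h1, h2]
        · rw [h1, h2, hD]
      rcases z with (⟨e', b'⟩ | r | s)
      · have hee : e = e' := by
          have h1 : (e.1.1 : ℕ) ≤ e.1.2 := e.2.1
          have h2 : (e'.1.1 : ℕ) ≤ e'.1.2 := e'.2.1
          refine Subtype.ext (Prod.ext (Fin.ext ?_) (Fin.ext ?_)) <;>
          · cases b <;> cases b' <;> simp [u, g] at hz <;> omega
        subst hee
        cases b <;> cases b' <;> simp [g]
      · rw [hR] at hz1; omega
      · rw [hS] at hz1; omega
    · rw [hR]; exact ⟨by omega, fun _ _ => Or.inr (Or.inr (by omega))⟩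
    · rw [hS]; exact ⟨by omega, fun _ _ => Or.inr (Or.inr (by omega))⟩
  refine ⟨fun x => e.symm (g (e x)), fun x => ⟨by simp [hg], fun h => ?_⟩, fun x => ?_, ?_⟩
  · exact (hg (e x)).2 (by simpa [Equiv.symm_apply_eq] using h)
  · have := (hgD (e x)).1
    rw [he, ← e.apply_symm_apply (g (e x)), he] at this
    exact this
  · intro x y hxy
    have := (hgD (e x)).2 (e y)
    rw [← e.apply_symm_apply (g (e x)), ← e.apply_symm_apply (g (e y)), he, he, he, he] at this
    rcases this hxy with h | h | h
    · exact Or.inl (e.injective h)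
    · exact Or.inr (Or.inl (e.injective h))
    · exact Or.inr (Or.inr h)

end Pairing
end MultilayerMatching

/-! ### The pattern of a given pairing. -/

namespace MultilayerMatching
section Pairing

variable {α : Type*} [Fintype α]

/-- `D` counts the pairs of each kind up to two. A balanced colouring of the points in pairs of
multiplicity two yields the sides, and Hall's condition holds because `f` itself maps one side
injectively into the other, respecting `D`. -/
theorem exists_feasible_of_pairing {t : α → ℕ} {K : ℕ} (ht : ∀ x, t x < K) {f : α → α}
    (hf : ∀ x, f (f x) = x ∧ f x ≠ x) :
    ∃ (D : ℕ → ℕ → ℕ) (σ : ℕ → ℕ), (∀ P Q, D P Q = D Q P) ∧ (∀ P Q, D P Q < 3) ∧ (∀ P, σ P < 3) ∧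
      Feasible D σ (fun P => (Finset.univ.filter fun x => t x = P).card) K ∧
      (∀ P Q, 0 < D P Q → ∃ x, t x = P ∧ t (f x) = Q) ∧
      ∀ P Q, 1 < D P Q → ∀ x, t x = P → t (f x) = Q →
        ∃ y, y ≠ x ∧ y ≠ f x ∧ t y = P ∧ t (f y) = Q := by
  classical
  set A : ℕ → ℕ → Finset α := fun P Q => Finset.univ.filter fun x =>
    (t x = P ∧ t (f x) = Q) ∨ (t x = Q ∧ t (f x) = P) with hA
  have hAc : ∀ P Q, A P Q = A Q P := fun P Q => by
    ext x; simp only [hA, Finset.mem_filter, Finset.mem_univ, true_and]; exact or_comm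
  have hAm : ∀ {P Q x}, x ∈ A P Q ↔ (t x = P ∧ t (f x) = Q) ∨ (t x = Q ∧ t (f x) = P) := by
    intro P Q x; simp [hA]
  have hAf : ∀ {P Q x}, x ∈ A P Q → f x ∈ A P Q := by
    intro P Q x h
    rw [hAm] at h ⊢
    rw [(hf x).1]; tauto
  have hA2 : ∀ {P Q x}, x ∈ A P Q → {x, f x} ⊆ A P Q := by
    intro P Q x h y hy
    simp only [Finset.mem_insert, Finset.mem_singleton] at hy
    rcases hy with rfl | rfl
    · exact h
    · exact hAf h
  have hpair : ∀ x, ({x, f x} : Finset α).card = 2 := fun x =>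
    Finset.card_pair (hf x).2.symm
  -- `A P Q` contains both ends of each pair, so at most two elements mean at most one pair.
  set D : ℕ → ℕ → ℕ := fun P Q => if (A P Q).card = 0 then 0 else if (A P Q).card ≤ 2 then 1 else 2
    with hDdef
  have hDc : ∀ P Q, D P Q = D Q P := fun P Q => by simp only [hDdef, hAc P Q]
  have hD3 : ∀ P Q, D P Q < 3 := fun P Q => by simp only [hDdef]; split_ifs <;> omega
  have hD0 : ∀ {P Q x}, x ∈ A P Q → 0 < D P Q := by
    intro P Q x h
    have := Finset.card_pos.2 ⟨x, h⟩
    simp only [hDdef]; split_ifs <;> omega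
  have hne : ∀ {P Q}, 0 < D P Q → (A P Q).Nonempty := by
    intro P Q h
    rw [Finset.nonempty_iff_ne_empty]
    intro h1
    simp [hDdef, h1] at h
  have hD1 : ∀ {P Q x}, x ∈ A P Q → D P Q = 1 → A P Q = {x, f x} := by
    intro P Q x h h1
    refine (Finset.eq_of_subset_of_card_le (hA2 h) ?_).symm
    rw [hpair]
    simp only [hDdef] at h1
    split_ifs at h1 <;> omega
  set B : Finset α := Finset.univ.filter fun x => D (t x) (t (f x)) = 2 with hB
  have hBm : ∀ {x}, x ∈ B ↔ D (t x) (t (f x)) = 2 := by intro x; simp [hB]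
  have hBf : ∀ {x}, x ∈ B → f x ∈ B := by
    intro x h
    rw [hBm] at h ⊢
    rw [(hf x).1, hDc, h]
  obtain ⟨col, hcol, hbal⟩ := exists_balanced_coloring t _ B f rfl fun x hx =>
    ⟨hBf hx, hf x⟩
  set F : ℕ → Bool → Finset α := fun P b => B.filter fun x => t x = P ∧ col x = b with hF
  -- In `outs` only the quotient `σ P / 2` matters: the digit 2 rounds the half up, the digits 0 and
  -- 1 round it down.
  set σ : ℕ → ℕ := fun P => if (F P false).card < (F P true).card then 2 else 0 with hσ
  set c : ℕ → ℕ := fun P => (Finset.univ.filter fun x => t x = P).card with hc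
  -- The points outside `B` are those in pairs of multiplicity one; they are counted by the type of
  -- the partner.
  have hends : ∀ P, ends D K P = (Finset.univ.filter fun x => t x = P ∧ x ∉ B).card := by
    intro P
    rw [Finset.card_eq_sum_card_fiberwise (f := fun x => t (f x)) (t := Finset.range K)
      (fun x _ => Finset.mem_coe.2 (Finset.mem_range.2 (ht (f x)))), ends]
    refine Finset.sum_congr rfl fun Q _ => ?_
    rw [Finset.filter_filter]
    split_ifs with h1 h2
    · subst h2
      obtain ⟨x, hx⟩ := hne (h1.symm ▸ one_pos)
      rw [← hpair x, ← hD1 hx h1]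
      congr 1
      ext y
      simp only [hAm, Finset.mem_filter, Finset.mem_univ, true_and, hBm, or_self]
      constructor
      · rintro ⟨h3, h4⟩; rw [h3, h4]; exact ⟨⟨rfl, by omega⟩, rfl⟩
      · rintro ⟨⟨h3, _⟩, h4⟩; exact ⟨h3, h4⟩
    · obtain ⟨x, hx, hxP, hxQ⟩ : ∃ x, x ∈ A P Q ∧ t x = P ∧ t (f x) = Q := by
        obtain ⟨x, hx⟩ := hne (h1.symm ▸ one_pos)
        rcases hAm.1 hx with h3 | h3
        · exact ⟨x, hx, h3⟩
        · exact ⟨f x, hAf hx, h3.2, by rw [(hf x).1, h3.1]⟩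
      symm
      rw [Finset.card_eq_one]
      refine ⟨x, ?_⟩
      ext y
      simp only [Finset.mem_filter, Finset.mem_univ, true_and, hBm, Finset.mem_singleton]
      constructor
      · rintro ⟨⟨h3, _⟩, h4⟩
        have : y ∈ A P Q := hAm.2 (Or.inl ⟨h3, h4⟩)
        rw [hD1 hx h1] at this
        simp only [Finset.mem_insert, Finset.mem_singleton] at this
        rcases this with rfl | rfl
        · rfl
        · exact absurd (h3.symm.trans hxQ) h2
      · rintro rfl
        exact ⟨⟨hxP, by rw [hxP, hxQ]; omega⟩, hxQ⟩
    · symm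
      rw [Finset.card_eq_zero, Finset.filter_eq_empty_iff]
      rintro x - ⟨⟨h3, h4⟩, h5⟩
      rw [hBm, h3, h5] at h4
      have h6 := hD0 (hAm.2 (Or.inl ⟨h3, h5⟩))
      have h7 := hD3 P Q
      omega
  have hcard : ∀ P, c P = ends D K P + ((F P true).card + (F P false).card) := by
    intro P
    have h1 : (F P true).card + (F P false).card =
        (Finset.univ.filter fun x => t x = P ∧ x ∈ B).card := by
      rw [← Finset.card_union_of_disjoint]
      · congr 1
        ext x
        simp only [hF, Finset.mem_union, Finset.mem_filter, Finset.mem_univ, true_and]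
        cases col x <;> simp [and_comm]
      · rw [Finset.disjoint_left]
        intro x hx hx'
        simp only [hF, Finset.mem_filter] at hx hx'
        rw [hx.2.2] at hx'
        simp at hx'
    rw [h1, hends, add_comm]
    simp only [hc]
    rw [← Finset.card_filter_add_card_filter_not (s := Finset.univ.filter fun x => t x = P)
      (p := fun x => x ∈ B), Finset.filter_filter, Finset.filter_filter]
  -- The two colour classes of a type differ by at most one, so their sizes are the two roundings of
  -- half their sum, and `σ` says which is which.
  have houts : ∀ P, outs D σ c K P = (F P true).card := by
    intro P
    have h1 := hbal P true
    have h2 := hbal P false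
    simp only [Bool.not_true, Bool.not_false] at h1 h2
    have h3 := hcard P
    change (F P true).card ≤ (F P false).card + 1 at h1
    change (F P false).card ≤ (F P true).card + 1 at h2
    simp only [outs, hσ]
    split_ifs <;> omega
  have hins : ∀ P, ins D σ c K P = (F P false).card := by
    intro P
    have h3 := hcard P
    simp only [ins, houts]
    omega
  have hsum : ∀ (p : ℕ → Prop) [DecidablePred p] (b : Bool), ∑ P ∈ Finset.range K, (if p P then (F P b).card else 0) =
      (B.filter fun x => col x = b ∧ p (t x)).card := by
    intro p _ b
    rw [Finset.card_eq_sum_card_fiberwise (f := t) (t := Finset.range K)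
      (fun x _ => Finset.mem_coe.2 (Finset.mem_range.2 (ht x)))]
    refine Finset.sum_congr rfl fun P _ => ?_
    rw [Finset.filter_filter]
    split_ifs with h
    · congr 1
      refine Finset.filter_congr fun x _ => ?_
      constructor
      · rintro ⟨rfl, h2⟩; exact ⟨⟨h2, h⟩, rfl⟩
      · rintro ⟨⟨h2, _⟩, h3⟩; exact ⟨h3, h2⟩
    · symm
      rw [Finset.card_eq_zero, Finset.filter_eq_empty_iff]
      rintro x - ⟨⟨_, h2⟩, rfl⟩
      exact h h2
  have hinj : Function.Injective f := fun x y h => by rw [← (hf x).1, h, (hf y).1]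
  refine ⟨D, σ, hDc, hD3, fun P => by simp only [hσ]; split_ifs <;> omega, ⟨?_, ?_, ?_⟩, ?_, ?_⟩
  · intro P _
    exact (hcard P).symm ▸ Nat.le_add_right _ _
  · have h1 := hsum (fun _ => True) true
    have h2 := hsum (fun _ => True) false
    simp only [if_true, and_true] at h1 h2
    change ∑ P ∈ Finset.range K, outs D σ c K P = ∑ P ∈ Finset.range K, ins D σ c K P
    simp only [houts, hins]
    rw [h1, h2]
    refine Finset.card_bij' (fun x _ => f x) (fun x _ => f x) ?_ ?_ ?_ ?_
    · intro x hx
      simp only [Finset.mem_filter] at hx ⊢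
      exact ⟨hBf hx.1, by rw [hcol x hx.1, hx.2]; rfl⟩
    · intro x hx
      simp only [Finset.mem_filter] at hx ⊢
      exact ⟨hBf hx.1, by rw [hcol x hx.1, hx.2]; rfl⟩
    · intro x _; exact (hf x).1
    · intro x _; exact (hf x).1
  · intro X _
    simp only [houts, hins]
    rw [hsum (fun P => 0 < X P), hsum (fun Q => ∃ P < K, 0 < X P ∧ D P Q = 2)]
    refine Finset.card_le_card_of_injOn f ?_ hinj.injOn
    intro x hx
    simp only [Finset.coe_filter, Set.mem_ofPred_eq] at hx ⊢
    exact ⟨hBf hx.1, by rw [hcol x hx.1, hx.2.1]; rfl, t x, ht x, hx.2.2, hBm.1 hx.1⟩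
  · intro P Q h
    obtain ⟨x, hx⟩ := hne h
    rcases hAm.1 hx with h3 | h3
    · exact ⟨x, h3⟩
    · exact ⟨f x, h3.2, by rw [(hf x).1, h3.1]⟩
  · intro P Q h x hxP hxQ
    have hlt : ({x, f x} : Finset α).card < (A P Q).card := by
      rw [hpair]
      simp only [hDdef] at h
      split_ifs at h <;> omega
    obtain ⟨y, hy, hy'⟩ := Finset.exists_mem_notMem_of_card_lt_card hlt
    simp only [Finset.mem_insert, Finset.mem_singleton, not_or] at hy'
    rcases hAm.1 hy with h3 | h3
    · exact ⟨y, hy'.1, hy'.2, h3⟩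
    · refine ⟨f y, fun h4 => hy'.2 ?_, fun h4 => hy'.1 (hinj h4), h3.2, by rw [(hf y).1, h3.1]⟩
      rw [← h4, (hf y).1]

end Pairing
end MultilayerMatching

namespace MultilayerMatching
variable {n ℓ : ℕ}

/-! ### Stability in terms of types -/

/-- The two agents are replaced one after the other, in an order that keeps the pair distinct. The
only case without such an order is the exchange `x = b`, `y = a`, which the symmetry clause of
`SameType` covers. -/
theorem SameType.mem_iff {T : Profile n ℓ} {a b x y : Fin n} (hax : SameType T a x)
    (hby : SameType T b y) (hab : a ≠ b) (hxy : x ≠ y) (i : Fin ℓ) : b ∈ T a i ↔ y ∈ T x i := by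
  have h1 : ∀ z, z ≠ a → z ≠ x → (z ∈ T a i ↔ z ∈ T x i) := fun z hza hzx => by
    have := Finset.ext_iff.1 (hax i).1 z
    simpa [hza, hzx] using this
  have h2 : ∀ z, z ≠ b → z ≠ y → (b ∈ T z i ↔ y ∈ T z i) := (hby i).2.2
  by_cases hay : a = y
  · by_cases hxb : x = b
    · subst hay hxb
      exact (hax i).2.1
    · rw [h1 b hab.symm (Ne.symm hxb), h2 x hxb hxy]
  · rw [h2 a hab hay, h1 y (Ne.symm hay) hxy.symm]

/-- What two agents and their partners approve: a condition on whether the first agent approves the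
second one, whether it is happy, and the same with the roles exchanged. -/
abbrev PairCondition (ℓ : ℕ) : Type :=
  (Fin ℓ → Prop) → (Fin ℓ → Prop) → (Fin ℓ → Prop) → (Fin ℓ → Prop) → Prop

/-- The condition `φ` for `a` with partner `b` and `a'` with partner `b'`. -/
def PairCondition.At (φ : PairCondition ℓ) (T : Profile n ℓ) (a : Fin n) (b : Option (Fin n))
    (a' : Fin n) (b' : Option (Fin n)) : Prop :=
  φ (fun i => a' ∈ T a i) (fun i => Approves T i a b) (fun i => a ∈ T a' i)
    (fun i => Approves T i a' b')

/-- The condition `φ` for all pairs of distinct agents not matched to each other. -/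
def PairCondition.Holds (φ : PairCondition ℓ) (T : Profile n ℓ) (M : Matching n) : Prop :=
  ∀ a a', a ≠ a' → M.partner a ≠ some a' → φ.At T a (M.partner a) a' (M.partner a')

/-- The type of a partner, where `τ` is the type of being unmatched. -/
def partnerType (tp : Fin n → ℕ) (τ : ℕ) (b : Option (Fin n)) : ℕ := b.elim τ tp

/-- The condition `φ` for all pairs of agents with partners that are possible according to the
multiplicities `D` of the pairs of types. -/
def PairCondition.Safe (φ : PairCondition ℓ) (T : Profile n ℓ) (tp : Fin n → ℕ) (τ : ℕ)
    (D : ℕ → ℕ → ℕ) : Prop :=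
  ∀ (a : Fin n) (b : Option (Fin n)) (a' : Fin n) (b' : Option (Fin n)),
    a ≠ a' → b ≠ some a → b ≠ some a' → b' ≠ some a → b' ≠ some a' →
    0 < D (tp a) (partnerType tp τ b) → 0 < D (tp a') (partnerType tp τ b') →
    ((tp a = tp a' ∧ partnerType tp τ b = partnerType tp τ b') ∨
      (tp a = partnerType tp τ b' ∧ partnerType tp τ b = tp a') →
      1 < D (tp a) (partnerType tp τ b)) →
    φ.At T a b a' b'

/-- The types of the agents and of as many dummies. -/
def extendedType (tp : Fin n → ℕ) (τ : ℕ) : Fin n ⊕ Fin n → ℕ := Sum.elim tp fun _ => τ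

/-- The number of agents or dummies of a type. -/
def classSize (tp : Fin n → ℕ) (τ P : ℕ) : ℕ :=
  (Finset.univ.filter fun x => extendedType tp τ x = P).card

variable {T : Profile n ℓ} {tp : Fin n → ℕ} {τ : ℕ}

theorem extendedType_lt (hτ : ∀ a, tp a < τ) (x : Fin n ⊕ Fin n) : extendedType tp τ x < τ + 1 := by
  rcases x with a | a
  · exact (hτ a).trans (Nat.lt_succ_self _)
  · exact Nat.lt_succ_self _

theorem approves_iff (htp : ∀ a b, tp a = tp b ↔ SameType T a b) (hτ : ∀ a, tp a < τ)
    {a x : Fin n} {b y : Option (Fin n)} (hax : tp a = tp x)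
    (hby : partnerType tp τ b = partnerType tp τ y) (hb : b ≠ some a) (hy : y ≠ some x)
    (i : Fin ℓ) : Approves T i a b ↔ Approves T i x y := by
  rcases b with - | b <;> rcases y with - | y
  · simp [Approves]
  · have := hτ y
    simp [partnerType] at hby; omega
  · have := hτ b
    simp [partnerType] at hby; omega
  · have h := SameType.mem_iff ((htp a x).1 hax) ((htp b y).1 hby) (fun h => hb (by rw [h]))
      (fun h => hy (by rw [h])) i
    simpa [Approves] using h

/-- The matching is made perfect by dummies: an unmatched agent goes with its dummy, and the dummies
of partners go together. For agents and partners admitted by the pattern, actual pairs of `M` with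
the same types are found, and the condition is carried over from them. -/
theorem Matching.exists_pattern (htp : ∀ a b, tp a = tp b ↔ SameType T a b) (hτ : ∀ a, tp a < τ)
    (M : Matching n) :
    ∃ (D : ℕ → ℕ → ℕ) (σ : ℕ → ℕ), (∀ P Q, D P Q = D Q P) ∧ (∀ P Q, D P Q < 3) ∧ (∀ P, σ P < 3) ∧
      Feasible D σ (classSize tp τ) (τ + 1) ∧
      ∀ φ : PairCondition ℓ, φ.Holds T M → φ.Safe T tp τ D := by
  set f : Fin n ⊕ Fin n → Fin n ⊕ Fin n := Sum.elim
    (fun a => (M.partner a).elim (Sum.inr a) Sum.inl)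
    (fun a => (M.partner a).elim (Sum.inl a) Sum.inr) with hfdef
  have hf : ∀ x, f (f x) = x ∧ f x ≠ x := by
    rintro (a | a)
    · cases h : M.partner a with
      | none => simp [hfdef, h]
      | some b =>
        have h1 := M.symm a b h
        refine ⟨by simp [hfdef, h, h1], ?_⟩
        simp only [hfdef, Sum.elim_inl, h, Option.elim, ne_eq, Sum.inl.injEq]
        rintro rfl
        exact M.irrefl _ h
    · cases h : M.partner a with
      | none => simp [hfdef, h]
      | some b =>
        have h1 := M.symm a b h
        refine ⟨by simp [hfdef, h, h1], ?_⟩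
        simp only [hfdef, Sum.elim_inr, h, Option.elim, ne_eq, Sum.inr.injEq]
        rintro rfl
        exact M.irrefl _ h
  obtain ⟨D, σ, hD, hD3, hσ, hfeas, hex, hex2⟩ :=
    exists_feasible_of_pairing (extendedType_lt hτ) hf
  refine ⟨D, σ, hD, hD3, hσ, hfeas, fun φ hM => ?_⟩
  have hinl : ∀ x a, extendedType tp τ x = tp a → ∃ x₀, x = Sum.inl x₀ ∧ tp x₀ = tp a := by
    rintro (x | x) a h
    · exact ⟨x, rfl, h⟩
    · have := hτ a
      simp [extendedType] at h; omega
  have hpt : ∀ x, extendedType tp τ (f (Sum.inl x)) = partnerType tp τ (M.partner x) := by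
    intro x
    cases h : M.partner x <;> simp [hfdef, h, extendedType, partnerType]
  intro a b a' b' haa' hba hba' hb'a hb'a' h0 h0' h1
  obtain ⟨x, hx, hfx⟩ := hex _ _ h0
  -- The second actual pair must differ from the first. If the unordered type pairs agree,
  -- multiplicity above one provides another pair, possibly to be turned around; otherwise the types
  -- already tell the pairs apart.
  obtain ⟨x', hx', hfx', hne, hne'⟩ : ∃ x', extendedType tp τ x' = tp a' ∧
      extendedType tp τ (f x') = partnerType tp τ b' ∧ x' ≠ x ∧ x' ≠ f x := by
    by_cases h2 : (tp a = tp a' ∧ partnerType tp τ b = partnerType tp τ b') ∨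
      (tp a = partnerType tp τ b' ∧ partnerType tp τ b = tp a')
    · obtain ⟨y, y1, y2, y3, y4⟩ := hex2 _ _ (h1 h2) x hx hfx
      rcases h2 with ⟨h3, h4⟩ | ⟨h3, h4⟩
      · exact ⟨y, by rw [y3, h3], by rw [y4, h4], y1, y2⟩
      · refine ⟨f y, by rw [y4, h4], by rw [(hf y).1, y3, h3], fun h => y2 ?_, fun h => y1 ?_⟩
        · rw [← h, (hf y).1]
        · rw [← (hf y).1, h, (hf x).1]
    · obtain ⟨x', e1, e2⟩ := hex _ _ h0'
      refine ⟨x', e1, e2, ?_, ?_⟩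
      · rintro rfl; exact h2 (Or.inl ⟨hx.symm.trans e1, hfx.symm.trans e2⟩)
      · rintro rfl
        rw [(hf x).1] at e2
        exact h2 (Or.inr ⟨hx.symm.trans e2, hfx.symm.trans e1⟩)
  obtain ⟨x, rfl, hxa⟩ := hinl _ _ hx
  obtain ⟨x', rfl, hxa'⟩ := hinl _ _ hx'
  rw [hpt] at hfx hfx'
  have hxx : x ≠ x' := fun h => hne (by rw [h])
  have hMx : M.partner x ≠ some x' := fun h => hne' (by simp [hfdef, h])
  have key := hM x x' hxx hMx
  unfold PairCondition.At at key ⊢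
  have e1 : (fun i => a' ∈ T a i) = fun i => x' ∈ T x i := funext fun i => propext
    (SameType.mem_iff ((htp _ _).1 hxa.symm) ((htp _ _).1 hxa'.symm) haa' hxx i)
  have e2 : (fun i => a ∈ T a' i) = fun i => x ∈ T x' i := funext fun i => propext
    (SameType.mem_iff ((htp _ _).1 hxa'.symm) ((htp _ _).1 hxa.symm) haa'.symm hxx.symm i)
  have e3 : (fun i => Approves T i a b) = fun i => Approves T i x (M.partner x) :=
    funext fun i => propext (approves_iff htp hτ hxa.symm hfx.symm hba (M.irrefl x) i)
  have e4 : (fun i => Approves T i a' b') = fun i => Approves T i x' (M.partner x') :=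
    funext fun i => propext (approves_iff htp hτ hxa'.symm hfx'.symm hb'a' (M.irrefl x') i)
  rw [e1, e2, e3, e4]
  exact key

/-- The pairing is restricted to the agents, and an agent paired with a dummy is unmatched. How the
dummies are paired among themselves is irrelevant. -/
theorem exists_matching_of_feasible (hτ : ∀ a, tp a < τ) {D : ℕ → ℕ → ℕ} {σ : ℕ → ℕ}
    (hD : ∀ P Q, D P Q = D Q P) (hσ : ∀ P, σ P < 3)
    (h : Feasible D σ (classSize tp τ) (τ + 1)) :
    ∃ M : Matching n, ∀ φ : PairCondition ℓ, φ.Safe T tp τ D → φ.Holds T M := by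
  obtain ⟨f, hf, hf0, hf1⟩ := exists_pairing_of_feasible (extendedType_lt hτ) hD hσ h
  have hp : ∀ a b, (f (Sum.inl a)).elim some (fun _ => none) = some b ↔ f (Sum.inl a) = Sum.inl b := by
    intro a b
    cases h : f (Sum.inl a) <;> simp
  refine ⟨⟨fun a => (f (Sum.inl a)).elim some (fun _ => none), ?_, ?_⟩, ?_⟩
  · intro a b h
    rw [hp] at h ⊢
    rw [← h, (hf _).1]
  · intro a h
    rw [hp] at h
    exact (hf _).2 h
  · intro φ hφ a a' haa' hne
    have hpt : ∀ a, partnerType tp τ ((f (Sum.inl a)).elim some (fun _ => none)) =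
        extendedType tp τ (f (Sum.inl a)) := by
      intro a
      cases h : f (Sum.inl a) <;> simp [extendedType, partnerType]
    simp only at hne ⊢
    refine hφ _ _ _ _ haa' ?_ hne ?_ ?_ ?_ ?_ ?_
    · rw [ne_eq, hp]; exact (hf _).2
    · rw [ne_eq, hp] at hne ⊢
      intro h
      exact hne (by rw [← h, (hf _).1])
    · rw [ne_eq, hp]; exact (hf _).2
    · rw [hpt]; exact hf0 (Sum.inl a)
    · rw [hpt]; exact hf0 (Sum.inl a')
    · rw [hpt, hpt]
      intro h
      rcases hf1 (Sum.inl a) (Sum.inl a') h with h | h | h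
      · exact absurd (Sum.inl.inj h).symm haa'
      · exact absurd ((hp a a').2 h.symm) hne
      · exact h

end MultilayerMatching

namespace MultilayerMatching
variable {n ℓ : ℕ}

/-! ### The stability notions as conditions on pairs -/

/-- Whether a pair blocks, given whether each agent approves the other one and whether it is happy. -/
def Criterion.blocks : Criterion → Bool → Bool → Bool → Bool → Bool
  | .weak, p, q, p', q' => (p && !q) && (p' && !q')
  | .strong, p, q, p', q' => ((p && !q) && (p' || !q')) || ((p' && !q') && (p || !q))
  | .super, p, q, p', q' => (p || !q) && (p' || !q')

/-- What has to hold in sufficiently many layers for a pair; in the case of the individual notions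
for its first or for its second agent. -/
def StabilityNotion.good : StabilityNotion → Bool → Bool → Bool → Bool → Bool → Bool
  | .global κ, _, p, q, p', q' => !κ.blocks p q p' q'
  | .pair κ, _, p, q, p', q' => !κ.blocks p q p' q'
  | .individualWeak, false, p, q, _, _ => !p || q
  | .individualWeak, true, _, _, p', q' => !p' || q'
  | .individualSuper, false, p, q, _, _ => !p && q
  | .individualSuper, true, _, _, p', q' => !p' && q'

open Classical in
/-- The pair is good in layer `i`. -/
noncomputable def StabilityNotion.layerCondition (σ : StabilityNotion) (i : Fin ℓ) :
    PairCondition ℓ :=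
  fun p q p' q' => σ.good false (decide (p i)) (decide (q i)) (decide (p' i)) (decide (q' i))

open Classical in
/-- The pair is good in `α` layers. -/
noncomputable def StabilityNotion.localCondition (σ : StabilityNotion) (α : ℕ) :
    PairCondition ℓ :=
  fun p q p' q' => ∃ s : Bool, α ≤ (Finset.univ.filter fun i : Fin ℓ =>
    σ.good s (decide (p i)) (decide (q i)) (decide (p' i)) (decide (q' i))).card

open Classical in
/-- Stability expressed by means of a property of conditions on pairs. -/
def StabilityNotion.Via (σ : StabilityNotion) (α : ℕ) (R : PairCondition ℓ → Prop) : Prop :=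
  match σ with
  | .global κ => α ≤ (Finset.univ.filter fun i : Fin ℓ =>
      R (StabilityNotion.layerCondition (.global κ) i)).card
  | τ => R (τ.localCondition α)

/-- Monotonicity lets both directions between matchings and patterns be proved for arbitrary pair
conditions, without regard to the notion. -/
theorem StabilityNotion.Via.mono {σ : StabilityNotion} {α : ℕ} {R R' : PairCondition ℓ → Prop}
    (h : σ.Via α R) (hR : ∀ φ, R φ → R' φ) : σ.Via α R' := by
  cases σ with
  | global κ =>
    exact le_trans (h : α ≤ _) (Finset.card_le_card fun i hi => by
      simp only [Finset.mem_filter, Finset.mem_univ, true_and] at hi ⊢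
      exact hR _ hi)
  | pair κ => exact hR _ h
  | individualWeak => exact hR _ h
  | individualSuper => exact hR _ h

theorem exists_finset_card_le_iff {ι : Type*} [Fintype ι] (p : ι → Prop) [DecidablePred p] (α : ℕ) :
    (∃ S : Finset ι, α ≤ S.card ∧ ∀ i ∈ S, p i) ↔ α ≤ (Finset.univ.filter p).card := by
  constructor
  · rintro ⟨S, h1, h2⟩
    exact h1.trans (Finset.card_le_card fun i hi => by simp [h2 i hi])
  · intro h
    exact ⟨_, h, by simp⟩

open Classical in
theorem blocks_iff (T : Profile n ℓ) (i : Fin ℓ) (M : Matching n) (κ : Criterion) (a b : Fin n) :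
    Blocks T i M κ a b ↔ a ≠ b ∧ M.partner a ≠ some b ∧
      κ.blocks (decide (b ∈ T a i)) (decide (Approves T i a (M.partner a))) (decide (a ∈ T b i))
        (decide (Approves T i b (M.partner b))) := by
  have h : ∀ a b, Approves T i a (some b) ↔ b ∈ T a i := fun a b => by simp [Approves]
  cases κ <;> simp [Blocks, Criterion.blocks, Prefers, Indifferent, h] <;> tauto

theorem isStable_iff (σ : StabilityNotion) (T : Profile n ℓ) {α : ℕ} (hα : α ≤ ℓ)
    (M : Matching n) : σ.IsStable T α M ↔ σ.Via α fun φ => φ.Holds T M := by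
  classical
  cases σ with
  | global κ =>
    have h1 : ∀ i : Fin ℓ, StableInLayer T i M κ ↔
        (StabilityNotion.layerCondition (.global κ) i).Holds T M := by
      intro i
      refine forall_congr' fun a => forall_congr' fun b => ?_
      rw [blocks_iff]
      simp only [PairCondition.At, StabilityNotion.layerCondition, StabilityNotion.good,
        Bool.not_eq_true', not_and, Bool.not_eq_true]
      constructor <;> (intro hx h1 h2; convert hx h1 h2)
    simp only [StabilityNotion.IsStable, StabilityNotion.Via, ← h1]
    rw [← exists_finset_card_le_iff]
    constructor
    · rintro ⟨S, h1, h2⟩; exact ⟨S, h1.ge, h2⟩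
    · rintro ⟨S, h1, h2⟩
      -- Global stability asks for a set of exactly `α` layers; surplus layers are discarded.
      obtain ⟨S', h3, h4⟩ := Finset.exists_subset_card_eq h1
      exact ⟨S', h4, fun i hi => h2 i (h3 hi)⟩
  | pair κ =>
    refine forall_congr' fun a => forall_congr' fun b => ?_
    refine imp_congr_right fun hab => ?_
    simp only [exists_finset_card_le_iff, blocks_iff, PairCondition.At,
      StabilityNotion.localCondition, StabilityNotion.good]
    by_cases h : M.partner a = some b
    -- Partners block in no layer, so all `ℓ` layers count, and `α ≤ ℓ`.
    · simp [h, hα]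
    · simp only [h, hab, ne_eq, not_false_eq_true, true_and, Bool.not_eq_true, Bool.not_eq_true',
        forall_const, Bool.exists_bool, or_self]
      constructor <;> (intro hx; convert hx)
  | individualWeak =>
    refine forall_congr' fun a => forall_congr' fun b => ?_
    refine imp_congr_right fun _ => imp_congr_right fun _ => ?_
    simp only [exists_finset_card_le_iff, PairCondition.At, Happy,
      StabilityNotion.localCondition, Bool.exists_bool, StabilityNotion.good, Bool.or_eq_true,
      Bool.not_eq_true', decide_eq_false_iff_not, decide_eq_true_eq]
    constructor
    · rintro ⟨b₁, b₂, ⟨rfl, rfl⟩ | ⟨rfl, rfl⟩, hS⟩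
      · exact Or.inl hS
      · exact Or.inr hS
    · rintro (h | h)
      · exact ⟨a, b, Or.inl ⟨rfl, rfl⟩, h⟩
      · exact ⟨b, a, Or.inr ⟨rfl, rfl⟩, h⟩
  | individualSuper =>
    refine forall_congr' fun a => forall_congr' fun b => ?_
    refine imp_congr_right fun _ => imp_congr_right fun _ => ?_
    simp only [exists_finset_card_le_iff, PairCondition.At, Happy,
      StabilityNotion.localCondition, Bool.exists_bool, StabilityNotion.good, Bool.and_eq_true,
      Bool.not_eq_true', decide_eq_false_iff_not, decide_eq_true_eq]
    constructor
    · rintro ⟨b₁, b₂, ⟨rfl, rfl⟩ | ⟨rfl, rfl⟩, hS⟩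
      · exact Or.inl hS
      · exact Or.inr hS
    · rintro (h | h)
      · exact ⟨a, b, Or.inl ⟨rfl, rfl⟩, h⟩
      · exact ⟨b, a, Or.inr ⟨rfl, rfl⟩, h⟩

/-- This replaces the search for a matching by a search for a pattern, whose size depends only on
the number of types. -/
theorem exists_isStable_iff (σ : StabilityNotion) {T : Profile n ℓ} {tp : Fin n → ℕ} {τ α : ℕ}
    (htp : ∀ a b, tp a = tp b ↔ SameType T a b) (hτ : ∀ a, tp a < τ) (hα : α ≤ ℓ) :
    (∃ M : Matching n, σ.IsStable T α M) ↔
      ∃ (D : ℕ → ℕ → ℕ) (ε : ℕ → ℕ), (∀ P Q, D P Q = D Q P) ∧ (∀ P Q, D P Q < 3) ∧ (∀ P, ε P < 3) ∧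
        Feasible D ε (classSize tp τ) (τ + 1) ∧ σ.Via α fun φ => φ.Safe T tp τ D := by
  constructor
  · rintro ⟨M, hM⟩
    rw [isStable_iff σ T hα] at hM
    obtain ⟨D, ε, h1, h2, h3, h4, h5⟩ := M.exists_pattern (ℓ := ℓ) htp hτ
    exact ⟨D, ε, h1, h2, h3, h4, hM.mono h5⟩
  · rintro ⟨D, ε, h1, h2, h3, h4, h5⟩
    obtain ⟨M, hM⟩ := exists_matching_of_feasible (T := T) hτ h1 h3 h4
    exact ⟨M, (isStable_iff σ T hα M).2 (h5.mono hM)⟩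

end MultilayerMatching

namespace MultilayerMatching

/-! ### Type indices -/

section Types

variable {n ℓ : ℕ}

/-- `b` is the first agent of its type. -/
def IsLeader (T : Profile n ℓ) (b : Fin n) : Prop := ∀ c < b, ¬ SameType T b c

open Classical in
/-- The number of types, counted by their first agents. -/
noncomputable def leaderCount (T : Profile n ℓ) : ℕ := (Finset.univ.filter (IsLeader T)).card

open Classical in
/-- The number of first agents of a type that precede the first agent of the type of `a`. -/
noncomputable def typeIndex (T : Profile n ℓ) (a : Fin n) : ℕ :=
  (Finset.univ.filter fun b => IsLeader T b ∧ ∀ c ≤ b, ¬ SameType T a c).card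

theorem SameType.refl (T : Profile n ℓ) (a : Fin n) : SameType T a a :=
  (typeSetoid T).iseqv.refl a

theorem exists_leader (T : Profile n ℓ) (a : Fin n) :
    ∃ b, IsLeader T b ∧ SameType T a b ∧ ∀ c < b, ¬ SameType T a c := by
  have := WellFounded.has_min (r := ((· < ·) : Fin n → Fin n → Prop)) wellFounded_lt
    {c | SameType T a c} ⟨a, SameType.refl T a⟩
  obtain ⟨b, hb, hmin⟩ := this
  exact ⟨b, fun c hc h => hmin c (SameType.trans hb h) hc, hb, fun c hc h => hmin c h hc⟩

theorem typeIndex_lt (T : Profile n ℓ) (a : Fin n) : typeIndex T a < leaderCount T := by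
  classical
  obtain ⟨b, hb, hab, -⟩ := exists_leader T a
  refine Finset.card_lt_card ⟨fun c hc => ?_, fun h => ?_⟩
  · simp only [Finset.mem_filter, Finset.mem_univ, true_and] at hc ⊢
    exact hc.1
  · have := h (by simpa using hb : b ∈ _)
    simp only [Finset.mem_filter, Finset.mem_univ, true_and] at this
    exact this.2 b le_rfl hab

/-- The index is the rank of the first agent of the type among all first agents, and different types
have different first agents. -/
theorem typeIndex_eq_iff (T : Profile n ℓ) (a b : Fin n) :
    typeIndex T a = typeIndex T b ↔ SameType T a b := by
  classical
  constructor
  -- If `x` comes first, the leaders counted for `a` are also counted for `b`, while `x` is counted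
  -- for `b` only.
  · have key : ∀ a b x y : Fin n, IsLeader T x → SameType T a x → (∀ c < y, ¬ SameType T b c) →
        (∀ c < x, ¬ SameType T a c) → x < y → typeIndex T a < typeIndex T b := by
      intro a b x y hx hax hby hax' hxy
      refine Finset.card_lt_card ⟨fun c hc => ?_, fun h => ?_⟩
      · simp only [Finset.mem_filter, Finset.mem_univ, true_and] at hc ⊢
        refine ⟨hc.1, fun e he => hby e (lt_of_le_of_lt he ?_)⟩
        by_contra h
        exact hc.2 x (by omega) hax
      · have := h (show x ∈ _ by
          simp only [Finset.mem_filter, Finset.mem_univ, true_and]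
          exact ⟨hx, fun c hc => hby c (lt_of_le_of_lt hc hxy)⟩)
        simp only [Finset.mem_filter, Finset.mem_univ, true_and] at this
        exact this.2 x le_rfl hax
    obtain ⟨x, hx, hax, hax'⟩ := exists_leader T a
    obtain ⟨y, hy, hby, hby'⟩ := exists_leader T b
    intro h
    rcases lt_trichotomy x y with hxy | rfl | hxy
    · have := key a b x y hx hax hby' hax' hxy; omega
    · exact hax.trans hby.symm
    · have := key b a y x hy hby hax' hby' hxy; omega
  · intro h
    unfold typeIndex
    congr 1
    refine Finset.filter_congr fun c _ => ?_
    refine and_congr_right fun _ => forall_congr' fun d => imp_congr_right fun _ => not_congr ?_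
    exact ⟨fun h' => h.symm.trans h', fun h' => h.trans h'⟩

/-- The program works with the number of leaders, so for the time bound this inequality suffices. -/
theorem leaderCount_le_numTypes (T : Profile n ℓ) : leaderCount T ≤ numTypes T := by
  classical
  unfold leaderCount numTypes
  rw [Nat.card_eq_fintype_card]
  refine Finset.card_le_card_of_injOn (t := Finset.univ)
    (fun b => (Quotient.mk (typeSetoid T) b)) (fun _ _ => Finset.mem_univ _) ?_
  intro a ha b hb hab
  have hab : SameType T a b := Quotient.exact hab
  simp only [Finset.coe_filter, Finset.mem_univ, true_and, Set.mem_ofPred_eq] at ha hb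
  rcases lt_trichotomy a b with h | h | h
  · exact absurd hab.symm (hb a h)
  · exact h
  · exact absurd hab (ha b h)

theorem leaderCount_le (T : Profile n ℓ) : leaderCount T ≤ n := by
  classical
  unfold leaderCount
  exact (Finset.card_filter_le _ _).trans (by simp)

end Types

/-! ### Triangular indices -/

/-- The index of an unordered pair. -/
def triIndex (x y : ℕ) : ℕ := if x < y then y * (y + 1) / 2 + x else x * (x + 1) / 2 + y

theorem triIndex_comm (x y : ℕ) : triIndex x y = triIndex y x := by
  unfold triIndex
  rcases lt_trichotomy x y with h | rfl | h
  · rw [if_pos h, if_neg (by omega)]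
  · rfl
  · rw [if_neg (by omega), if_pos h]

theorem half_mul_succ (y : ℕ) : (y + 1) * (y + 1 + 1) / 2 = y * (y + 1) / 2 + (y + 1) := by
  rw [show (y + 1) * (y + 1 + 1) = y * (y + 1) + (y + 1) * 2 by ring,
    Nat.add_mul_div_right _ _ (by norm_num)]

theorem half_mul_mono {x y : ℕ} (h : x ≤ y) : x * (x + 1) / 2 ≤ y * (y + 1) / 2 :=
  Nat.div_le_div_right (Nat.mul_le_mul h (by omega))

theorem triIndex_lt {x y K : ℕ} (hx : x < K) (hy : y < K) : triIndex x y < K * (K + 1) / 2 := by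
  obtain ⟨k, rfl⟩ : ∃ k, K = k + 1 := ⟨K - 1, by omega⟩
  have h1 := half_mul_mono (show x ≤ k by omega)
  have h2 := half_mul_mono (show y ≤ k by omega)
  have h3 := half_mul_succ k
  unfold triIndex
  split_ifs <;> omega

/-- Row `y` of the triangle occupies the `y + 1` numbers from `y * (y + 1) / 2` on; different rows
are disjoint. -/
theorem half_mul_add_inj {x y x' y' : ℕ} (h : x ≤ y) (h' : x' ≤ y')
    (e : y * (y + 1) / 2 + x = y' * (y' + 1) / 2 + x') : x = x' ∧ y = y' := by
  have h1 := half_mul_succ y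
  have h2 := half_mul_succ y'
  rcases lt_trichotomy y y' with hy | rfl | hy
  · have := half_mul_mono (show y + 1 ≤ y' by omega); omega
  · omega
  · have := half_mul_mono (show y' + 1 ≤ y by omega); omega

theorem triIndex_eq_iff (x y x' y' : ℕ) :
    triIndex x y = triIndex x' y' ↔ (x = x' ∧ y = y') ∨ (x = y' ∧ y = x') := by
  constructor
  · intro h
    unfold triIndex at h
    split_ifs at h with h1 h2 h2
    · have := half_mul_add_inj h1.le h2.le h; omega
    · have := half_mul_add_inj h1.le (by omega) h; omega
    · have := half_mul_add_inj (by omega) h2.le h; omega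
    · have := half_mul_add_inj (x := y) (by omega) (by omega) h; omega
  · rintro (⟨rfl, rfl⟩ | ⟨rfl, rfl⟩)
    · rfl
    · exact triIndex_comm _ _

/-! ### Expressions of logic -/

namespace Expression

def not (p : Expression) : Expression := ite (const 0) p (const 0) (const 1)
def and (p q : Expression) : Expression := ite (const 0) p q (const 0)
def or (p q : Expression) : Expression := ite (const 0) p (const 1) q
def xor (p q : Expression) : Expression := ite (const 0) p (not q) q
def cond (p a b : Expression) : Expression := ite (const 0) p a b
def lt (a b : Expression) : Expression := ite a b (const 1) (const 0)
def ne (a b : Expression) : Expression := or (lt a b) (lt b a)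
def eq (a b : Expression) : Expression := not (ne a b)

/-- Case distinction on whether `p` is positive. -/
def select (p : Expression) (g : Bool → Expression) : Expression := cond p (g true) (g false)

variable {p q a b : Expression} {μ ρ : ℕ → ℕ}

theorem eval_not : (not p).eval μ ρ = if 0 < p.eval μ ρ then 0 else 1 := rfl

theorem eval_cond : (cond p a b).eval μ ρ = if 0 < p.eval μ ρ then a.eval μ ρ else b.eval μ ρ := rfl

theorem eval_select (g : Bool → Expression) :
    (select p g).eval μ ρ = (g (decide (0 < p.eval μ ρ))).eval μ ρ := by
  rw [select, eval_cond]
  split_ifs with h <;> simp [h]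

theorem pos_not : 0 < (not p).eval μ ρ ↔ ¬ 0 < p.eval μ ρ := by
  rw [eval_not]; split_ifs with h <;> simp [h]

theorem pos_and : 0 < (and p q).eval μ ρ ↔ 0 < p.eval μ ρ ∧ 0 < q.eval μ ρ := by
  simp only [and, eval]; split_ifs with h <;> simp [h]

theorem pos_or : 0 < (or p q).eval μ ρ ↔ 0 < p.eval μ ρ ∨ 0 < q.eval μ ρ := by
  simp only [or, eval]; split_ifs with h <;> simp [h]

theorem pos_xor : 0 < (xor p q).eval μ ρ ↔ ¬ (0 < p.eval μ ρ ↔ 0 < q.eval μ ρ) := by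
  rw [show (xor p q).eval μ ρ = if 0 < p.eval μ ρ then (not q).eval μ ρ else q.eval μ ρ from rfl]
  split_ifs with h
  · rw [pos_not]; simp [h]
  · simp only [h, false_iff, not_not]

theorem pos_lt : 0 < (lt a b).eval μ ρ ↔ a.eval μ ρ < b.eval μ ρ := by
  simp only [lt, eval]; split_ifs with h <;> simp [h]

theorem pos_ne : 0 < (ne a b).eval μ ρ ↔ a.eval μ ρ ≠ b.eval μ ρ := by
  rw [ne, pos_or, pos_lt, pos_lt]; omega

theorem pos_eq : 0 < (eq a b).eval μ ρ ↔ a.eval μ ρ = b.eval μ ρ := by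
  rw [eq, pos_not, pos_ne]; simp

theorem pos_sum {y x : ℕ} : 0 < (sum y x p).eval μ ρ ↔
    ∃ j < ρ x, 0 < p.eval μ (Function.update ρ y j) := by
  simp only [eval]
  rw [Finset.sum_pos_iff]
  simp

theorem eval_not_eq {s : Prop} [Decidable s] (h : 0 < p.eval μ ρ ↔ ¬ s) :
    (not p).eval μ ρ = if s then 1 else 0 := by
  rw [eval_not]; split_ifs <;> simp_all

theorem pos_any {o l : ℕ} : 0 < (any o l p).eval μ ρ ↔
    ∃ d : ℕ → ℕ, (∀ j, d j < 3) ∧ 0 < p.eval (overlay μ (ρ o) (ρ l) d) ρ := by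
  simp only [eval]; split_ifs with h <;> simp [h]

theorem eval_add : (arith .add a b).eval μ ρ = a.eval μ ρ + b.eval μ ρ := rfl
theorem eval_sub : (arith .sub a b).eval μ ρ = a.eval μ ρ - b.eval μ ρ := rfl
theorem eval_mul : (arith .mul a b).eval μ ρ = a.eval μ ρ * b.eval μ ρ := rfl
theorem eval_div : (arith .div a b).eval μ ρ = a.eval μ ρ / b.eval μ ρ := rfl
theorem eval_var {x : ℕ} : (var x).eval μ ρ = ρ x := rfl
theorem eval_const {k : ℕ} : (const k).eval μ ρ = k := rfl
theorem eval_load : (load a).eval μ ρ = μ (a.eval μ ρ) := rfl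

/-- The value of a sum of truth values. -/
theorem eval_sum_eq_card {N : ℕ} {y x : ℕ} (hx : ρ x = N) (s : Fin N → Prop) [DecidablePred s]
    (h : ∀ j : Fin N, p.eval μ (Function.update ρ y j) = if s j then 1 else 0) :
    (sum y x p).eval μ ρ = (Finset.univ.filter s).card := by
  simp only [eval]
  rw [hx, Finset.card_filter, Finset.sum_range]
  exact Finset.sum_congr rfl fun j _ => h j

/-! ### The program: approvals and types -/

/-- Whether agent `a` approves `b` (an agent, or `n` for being unmatched) in layer `i`. -/
def approves (i a b : ℕ) : Expression :=
  ite (var b) (var 0) (load (arith .add (arith .mul (arith .add (arith .mul (var i) (var 0)) (var a))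
    (var 0)) (var b))) (const 0)

/-- Whether two agents are not of the same type. -/
def diffType (a c : ℕ) : Expression :=
  sum 14 1 <| sum 15 0 <| or
    (xor (and (approves 14 a 15) (ne (var 15) (var c))) (and (approves 14 c 15) (ne (var 15) (var a))))
    (or (xor (approves 14 a c) (approves 14 c a))
      (and (ne (var 15) (var a)) (and (ne (var 15) (var c))
        (xor (approves 14 15 a) (approves 14 15 c)))))

/-- The number of agents of the same type that precede agent `11`. -/
def earlier : Expression := sum 12 0 (and (lt (var 12) (var 11)) (not (diffType 11 12)))

/-- The number of types. -/
def typeCount : Expression := sum 11 0 (not earlier)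

/-- The type index of agent `10`; the number of types for the value `n`. -/
def typeOf : Expression :=
  ite (var 10) (var 0)
    (sum 11 0 (not (arith .add earlier
      (sum 12 0 (and (not (lt (var 11) (var 12))) (not (diffType 10 12)))))))
    (var 3)

/-- The number of an agent, and `n` for being unmatched. -/
def _root_.MultilayerMatching.code {n : ℕ} (b : Option (Fin n)) : ℕ := b.elim n Fin.val

/-- The memory and the registers contain the instance. -/
structure Input {n ℓ : ℕ} (T : Profile n ℓ) (μ ρ : ℕ → ℕ) : Prop where
  reg₀ : ρ 0 = n
  reg₁ : ρ 1 = ℓ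
  mem : ∀ (i : Fin ℓ) (a b : Fin n), 0 < μ (((i : ℕ) * n + a) * n + b) ↔ b ∈ T a i

section

variable {n ℓ : ℕ} {T : Profile n ℓ}

theorem Input.update (h : Input T μ ρ) {y : ℕ} (hy : 10 ≤ y) (j : ℕ) :
    Input T μ (Function.update ρ y j) :=
  ⟨by rw [Function.update_of_ne (by omega)]; exact h.reg₀,
    by rw [Function.update_of_ne (by omega)]; exact h.reg₁, h.mem⟩

theorem pos_approves (h : Input T μ ρ) {i a b : ℕ} {i' : Fin ℓ} {a' : Fin n} {b' : Option (Fin n)}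
    (hi : ρ i = i') (ha : ρ a = a') (hb : ρ b = code b') :
    0 < (approves i a b).eval μ ρ ↔ Approves T i' a' b' := by
  simp only [approves, eval, ArithOp.eval, hi, ha, hb, h.reg₀]
  cases b' with
  | none => simp [code, Approves]
  | some b' =>
    have := h.mem i' a' b'
    simp only [code, Option.elim, Approves, Option.some.injEq, exists_eq_left', Fin.is_lt, if_true]
    exact this

theorem pos_approves_some (h : Input T μ ρ) {i a b : ℕ} {i' : Fin ℓ} {a' b' : Fin n}
    (hi : ρ i = i') (ha : ρ a = a') (hb : ρ b = b') :
    0 < (approves i a b).eval μ ρ ↔ b' ∈ T a' i' := by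
  rw [pos_approves h (b' := some b') hi ha hb]
  simp [Approves]

theorem exists_lt_iff_exists_fin {N : ℕ} {P : ℕ → Prop} : (∃ j < N, P j) ↔ ∃ j : Fin N, P j :=
  ⟨fun ⟨j, hj, h⟩ => ⟨⟨j, hj⟩, h⟩, fun ⟨j, h⟩ => ⟨j, j.2, h⟩⟩

theorem pos_diffType (h : Input T μ ρ) {a c : ℕ} {a' c' : Fin n} (ha : ρ a = a') (hc : ρ c = c')
    (ha14 : a < 14) (hc14 : c < 14) : 0 < (diffType a c).eval μ ρ ↔ ¬ SameType T a' c' := by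
  have key : 0 < (diffType a c).eval μ ρ ↔ ∃ (i : Fin ℓ) (u : Fin n),
      ¬ ((u ∈ T a' i ∧ u ≠ c') ↔ (u ∈ T c' i ∧ u ≠ a')) ∨ ¬ (c' ∈ T a' i ↔ a' ∈ T c' i) ∨
      (u ≠ a' ∧ u ≠ c' ∧ ¬ (a' ∈ T u i ↔ c' ∈ T u i)) := by
    rw [diffType, pos_sum, h.reg₁, exists_lt_iff_exists_fin]
    refine exists_congr fun i => ?_
    rw [pos_sum, (h.update (by omega) _).reg₀, exists_lt_iff_exists_fin]
    refine exists_congr fun u => ?_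
    have h' := (h.update (y := 14) (by omega) i).update (y := 15) (by omega) u
    set ρ' := Function.update (Function.update ρ 14 (i : ℕ)) 15 (u : ℕ) with hρ'
    have h14 : ρ' 14 = i := by simp [hρ']
    have h15 : ρ' 15 = u := by simp [hρ']
    have ha' : ρ' a = a' := by
      rw [hρ', Function.update_of_ne (by omega), Function.update_of_ne (by omega), ha]
    have hc' : ρ' c = c' := by
      rw [hρ', Function.update_of_ne (by omega), Function.update_of_ne (by omega), hc]
    simp only [pos_or, pos_xor, pos_and, pos_ne, eval_var, pos_approves_some h' h14 ha' h15,
      pos_approves_some h' h14 hc' h15, pos_approves_some h' h14 ha' hc',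
      pos_approves_some h' h14 hc' ha', pos_approves_some h' h14 h15 ha',
      pos_approves_some h' h14 h15 hc', h15, ha', hc', ne_eq, Fin.val_inj]
  rw [key, ← not_iff_not, not_not]
  push Not
  unfold SameType
  refine forall_congr' fun i => ?_
  constructor
  · intro h1
    -- The symmetry clause does not mention `u`, so any agent can be inserted for it.
    refine ⟨?_, (h1 a').2.1, fun b hb hb' => (h1 b).2.2 hb hb'⟩
    ext u
    simpa using (h1 u).1
  · rintro ⟨h1, h2, h3⟩ u
    refine ⟨?_, h2, h3 u⟩
    simpa using Finset.ext_iff.1 h1 u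

theorem pos_earlier (h : Input T μ ρ) {b : Fin n} (hb : ρ 11 = b) :
    0 < earlier.eval μ ρ ↔ ¬ IsLeader T b := by
  rw [earlier, pos_sum, h.reg₀, exists_lt_iff_exists_fin, IsLeader]
  push Not
  refine exists_congr fun c => ?_
  have h' := h.update (y := 12) (by omega) c
  rw [pos_and, pos_lt, pos_not, pos_diffType h' (a' := b) (c' := c) (by simpa using hb) (by simp)
    (by omega) (by omega), not_not]
  simp [eval_var, hb]

theorem eval_typeCount (h : Input T μ ρ) : typeCount.eval μ ρ = leaderCount T := by
  classical
  refine eval_sum_eq_card h.reg₀ _ fun b => ?_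
  exact eval_not_eq (pos_earlier (h.update (by omega) b) (b := b) (by simp))

theorem eval_typeOf (h : Input T μ ρ) {a : Fin n} (ha : ρ 10 = a) :
    typeOf.eval μ ρ = typeIndex T a := by
  classical
  rw [typeOf, eval, eval_var, eval_var, if_pos (by rw [ha, h.reg₀]; exact a.2)]
  refine eval_sum_eq_card h.reg₀ _ fun b => ?_
  have h' := h.update (y := 11) (by omega) b
  refine eval_not_eq ?_
  -- The sum of the two counts vanishes exactly if `b` is a leader and no agent up to `b` has the
  -- type of `a`.
  rw [eval_add, Nat.add_pos_iff_pos_or_pos,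
    pos_earlier h' (b := b) (by simp), pos_sum, h'.reg₀, exists_lt_iff_exists_fin]
  have : (∃ j : Fin n, 0 < ((not (lt (var 11) (var 12))).and (not (diffType 10 12))).eval μ
      (Function.update (Function.update ρ 11 (b : ℕ)) 12 (j : ℕ))) ↔
      ¬ ∀ c ≤ b, ¬ SameType T a c := by
    push Not
    refine exists_congr fun c => ?_
    have h'' := h'.update (y := 12) (by omega) c
    rw [pos_and, pos_not, pos_lt, pos_not, pos_diffType h'' (a' := a) (c' := c)
      (by simpa using ha) (by simp) (by omega) (by omega), not_not]
    simp [eval_var]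
  rw [this]
  tauto

end

end Expression
end MultilayerMatching

/-! ### Locality of feasibility, class sizes, and the numbering of optional agents. -/

namespace MultilayerMatching

/-- Feasibility looks only at indices below `K`; this matters because a finite array determines `D`
and `ε` only there. -/
theorem Feasible.congr {D D' : ℕ → ℕ → ℕ} {ε ε' c : ℕ → ℕ} {K : ℕ} (h : Feasible D ε c K)
    (hD : ∀ P < K, ∀ Q < K, D P Q = D' P Q) (hε : ∀ P < K, ε P = ε' P) : Feasible D' ε' c K := by
  have h1 : ∀ P < K, ends D' K P = ends D K P := fun P hP =>
    Finset.sum_congr rfl fun Q hQ => by rw [hD P hP Q (Finset.mem_range.1 hQ)]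
  have h2 : ∀ P < K, outs D' ε' c K P = outs D ε c K P := fun P hP => by
    rw [outs, outs, h1 P hP, hε P hP]
  have h3 : ∀ P < K, ins D' ε' c K P = ins D ε c K P := fun P hP => by
    rw [ins, ins, h1 P hP, h2 P hP]
  refine ⟨fun P hP => (h1 P hP).trans_le (h.ends_le P hP), ?_, fun X hX => ?_⟩
  · rw [Finset.sum_congr rfl fun P hP => h2 P (Finset.mem_range.1 hP),
      Finset.sum_congr rfl fun P hP => h3 P (Finset.mem_range.1 hP), h.sum_eq]
  · convert h.hall X hX using 1
    · exact Finset.sum_congr rfl fun P hP => by rw [h2 P (Finset.mem_range.1 hP)]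
    · refine Finset.sum_congr rfl fun Q hQ => ?_
      have hQ := Finset.mem_range.1 hQ
      have : (∃ P < K, 0 < X P ∧ D' P Q = 2) ↔ ∃ P < K, 0 < X P ∧ D P Q = 2 :=
        exists_congr fun P => and_congr_right fun hP => by rw [hD P hP Q hQ]
      rw [h3 Q hQ]
      simp only [this]

theorem classSize_eq {n : ℕ} {tp : Fin n → ℕ} {τ : ℕ} (hτ : ∀ a, tp a < τ) (P : ℕ) (hP : P < τ + 1) :
    classSize tp τ P = if P < τ then (Finset.univ.filter fun a => tp a = P).card else n := by
  rw [classSize, Finset.card_filter, Fintype.sum_sum_type]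
  split_ifs with h
  · have : τ ≠ P := by omega
    simp only [extendedType, Sum.elim_inl, Sum.elim_inr, this, if_false, Finset.sum_const_zero,
      add_zero, Finset.card_filter]
    rfl
  · obtain rfl : P = τ := by omega
    have : ∀ a, tp a ≠ P := fun a => (hτ a).ne
    simp [extendedType, this]

section code

variable {n : ℕ}

theorem code_le (b : Option (Fin n)) : code b < n + 1 := by
  cases b with
  | none => exact Nat.lt_succ_self _
  | some b => exact b.2.trans (Nat.lt_succ_self _)

theorem code_inj {b b' : Option (Fin n)} : code b = code b' ↔ b = b' := by
  rcases b with - | b <;> rcases b' with - | b' <;>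
    simp only [code, Option.elim, reduceCtorEq, Option.some.injEq, Fin.val_inj, iff_false]
  · exact (b'.2).ne'
  · exact (b.2).ne

theorem exists_lt_iff_exists_option {P : ℕ → Prop} :
    (∃ j < n + 1, P j) ↔ ∃ b : Option (Fin n), P (code b) := by
  constructor
  · rintro ⟨j, hj, h⟩
    rcases Nat.lt_succ_iff_lt_or_eq.1 hj with hj | rfl
    · exact ⟨some ⟨j, hj⟩, h⟩
    · exact ⟨none, h⟩
  · rintro ⟨b, h⟩
    exact ⟨_, code_le b, h⟩

end code

namespace Expression

/-! ### The program: safety and feasibility of a pattern -/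

/-- The type of the agent (or of being unmatched) `x`. -/
def type (x : ℕ) : Expression := load (arith .add (var 8) (var x))

def tri (x y : Expression) : Expression :=
  ite x y (arith .add (arith .div (arith .mul y (arith .add y (const 1))) (const 2)) x)
    (arith .add (arith .div (arith .mul x (arith .add x (const 1))) (const 2)) y)

/-- The multiplicity of pairs of agents of the types `x` and `y`. -/
def digit (x y : Expression) : Expression := load (arith .add (var 6) (tri x y))

/-- The agents `10` and `12` can have the partners `11` and `13`. -/
def compatible : Expression :=
  and (ne (var 10) (var 12)) <| and (ne (var 11) (var 10)) <| and (ne (var 11) (var 12)) <|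
  and (ne (var 13) (var 10)) <| and (ne (var 13) (var 12)) <|
  and (digit (type 10) (type 11)) <| and (digit (type 12) (type 13)) <|
  or (ne (tri (type 10) (type 11)) (tri (type 12) (type 13)))
    (lt (const 1) (digit (type 10) (type 11)))

/-- The condition `p` for all compatible agents and partners. -/
def forallCompatible (p : Expression) : Expression :=
  not <| sum 10 0 <| sum 11 4 <| sum 12 0 <| sum 13 4 <| and compatible (not p)

/-- Whether the pair `10`, `12` is good in layer `14`. -/
def goodPair (σ : StabilityNotion) (s : Bool) : Expression :=
  select (approves 14 10 12) fun p => select (approves 14 10 11) fun q =>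
  select (approves 14 12 10) fun p' => select (approves 14 12 13) fun q' =>
    const (if σ.good s p q p' q' then 1 else 0)

/-- Whether the pair `10`, `12` is good in at least `α` layers. -/
def goodLayers (σ : StabilityNotion) : Expression :=
  or (not (lt (sum 14 1 (goodPair σ false)) (var 2)))
    (not (lt (sum 14 1 (goodPair σ true)) (var 2)))

/-- Whether all matchings with the pattern are stable. -/
def safe : StabilityNotion → Expression
  | .global κ => not (lt (sum 14 1 (forallCompatible (goodPair (.global κ) false))) (var 2))
  | σ => forallCompatible (goodLayers σ)

def classSize (x : ℕ) : Expression :=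
  ite (var x) (var 3) (sum 10 0 (eq (type 10) (var x))) (var 0)

def ends (x : ℕ) : Expression :=
  sum 18 5 (cond (eq (digit (var x) (var 18)) (const 1))
    (cond (eq (var x) (var 18)) (const 2) (const 1)) (const 0))

def outs (x : ℕ) : Expression :=
  arith .div (arith .add (arith .sub (classSize x) (ends x))
    (arith .div (digit (var x) (var 5)) (const 2))) (const 2)

def ins (x : ℕ) : Expression := arith .sub (arith .sub (classSize x) (ends x)) (outs x)

/-- Whether the type `x` belongs to the set of types under consideration. -/
def chosen (x : ℕ) : Expression := load (arith .add (var 9) (var x))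

def violatesHall : Expression :=
  lt (sum 17 5 (cond (sum 16 5 (and (chosen 16) (eq (digit (var 16) (var 17)) (const 2)))) (ins 17)
      (const 0)))
    (sum 16 5 (cond (chosen 16) (outs 16) (const 0)))

def feasible : Expression :=
  and (not (sum 16 5 (lt (classSize 16) (ends 16)))) <|
  and (eq (sum 16 5 (outs 16)) (sum 16 5 (ins 16))) <|
  not (any 9 5 violatesHall)

/-- Whether there is a stable matching. -/
def answer (σ : StabilityNotion) : Expression := any 6 7 (and (safe σ) feasible)

variable {μ ρ : ℕ → ℕ} {n ℓ : ℕ} {T : Profile n ℓ} {tp : Fin n → ℕ} {τ α : ℕ} {D : ℕ → ℕ → ℕ}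

/-- The memory and the registers contain the instance, its types and a pattern. -/
structure Tables (T : Profile n ℓ) (tp : Fin n → ℕ) (τ α : ℕ) (D : ℕ → ℕ → ℕ) (μ ρ : ℕ → ℕ) : Prop
    extends Input T μ ρ where
  reg₂ : ρ 2 = α
  reg₃ : ρ 3 = τ
  reg₄ : ρ 4 = n + 1
  reg₅ : ρ 5 = τ + 1
  type_some : ∀ a : Fin n, μ (ρ 8 + a) = tp a
  type_none : μ (ρ 8 + n) = τ
  digit_eq : ∀ P < τ + 2, ∀ Q < τ + 2, μ (ρ 6 + triIndex P Q) = D P Q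

theorem Tables.update (h : Tables T tp τ α D μ ρ) {y : ℕ} (hy : 10 ≤ y) (j : ℕ) :
    Tables T tp τ α D μ (Function.update ρ y j) := by
  have e : ∀ x, x < 10 → Function.update ρ y j x = ρ x := fun x hx =>
    Function.update_of_ne (by omega) _ _
  refine ⟨h.toInput.update hy j, ?_, ?_, ?_, ?_, ?_, ?_, ?_⟩
  · rw [e _ (by omega), h.reg₂]
  · rw [e _ (by omega), h.reg₃]
  · rw [e _ (by omega), h.reg₄]
  · rw [e _ (by omega), h.reg₅]
  · rw [e _ (by omega)]; exact h.type_some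
  · rw [e _ (by omega)]; exact h.type_none
  · rw [e _ (by omega)]; exact h.digit_eq

theorem eval_tri (x y : Expression) : (tri x y).eval μ ρ = triIndex (x.eval μ ρ) (y.eval μ ρ) := rfl

theorem eval_digit (h : Tables T tp τ α D μ ρ) {x y : Expression} {P Q : ℕ} (hx : x.eval μ ρ = P)
    (hy : y.eval μ ρ = Q) (hP : P < τ + 2) (hQ : Q < τ + 2) : (digit x y).eval μ ρ = D P Q := by
  rw [digit, eval_load, eval_add, eval_tri, hx, hy, eval_var]
  exact h.digit_eq P hP Q hQ

theorem eval_type (h : Tables T tp τ α D μ ρ) {x : ℕ} {b : Option (Fin n)} (hx : ρ x = code b) :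
    (type x).eval μ ρ = partnerType tp τ b := by
  rw [type, eval_load, eval_add, eval_var, eval_var, hx]
  cases b with
  | none => exact h.type_none
  | some b => exact h.type_some b

theorem partnerType_lt (hτ : ∀ a, tp a < τ) (b : Option (Fin n)) : partnerType tp τ b < τ + 1 := by
  cases b with
  | none => exact Nat.lt_succ_self _
  | some b => exact (hτ b).trans (Nat.lt_succ_self _)

theorem pos_compatible (h : Tables T tp τ α D μ ρ) (hτ : ∀ a, tp a < τ) {a a' : Fin n}
    {b b' : Option (Fin n)} (ha : ρ 10 = a) (hb : ρ 11 = code b) (ha' : ρ 12 = a')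
    (hb' : ρ 13 = code b') :
    0 < compatible.eval μ ρ ↔ a ≠ a' ∧ b ≠ some a ∧ b ≠ some a' ∧ b' ≠ some a ∧ b' ≠ some a' ∧
      0 < D (tp a) (partnerType tp τ b) ∧ 0 < D (tp a') (partnerType tp τ b') ∧
      ((tp a = tp a' ∧ partnerType tp τ b = partnerType tp τ b') ∨
        (tp a = partnerType tp τ b' ∧ partnerType tp τ b = tp a') →
        1 < D (tp a) (partnerType tp τ b)) := by
  have t1 := eval_type h (x := 10) (b := some a) ha
  have t2 := eval_type h (x := 11) hb
  have t3 := eval_type h (x := 12) (b := some a') ha'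
  have t4 := eval_type h (x := 13) hb'
  have l1 := hτ a
  have l2 := partnerType_lt hτ b
  have l3 := hτ a'
  have l4 := partnerType_lt hτ b'
  have c : ∀ (x : Fin n) (y : Option (Fin n)), code y = (x : ℕ) ↔ y = some x := fun x y =>
    code_inj (b := y) (b' := some x)
  simp only [compatible, pos_and, pos_or, pos_ne, pos_lt, eval_var, eval_const, eval_tri, t1, t2, t3,
    t4, eval_digit h t1 t2 (show partnerType tp τ (some a) < τ + 2 from l1.trans (by omega))
      (l2.trans (by omega)),
    eval_digit h t3 t4 (show partnerType tp τ (some a') < τ + 2 from l3.trans (by omega))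
      (l4.trans (by omega)), ha, hb, ha', hb', ne_eq, c, Fin.val_inj, triIndex_eq_iff]
  -- The program compares triangular indices, which are equal exactly for equal unordered pairs of
  -- types.
  rw [← imp_iff_not_or]
  rfl

theorem pos_forallCompatible (h : Tables T tp τ α D μ ρ) (hτ : ∀ a, tp a < τ) {p : Expression}
    {φ : PairCondition ℓ}
    (hp : ∀ (a : Fin n) (b : Option (Fin n)) (a' : Fin n) (b' : Option (Fin n)) (ρ' : ℕ → ℕ),
      ρ' = Function.update (Function.update (Function.update (Function.update ρ 10 a) 11 (code b)) 12 a')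
        13 (code b') → (0 < p.eval μ ρ' ↔ φ.At T a b a' b')) :
    0 < (forallCompatible p).eval μ ρ ↔ φ.Safe T tp τ D := by
  rw [forallCompatible, pos_not, pos_sum, h.reg₀, exists_lt_iff_exists_fin, PairCondition.Safe,
    not_exists]
  refine forall_congr' fun a => ?_
  have h1 := h.update (y := 10) (by omega) a
  rw [pos_sum, h1.reg₄, exists_lt_iff_exists_option, not_exists]
  refine forall_congr' fun b => ?_
  have h2 := h1.update (y := 11) (by omega) (code b)
  rw [pos_sum, h2.reg₀, exists_lt_iff_exists_fin, not_exists]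
  refine forall_congr' fun a' => ?_
  have h3 := h2.update (y := 12) (by omega) a'
  rw [pos_sum, h3.reg₄, exists_lt_iff_exists_option, not_exists]
  refine forall_congr' fun b' => ?_
  have h4 := h3.update (y := 13) (by omega) (code b')
  rw [pos_and, pos_not, hp a b a' b' _ rfl,
    pos_compatible h4 hτ (a := a) (b := b) (a' := a') (b' := b') (by simp) (by simp) (by simp)
      (by simp)]
  tauto

open Classical in
theorem eval_goodPair (h : Input T μ ρ) (σ : StabilityNotion) (s : Bool) {a a' : Fin n}
    {b b' : Option (Fin n)} {i : Fin ℓ} (ha : ρ 10 = a) (hb : ρ 11 = code b) (ha' : ρ 12 = a')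
    (hb' : ρ 13 = code b') (hi : ρ 14 = i) :
    (goodPair σ s).eval μ ρ = if σ.good s (decide (a' ∈ T a i)) (decide (Approves T i a b))
      (decide (a ∈ T a' i)) (decide (Approves T i a' b')) then 1 else 0 := by
  simp only [goodPair, eval_select, eval_const, pos_approves_some h hi ha ha',
    pos_approves_some h hi ha' ha, pos_approves h hi ha hb, pos_approves h hi ha' hb']

theorem pos_goodLayers (h : Tables T tp τ α D μ ρ) (σ : StabilityNotion) {a a' : Fin n}
    {b b' : Option (Fin n)} (ha : ρ 10 = a) (hb : ρ 11 = code b) (ha' : ρ 12 = a')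
    (hb' : ρ 13 = code b') :
    0 < (goodLayers σ).eval μ ρ ↔ (σ.localCondition α : PairCondition ℓ).At T a b a' b' := by
  classical
  have key : ∀ s, (sum 14 1 (goodPair σ s)).eval μ ρ = (Finset.univ.filter fun i : Fin ℓ =>
      σ.good s (decide (a' ∈ T a i)) (decide (Approves T i a b))
      (decide (a ∈ T a' i)) (decide (Approves T i a' b'))).card := fun s => by
    refine eval_sum_eq_card h.reg₁ _ fun i => ?_
    rw [eval_goodPair (h.toInput.update (by omega) _) σ s (a := a) (b := b) (a' := a') (b' := b')
      (i := i) (by simpa using ha) (by simpa using hb) (by simpa using ha') (by simpa using hb')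
      (by simp)]
  rw [goodLayers, pos_or, pos_not, pos_not, pos_lt, pos_lt, key, key, eval_var, h.reg₂]
  simp only [PairCondition.At, StabilityNotion.localCondition, Bool.exists_bool, Nat.not_lt]
  refine or_congr ?_ ?_ <;> constructor <;> (intro hx; convert hx)

/-- For the global notions the loop over the layers is outside the four loops over agents and
partners, for the others inside. Either way there are `O(n^4 ℓ)` rounds of constant cost. -/
theorem pos_safe (h : Tables T tp τ α D μ ρ) (hτ : ∀ a, tp a < τ) (σ : StabilityNotion) :
    0 < (safe σ).eval μ ρ ↔ σ.Via α fun φ : PairCondition ℓ => φ.Safe T tp τ D := by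
  classical
  have key : ∀ σ, 0 < (forallCompatible (goodLayers σ)).eval μ ρ ↔
      (σ.localCondition α : PairCondition ℓ).Safe T tp τ D := by
    intro σ
    refine pos_forallCompatible h hτ fun a b a' b' ρ' hρ' => ?_
    have h' : Tables T tp τ α D μ ρ' := hρ' ▸ (((h.update (by omega) _).update (by omega) _).update
      (by omega) _).update (by omega) _
    exact pos_goodLayers h' σ (by simp [hρ']) (by simp [hρ']) (by simp [hρ']) (by simp [hρ'])
  cases σ with
  | global κ =>
    rw [safe, pos_not, pos_lt, Nat.not_lt, eval_var, h.reg₂, StabilityNotion.Via,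
      eval_sum_eq_card h.reg₁ fun i =>
        PairCondition.Safe (StabilityNotion.layerCondition (.global κ) i) T tp τ D]
    intro i
    refine eval_not_eq ?_
    rw [← not_iff_not, not_not, ← pos_not]
    refine pos_forallCompatible (h.update (by omega) _) hτ fun a b a' b' ρ' hρ' => ?_
    have h' : Tables T tp τ α D μ ρ' := hρ' ▸ ((((h.update (by omega) _).update (by omega) _).update
      (by omega) _).update (by omega) _).update (by omega) _
    rw [eval_goodPair h'.toInput (.global κ) false (a := a) (b := b) (a' := a') (b' := b') (i := i)
      (by simp [hρ']) (by simp [hρ']) (by simp [hρ']) (by simp [hρ']) (by simp [hρ'])]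
    simp only [PairCondition.At, StabilityNotion.layerCondition]
    split_ifs with hx
    · simp only [zero_lt_one, true_iff]; convert hx
    · simp only [lt_self_iff_false, false_iff]; convert hx
  | pair κ => exact key _
  | individualWeak => exact key _
  | individualSuper => exact key _

end Expression
end MultilayerMatching

/-! ### Correctness of the feasibility test and of the whole decision expression. -/

namespace MultilayerMatching
namespace Expression

variable {μ ρ : ℕ → ℕ} {n ℓ : ℕ} {T : Profile n ℓ} {tp : Fin n → ℕ} {τ α : ℕ} {D : ℕ → ℕ → ℕ}

theorem eval_sum_eq {x y N : ℕ} {p : Expression} {f : ℕ → ℕ} (hx : ρ x = N)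
    (h : ∀ j < N, p.eval μ (Function.update ρ y j) = f j) :
    (sum y x p).eval μ ρ = ∑ j ∈ Finset.range N, f j := by
  simp only [eval]
  rw [hx]
  exact Finset.sum_congr rfl fun j hj => h j (Finset.mem_range.1 hj)

theorem eval_classSize (h : Tables T tp τ α D μ ρ) (hτ : ∀ a, tp a < τ) {x P : ℕ} (hx : ρ x = P)
    (hP : P < τ + 1) (h10 : x ≠ 10) :
    (classSize x).eval μ ρ = MultilayerMatching.classSize tp τ P := by
  rw [classSize_eq hτ P hP, classSize, eval, eval_var, eval_var, hx, h.reg₃, eval_var, h.reg₀]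
  congr 1
  refine eval_sum_eq_card h.reg₀ _ fun a => ?_
  refine eval_not_eq ?_
  rw [pos_ne, eval_type (h.update (by omega) _) (b := some a) (by simp [code]), eval_var,
    Function.update_of_ne h10, hx]
  rfl

theorem eval_ends (h : Tables T tp τ α D μ ρ) {x P : ℕ} (hx : ρ x = P) (hP : P < τ + 1)
    (h18 : x ≠ 18) : (ends x).eval μ ρ = MultilayerMatching.ends D (τ + 1) P := by
  refine eval_sum_eq h.reg₅ fun Q hQ => ?_
  have hx' : Function.update ρ 18 Q x = P := by rw [Function.update_of_ne h18, hx]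
  have e := eval_digit (h.update (y := 18) (by omega) Q) (x := var x) (y := var 18) (P := P) (Q := Q)
    hx' (by simp [eval]) (by omega) (by omega)
  simp only [eval_cond, pos_eq, e, eval_var, hx', eval_const, Function.update_self]

/-- The rounding choices are stored in the same triangular array as the multiplicities: the choice
for `P` is the digit of the pair of `P` with an artificial type `τ + 1`, the content of register 5.
-/
theorem eval_outs (h : Tables T tp τ α D μ ρ) (hτ : ∀ a, tp a < τ) {x P : ℕ} (hx : ρ x = P)
    (hP : P < τ + 1) (h10 : x ≠ 10) (h18 : x ≠ 18) : (outs x).eval μ ρ =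
      MultilayerMatching.outs D (fun P => D P (τ + 1)) (MultilayerMatching.classSize tp τ) (τ + 1) P := by
  have e := eval_digit h (x := var x) (y := var 5) (P := P) (Q := τ + 1) hx h.reg₅ (by omega) (by omega)
  simp only [outs, eval_div, eval_add, eval_sub, eval_classSize h hτ hx hP h10,
    eval_ends h hx hP h18, e, eval_const]
  rfl

theorem eval_ins (h : Tables T tp τ α D μ ρ) (hτ : ∀ a, tp a < τ) {x P : ℕ} (hx : ρ x = P)
    (hP : P < τ + 1) (h10 : x ≠ 10) (h18 : x ≠ 18) : (ins x).eval μ ρ =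
      MultilayerMatching.ins D (fun P => D P (τ + 1)) (MultilayerMatching.classSize tp τ) (τ + 1) P := by
  simp only [ins, eval_sub, eval_classSize h hτ hx hP h10, eval_ends h hx hP h18,
    eval_outs h hτ hx hP h10 h18]
  rfl

theorem address_lt (i : Fin ℓ) (a b : Fin n) : ((i : ℕ) * n + a) * n + b < ℓ * n * n := by
  have hi := i.2
  have ha := a.2
  have hb := b.2
  calc ((i : ℕ) * n + a) * n + b < ((i : ℕ) * n + a) * n + n := by omega
    _ = ((i : ℕ) * n + a + 1) * n := by ring
    _ ≤ ((i : ℕ) * n + n) * n := Nat.mul_le_mul_right _ (by omega)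
    _ = ((i : ℕ) + 1) * n * n := by ring
    _ ≤ ℓ * n * n := Nat.mul_le_mul_right _ (Nat.mul_le_mul_right _ hi)

/-- The array for Hall's condition lies behind all tables, so overwriting it leaves them intact. -/
theorem Tables.of_agree {μ' : ℕ → ℕ} {B : ℕ} (h : Tables T tp τ α D μ ρ) (h8 : ℓ * n * n ≤ ρ 8)
    (h6 : ρ 8 + n < ρ 6) (hB : ρ 6 + (τ + 2) * (τ + 3) / 2 ≤ B) (hμ : ∀ x < B, μ' x = μ x) :
    Tables T tp τ α D μ' ρ := by
  refine ⟨⟨h.reg₀, h.reg₁, fun i a b => ?_⟩, h.reg₂, h.reg₃, h.reg₄, h.reg₅, fun a => ?_, ?_,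
    fun P hP Q hQ => ?_⟩
  · rw [hμ, h.mem]
    have h1 := address_lt i a b
    omega
  · rw [hμ, h.type_some]
    have := a.2; omega
  · rw [hμ, h.type_none]; omega
  · rw [hμ, h.digit_eq P hP Q hQ]
    have := triIndex_lt hP hQ
    rw [show τ + 2 + 1 = τ + 3 from rfl] at this
    omega

theorem pos_violatesHall (h : Tables T tp τ α D μ ρ) (hτ : ∀ a, tp a < τ) {X : ℕ → ℕ}
    (hX : ∀ P < τ + 1, μ (ρ 9 + P) = X P) :
    0 < violatesHall.eval μ ρ ↔
      ¬ ∑ P ∈ Finset.range (τ + 1), (if 0 < X P then MultilayerMatching.outs D (fun P => D P (τ + 1))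
          (MultilayerMatching.classSize tp τ) (τ + 1) P else 0) ≤
        ∑ Q ∈ Finset.range (τ + 1), if ∃ P < τ + 1, 0 < X P ∧ D P Q = 2 then
          MultilayerMatching.ins D (fun P => D P (τ + 1)) (MultilayerMatching.classSize tp τ) (τ + 1) Q
          else 0 := by
  have hX' : ∀ ρ' : ℕ → ℕ, ρ' 9 = ρ 9 → ∀ P, ρ' 16 = P → P < τ + 1 →
      (chosen 16).eval μ ρ' = X P := by
    intro ρ' h9 P h16 hP
    rw [chosen, eval_load, eval_add, eval_var, eval_var, h9, h16, hX P hP]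
  rw [violatesHall, pos_lt, Nat.not_le]
  rw [eval_sum_eq h.reg₅ (p := cond (chosen 16) _ _) (y := 16) (f := fun P => if 0 < X P then
    MultilayerMatching.outs D (fun P => D P (τ + 1)) (MultilayerMatching.classSize tp τ) (τ + 1) P
      else 0), eval_sum_eq h.reg₅ (y := 17) (f := fun Q => if ∃ P < τ + 1, 0 < X P ∧ D P Q = 2 then
          MultilayerMatching.ins D (fun P => D P (τ + 1)) (MultilayerMatching.classSize tp τ) (τ + 1) Q
          else 0)]
  · intro Q hQ
    have h17 := h.update (y := 17) (by omega) Q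
    rw [eval_cond, eval_ins h17 hτ (x := 17) (P := Q) (by simp) hQ (by omega) (by omega), eval_const]
    have : 0 < (sum 16 5 (and (chosen 16) (eq (digit (var 16) (var 17)) (const 2)))).eval μ
        (Function.update ρ 17 Q) ↔ ∃ P < τ + 1, 0 < X P ∧ D P Q = 2 := by
      rw [pos_sum, h17.reg₅]
      refine exists_congr fun P => and_congr_right fun hP => ?_
      rw [pos_and, pos_eq, hX' _ (by simp) P (by simp) hP,
        eval_digit (h17.update (y := 16) (by omega) P) (P := P) (Q := Q) (by simp [eval])
          (by simp [eval]) (by omega) (by omega), eval_const]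
    simp only [this]
  · intro P hP
    rw [eval_cond, hX' _ (by simp) P (by simp) hP,
      eval_outs (h.update (by omega) _) hτ (x := 16) (P := P) (by simp) hP (by omega) (by omega),
      eval_const]

theorem pos_feasible (h : Tables T tp τ α D μ ρ) (hτ : ∀ a, tp a < τ) (h8 : ℓ * n * n ≤ ρ 8)
    (h6 : ρ 8 + n < ρ 6) (h9 : ρ 6 + (τ + 2) * (τ + 3) / 2 ≤ ρ 9) :
    0 < feasible.eval μ ρ ↔
      Feasible D (fun P => D P (τ + 1)) (MultilayerMatching.classSize tp τ) (τ + 1) := by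
  rw [feasible, pos_and, pos_and, pos_not, pos_not, pos_eq]
  have e1 : (¬ 0 < (sum 16 5 (lt (classSize 16) (ends 16))).eval μ ρ) ↔ ∀ P < τ + 1,
      MultilayerMatching.ends D (τ + 1) P ≤ MultilayerMatching.classSize tp τ P := by
    rw [pos_sum, h.reg₅]
    push Not
    refine forall_congr' fun P => imp_congr_right fun hP => ?_
    have h' := h.update (y := 16) (by omega) P
    have := pos_lt (a := classSize 16) (b := ends 16) (μ := μ) (ρ := Function.update ρ 16 P)
    rw [eval_classSize h' hτ (x := 16) (P := P) (by simp) hP (by omega),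
      eval_ends h' (x := 16) (P := P) (by simp) hP (by omega)] at this
    omega
  have e2 : (sum 16 5 (outs 16)).eval μ ρ = ∑ P ∈ Finset.range (τ + 1), MultilayerMatching.outs D
      (fun P => D P (τ + 1)) (MultilayerMatching.classSize tp τ) (τ + 1) P :=
    eval_sum_eq h.reg₅ fun P hP =>
      eval_outs (h.update (by omega) _) hτ (by simp) hP (by omega) (by omega)
  have e3 : (sum 16 5 (ins 16)).eval μ ρ = ∑ P ∈ Finset.range (τ + 1), MultilayerMatching.ins D
      (fun P => D P (τ + 1)) (MultilayerMatching.classSize tp τ) (τ + 1) P :=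
    eval_sum_eq h.reg₅ fun P hP =>
      eval_ins (h.update (by omega) _) hτ (by simp) hP (by omega) (by omega)
  have e4 : ∀ X : ℕ → ℕ, 0 < violatesHall.eval (overlay μ (ρ 9) (ρ 5) X) ρ ↔ _ := fun X =>
    pos_violatesHall (X := X) (h.of_agree (B := ρ 9) h8 h6 h9 fun x hx => by
      rw [overlay, if_neg (by omega)]) hτ fun P hP => overlay_apply (by rw [h.reg₅]; exact hP)
  rw [e1, e2, e3, pos_any]
  simp only [e4]
  constructor
  · rintro ⟨h1, h2, h3⟩
    exact ⟨h1, h2, fun X hX => by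
      by_contra hcon
      exact h3 ⟨X, hX, hcon⟩⟩
  · rintro ⟨h1, h2, h3⟩
    exact ⟨h1, h2, fun ⟨X, hX, hcon⟩ => hcon (h3 X hX)⟩

/-- The main expression is positive exactly for the instances that admit a stable matching. -/
theorem pos_answer (hI : Input T μ ρ) (h2 : ρ 2 = α) (h3 : ρ 3 = τ) (h4 : ρ 4 = n + 1)
    (h5 : ρ 5 = τ + 1) (h7 : ρ 7 = (τ + 2) * (τ + 3) / 2) (h8 : ℓ * n * n ≤ ρ 8)
    (h6 : ρ 8 + n < ρ 6) (h9 : ρ 6 + (τ + 2) * (τ + 3) / 2 ≤ ρ 9)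
    (htype : ∀ a : Fin n, μ (ρ 8 + a) = tp a) (hnone : μ (ρ 8 + n) = τ)
    (htp : ∀ a b, tp a = tp b ↔ SameType T a b) (hτ : ∀ a, tp a < τ) (hα : α ≤ ℓ)
    (σ : StabilityNotion) :
    0 < (answer σ).eval μ ρ ↔ ∃ M : Matching n, σ.IsStable T α M := by
  classical
  rw [exists_isStable_iff σ htp hτ hα, answer, pos_any]
  have key : ∀ (d : ℕ → ℕ), Tables T tp τ α (fun P Q => d (triIndex P Q))
      (overlay μ (ρ 6) (ρ 7) d) ρ := by
    intro d
    have e : ∀ x < ρ 6, overlay μ (ρ 6) (ρ 7) d x = μ x := fun x hx => by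
      rw [overlay, if_neg (by omega)]
    refine ⟨⟨hI.reg₀, hI.reg₁, fun i a b => ?_⟩, h2, h3, h4, h5, fun a => ?_, ?_, fun P hP Q hQ => ?_⟩
    · rw [e, hI.mem]
      have h1 := address_lt i a b
      omega
    · rw [e, htype]; have := a.2; omega
    · rw [e, hnone]; omega
    · exact overlay_apply (by rw [h7]; exact triIndex_lt hP hQ)
  constructor
  · rintro ⟨d, hd, h⟩
    rw [pos_and, pos_safe (key d) hτ, pos_feasible (key d) hτ h8 h6 h9] at h
    exact ⟨fun P Q => d (triIndex P Q), fun P => d (triIndex P (τ + 1)),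
      fun P Q => congrArg d (triIndex_comm P Q), fun P Q => hd _, fun P => hd _, h.2, h.1⟩
  · rintro ⟨D, ε, hD, hD3, hε, hF, hS⟩
    -- `D` and `ε` are merged into one table, with `ε` in the row and column of the artificial type.
    set E : ℕ → ℕ → ℕ := fun P Q => if P < τ + 1 then (if Q < τ + 1 then D P Q else ε P) else ε Q
      with hE
    have hE1 : ∀ P < τ + 1, ∀ Q < τ + 1, E P Q = D P Q := fun P hP Q hQ => by
      simp only [hE, if_pos hP, if_pos hQ]
    have hE2 : ∀ P < τ + 1, E P (τ + 1) = ε P := fun P hP => by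
      simp only [hE, if_pos hP, lt_irrefl, if_false]
    have hE3 : ∀ P Q, E P Q < 3 := fun P Q => by
      simp only [hE]; split_ifs <;> simp [hD3, hε]
    -- The restriction `p.1 < τ + 1` makes the entry independent of the chosen preimage: a preimage
    -- with exchanged coordinates then has both below `τ + 1`, where `D` is symmetric.
    set d : ℕ → ℕ := fun i => if h : ∃ p : ℕ × ℕ, p.1 < τ + 1 ∧ triIndex p.1 p.2 = i then
      E h.choose.1 h.choose.2 else 0 with hd
    have hd3 : ∀ i, d i < 3 := fun i => by
      simp only [hd]; split_ifs
      · exact hE3 _ _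
      · omega
    have hdE : ∀ P < τ + 1, ∀ Q < τ + 2, d (triIndex P Q) = E P Q := by
      intro P hP Q hQ
      have hex : ∃ p : ℕ × ℕ, p.1 < τ + 1 ∧ triIndex p.1 p.2 = triIndex P Q := ⟨(P, Q), hP, rfl⟩
      have h0 : d (triIndex P Q) = E hex.choose.1 hex.choose.2 := by
        simp only [hd]; rw [dif_pos hex]
      obtain ⟨c1, c2⟩ := hex.choose_spec
      rw [triIndex_eq_iff] at c2
      rw [h0]
      rcases c2 with ⟨e1, e2⟩ | ⟨e1, e2⟩
      · rw [e1, e2]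
      · rw [e1] at c1 ⊢
        rw [e2, hE1 Q c1 P hP, hE1 P hP Q c1, hD]
    refine ⟨d, hd3, ?_⟩
    rw [pos_and, pos_safe (key d) hτ, pos_feasible (key d) hτ h8 h6 h9]
    constructor
    · refine hS.mono fun φ hφ a b a' b' p1 p2 p3 p4 p5 p6 p7 p8 => ?_
      have l1 := (hτ a).trans (Nat.lt_succ_self τ)
      have l2 := partnerType_lt hτ b
      have l3 := (hτ a').trans (Nat.lt_succ_self τ)
      have l4 := partnerType_lt hτ b'
      simp only at p6 p7 p8
      rw [hdE _ l1 _ (l2.trans (by omega)), hE1 _ l1 _ l2] at p6 p8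
      rw [hdE _ l3 _ (l4.trans (by omega)), hE1 _ l3 _ l4] at p7
      exact hφ a b a' b' p1 p2 p3 p4 p5 p6 p7 p8
    · refine hF.congr (fun P hP Q hQ => ?_) fun P hP => ?_
      · rw [hdE P hP Q (by omega), hE1 P hP Q hQ]
      · rw [hdE P hP _ (by omega), hE2 P hP]

end Expression
end MultilayerMatching

namespace MultilayerMatching

namespace Expression

/-! ### Running times -/

/-- Exponents of the four parameters that occur in running times. -/
abbrev Exponents := ℕ × ℕ × ℕ × ℕ

/-- The monomial with the given exponents. -/
def monomial (N L A B : ℕ) (d : Exponents) : ℕ := N ^ d.1 * L ^ d.2.1 * A ^ d.2.2.1 * B ^ d.2.2.2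

/-- The exponents of a bound for the number of repetitions of a sum. -/
def sumExponents (x : ℕ) : Exponents := if x = 1 then (0, 1, 0, 0) else (1, 0, 0, 0)

/-- The exponents of a bound for the number of repetitions of a quantification. -/
def anyExponents (l : ℕ) : Exponents := if l = 7 then (0, 0, 1, 0) else (0, 0, 0, 1)

/-- The exponents of a bound for the running time. -/
def exponents : Expression → Exponents
  | const _ => 0
  | var _ => 0
  | arith _ a b => a.exponents ⊔ b.exponents
  | ite a b c d => (a.exponents ⊔ b.exponents) ⊔ (c.exponents ⊔ d.exponents)
  | load a => a.exponents
  | sum _ x body => sumExponents x + body.exponents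
  | any _ l body => anyExponents l + (body.exponents ⊔ (0, 0, 0, 1))

/-- The constant factor of a bound for the running time. -/
def factor : Expression → ℕ
  | const _ => 1
  | var _ => 1
  | arith _ a b => a.factor + b.factor + 1
  | ite a b c d => a.factor + b.factor + (c.factor + d.factor) + 1
  | load a => a.factor + 1
  | sum _ _ body => body.factor + 10
  | any _ _ body => body.factor + 21

/-- All loops and quantifications have one of the expected lengths. -/
def Measured : Expression → Bool
  | const _ => true
  | var _ => true
  | arith _ a b => a.Measured && b.Measured
  | ite a b c d => a.Measured && b.Measured && c.Measured && d.Measured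
  | load a => a.Measured
  | sum _ x body => (x == 0 || x == 1 || x == 4 || x == 5) && body.Measured
  | any _ l body => (l == 5 || l == 7) && body.Measured

/-- The expression has no quantification. -/
def AnyFree : Expression → Bool
  | const _ => true
  | var _ => true
  | arith _ a b => a.AnyFree && b.AnyFree
  | ite a b c d => a.AnyFree && b.AnyFree && c.AnyFree && d.AnyFree
  | load a => a.AnyFree
  | sum _ _ body => body.AnyFree
  | any _ _ _ => false

theorem AnyFree.scratchFree {e : Expression} (h : e.AnyFree) (μ ρ : ℕ → ℕ) :
    e.ScratchFree μ ρ := by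
  induction e with
  | const | var => trivial
  | arith op a b iha ihb =>
    simp only [AnyFree, Bool.and_eq_true] at h
    exact ⟨iha h.1, ihb h.2⟩
  | ite a b c d iha ihb ihc ihd =>
    simp only [AnyFree, Bool.and_eq_true] at h
    exact ⟨iha h.1.1.1, ihb h.1.1.2, ihc h.1.2, ihd h.2⟩
  | load a ih => exact ih h
  | sum y x body ih => exact ih h
  | any o l body ih => simp [AnyFree] at h

/-- The values of the loop bounds are at most the parameters of the running time. -/
structure Sizes (N L A B : ℕ) (ρ : ℕ → ℕ) : Prop where
  one_le_N : 1 ≤ N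
  one_le_L : 1 ≤ L
  reg₀ : ρ 0 ≤ N
  reg₁ : ρ 1 ≤ L
  reg₄ : ρ 4 ≤ N
  reg₅ : ρ 5 ≤ N
  pow_reg₅ : 3 ^ ρ 5 ≤ B
  reg₇ : ρ 7 ≤ B
  pow_reg₇ : 3 ^ ρ 7 ≤ A

section

variable {N L A B : ℕ} {ρ : ℕ → ℕ}

theorem monomial_add (d d' : Exponents) :
    monomial N L A B (d + d') = monomial N L A B d * monomial N L A B d' := by
  simp only [monomial, Prod.fst_add, Prod.snd_add, pow_add]
  ring

theorem Sizes.monomial_mono (h : Sizes N L A B ρ) {d d' : Exponents} (hd : d ≤ d') :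
    monomial N L A B d ≤ monomial N L A B d' := by
  have hA : 1 ≤ A := (Nat.one_le_pow _ _ (by norm_num)).trans h.pow_reg₇
  have hB : 1 ≤ B := (Nat.one_le_pow _ _ (by norm_num)).trans h.pow_reg₅
  have := h.one_le_N
  have := h.one_le_L
  obtain ⟨h1, h2, h3, h4⟩ := hd
  unfold monomial
  gcongr

theorem Sizes.one_le_monomial (h : Sizes N L A B ρ) (d : Exponents) : 1 ≤ monomial N L A B d := by
  have := h.monomial_mono (show 0 ≤ d from ⟨Nat.zero_le _, Nat.zero_le _, Nat.zero_le _, Nat.zero_le _⟩)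
  simpa [monomial] using this

theorem Sizes.reg_le_monomial (h : Sizes N L A B ρ) {x : ℕ}
    (hx : (x == 0 || x == 1 || x == 4 || x == 5) = true) :
    ρ x ≤ monomial N L A B (sumExponents x) := by
  simp only [Bool.or_eq_true, beq_iff_eq] at hx
  rcases hx with ((rfl | rfl) | rfl) | rfl
  · simpa [monomial, sumExponents] using h.reg₀
  · simpa [monomial, sumExponents] using h.reg₁
  · simpa [monomial, sumExponents] using h.reg₄
  · simpa [monomial, sumExponents] using h.reg₅

theorem Sizes.pow_reg_le_monomial (h : Sizes N L A B ρ) {l : ℕ} (hl : (l == 5 || l == 7) = true) :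
    3 ^ ρ l ≤ monomial N L A B (anyExponents l) ∧ ρ l ≤ B := by
  simp only [Bool.or_eq_true, beq_iff_eq] at hl
  rcases hl with rfl | rfl
  · exact ⟨by simpa [monomial, anyExponents] using h.pow_reg₅,
      (Nat.lt_pow_self (by norm_num)).le.trans h.pow_reg₅⟩
  · exact ⟨by simpa [monomial, anyExponents] using h.pow_reg₇, h.reg₇⟩

/-- All monomials are at least 1 and monotone in the exponents, so additions take the componentwise
maximum of exponents and add the factors, while repetitions add exponents. The work of a counter
increment, linear in the array length, is absorbed by raising the exponent of `B` in the body to at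
least 1. -/
theorem Sizes.cost_le (h : Sizes N L A B ρ) (e : Expression) (he : e.Measured) :
    e.cost ρ ≤ e.factor * monomial N L A B e.exponents := by
  induction e with
  | const | var => simp [cost, factor, exponents, monomial]
  | arith op a b iha ihb =>
    simp only [Measured, Bool.and_eq_true] at he
    have h1 := (iha he.1).trans (Nat.mul_le_mul_left _
      (h.monomial_mono (le_sup_left : _ ≤ a.exponents ⊔ b.exponents)))
    have h2 := (ihb he.2).trans (Nat.mul_le_mul_left _
      (h.monomial_mono (le_sup_right : _ ≤ a.exponents ⊔ b.exponents)))
    have h3 := h.one_le_monomial (a.exponents ⊔ b.exponents)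
    simp only [cost, factor, exponents, add_mul, one_mul]
    omega
  | ite a b c d iha ihb ihc ihd =>
    simp only [Measured, Bool.and_eq_true] at he
    simp only [cost, factor, exponents, add_mul, one_mul]
    set D := (a.exponents ⊔ b.exponents) ⊔ (c.exponents ⊔ d.exponents) with hD
    have h1 := (iha he.1.1.1).trans (Nat.mul_le_mul_left _
      (h.monomial_mono (show _ ≤ D from le_sup_of_le_left le_sup_left)))
    have h2 := (ihb he.1.1.2).trans (Nat.mul_le_mul_left _
      (h.monomial_mono (show _ ≤ D from le_sup_of_le_left le_sup_right)))
    have h3 := (ihc he.1.2).trans (Nat.mul_le_mul_left _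
      (h.monomial_mono (show _ ≤ D from le_sup_of_le_right le_sup_left)))
    have h4 := (ihd he.2).trans (Nat.mul_le_mul_left _
      (h.monomial_mono (show _ ≤ D from le_sup_of_le_right le_sup_right)))
    have h5 := h.one_le_monomial D
    omega
  | load a ih =>
    have h1 := ih he
    have h2 := h.one_le_monomial a.exponents
    simp only [cost, factor, exponents, add_mul, one_mul]
    omega
  | sum y x body ih =>
    simp only [Measured, Bool.and_eq_true] at he
    have h1 := ih he.2
    have h2 := h.one_le_monomial body.exponents
    have h3 := h.reg_le_monomial he.1
    have h4 := h.one_le_monomial (sumExponents x)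
    simp only [cost, factor, exponents, monomial_add]
    calc ρ x * (body.cost ρ + 3) + 7
        ≤ monomial N L A B (sumExponents x) *
            (body.factor * monomial N L A B body.exponents + 3 * monomial N L A B body.exponents) +
          7 * (monomial N L A B (sumExponents x) * monomial N L A B body.exponents) := by
          refine Nat.add_le_add (Nat.mul_le_mul h3 (by omega)) ?_
          have := Nat.mul_le_mul h4 h2
          omega
      _ = _ := by ring
  | any o l body ih =>
    simp only [Measured, Bool.and_eq_true] at he
    simp only [cost, factor, exponents, monomial_add]
    set D := body.exponents ⊔ (0, 0, 0, 1) with hD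
    have h1 := (ih he.2).trans (Nat.mul_le_mul_left _
      (h.monomial_mono (show _ ≤ D from le_sup_left)))
    have h2 := h.one_le_monomial D
    obtain ⟨h3, h3'⟩ := h.pow_reg_le_monomial he.1
    have h4 := h.one_le_monomial (anyExponents l)
    have h5 : ρ l ≤ monomial N L A B D :=
      h3'.trans ((by simp [monomial] : B ≤ monomial N L A B (0, 0, 0, 1)).trans
        (h.monomial_mono le_sup_right))
    calc 3 ^ ρ l * (body.cost ρ + 8 * ρ l + 7) + 6
        ≤ monomial N L A B (anyExponents l) * (body.factor * monomial N L A B D +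
            8 * monomial N L A B D + 7 * monomial N L A B D) +
          6 * (monomial N L A B (anyExponents l) * monomial N L A B D) := by
          refine Nat.add_le_add (Nat.mul_le_mul h3 (by omega)) ?_
          have := Nat.mul_le_mul h4 h2
          omega
      _ = _ := by ring

theorem Sizes.cost_le_of_le (h : Sizes N L A B ρ) {e : Expression} (he : e.Measured)
    {d : Exponents} (hd : e.exponents ≤ d) : e.cost ρ ≤ e.factor * monomial N L A B d :=
  (h.cost_le e he).trans (Nat.mul_le_mul_left _ (h.monomial_mono hd))

end

theorem answer_wellFormed (σ : StabilityNotion) : (answer σ).WellFormed = true := by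
  rcases σ with κ | κ | _ | _ <;> (try cases κ) <;> rfl

theorem answer_measured (σ : StabilityNotion) : (answer σ).Measured = true := by
  rcases σ with κ | κ | _ | _ <;> (try cases κ) <;> rfl

theorem answer_exponents (σ : StabilityNotion) : (answer σ).exponents ≤ (4, 1, 1, 2) := by
  rcases σ with κ | κ | _ | _ <;> (try cases κ) <;> decide +kernel

theorem typeCount_exponents : typeCount.exponents ≤ (4, 1, 1, 2) := by decide +kernel

theorem typeOf_exponents : typeOf.exponents ≤ (3, 1, 1, 2) := by decide +kernel

theorem safe_anyFree (σ : StabilityNotion) : (safe σ).AnyFree = true := by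
  rcases σ with κ | κ | _ | _ <;> (try cases κ) <;> rfl

/-- The two quantified arrays are disjoint, so the Hall array is still zero while a pattern is
written in the other one. Apart from these two quantifiers the expression has none. -/
theorem scratchFree_answer (σ : StabilityNotion) {μ ρ : ℕ → ℕ} (h9 : ρ 6 + ρ 7 ≤ ρ 9)
    (h : ∀ x, ρ 6 ≤ x → μ x = 0) : (answer σ).ScratchFree μ ρ := by
  refine ⟨fun j _ => h _ (by omega), fun d _ => ?_⟩
  have hf : (any 9 5 violatesHall).ScratchFree (overlay μ (ρ 6) (ρ 7) d) ρ := by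
    refine ⟨fun j _ => ?_, fun d' _ => AnyFree.scratchFree rfl _ _⟩
    rw [overlay, if_neg (by omega)]
    exact h _ (by omega)
  have ha : ∀ e : Expression, e.AnyFree = true → e.ScratchFree (overlay μ (ρ 6) (ρ 7) d) ρ :=
    fun e he => AnyFree.scratchFree he _ _
  exact ⟨trivial, ha _ (safe_anyFree σ), ⟨trivial, ha _ rfl,
    ⟨trivial, ha _ rfl, ⟨trivial, hf, trivial, trivial⟩, trivial⟩, trivial⟩, trivial⟩

end Expression

/-- The exponential factor of the running time. -/
theorem three_pow_mul_le (τ : ℕ) :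
    3 ^ ((τ + 2) * (τ + 3) / 2) * (3 ^ (τ + 1)) ^ 2 ≤ 2 ^ 41 * 2 ^ ((τ + 1) ^ 2) := by
  rw [← pow_mul, ← pow_add, ← pow_add]
  set e := (τ + 2) * (τ + 3) / 2 + (τ + 1) * 2 with he
  have h1 : 2 * ((τ + 2) * (τ + 3) / 2) ≤ (τ + 2) * (τ + 3) := Nat.mul_div_le _ _
  have h2 : e * 8 ≤ (41 + (τ + 1) ^ 2) * 5 := by
    -- What is needed is `τ ^ 2 - 26 * τ + 170 ≥ 0`, that is `(τ - 13) ^ 2 + 1 ≥ 0`; this is where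
    -- the constant 41 comes from.
    have h3 : 26 * τ ≤ τ ^ 2 + 169 := by
      zify
      nlinarith [sq_nonneg ((τ : ℤ) - 13)]
    nlinarith
  -- Fifth powers allow the use of `3 ^ 5 = 243 ≤ 256 = 2 ^ 8`.
  rw [← Nat.pow_le_pow_iff_left (n := 5) (by norm_num)]
  calc (3 ^ e) ^ 5 = (3 ^ 5) ^ e := by rw [← pow_mul, ← pow_mul, mul_comm]
    _ ≤ (2 ^ 8) ^ e := Nat.pow_le_pow_left (by norm_num) _
    _ = 2 ^ (e * 8) := by rw [← pow_mul, mul_comm]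
    _ ≤ 2 ^ ((41 + (τ + 1) ^ 2) * 5) := Nat.pow_le_pow_right (by norm_num) h2
    _ = _ := by rw [pow_mul]

/-- Bounds the length of the pattern array by the parameter `B` of the running time. -/
theorem half_mul_le_three_pow (τ : ℕ) : (τ + 2) * (τ + 3) / 2 ≤ 3 ^ (τ + 1) := by
  induction τ with
  | zero => norm_num
  | succ τ ih =>
    have h := half_mul_succ (τ + 2)
    have h' : τ + 1 < 3 ^ (τ + 1) := Nat.lt_pow_self (by norm_num)
    have h'' : 3 ^ 1 ≤ 3 ^ (τ + 1) := Nat.pow_le_pow_right (by norm_num) (by omega)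
    rw [show (τ + 1 + 2) * (τ + 1 + 3) / 2 = (τ + 2) * (τ + 3) / 2 + (τ + 3) from h, pow_succ _ (τ + 1)]
    omega

end MultilayerMatching

namespace MultilayerMatching

open Expression

/-! ### The program -/

/-- Put the value of an expression into register `r`. -/
def assign (r : ℕ) (e : Expression) : Prog := .seq (e.compile 24) (.instr (.copy r 24))

/-- Write the types of the agents, and of being unmatched, into the memory. -/
def fillTypes : Prog :=
  .loop 10 4 <|
    .seq ((Expression.arith .add (.var 8) (.var 10)).compile 24) <|
    .seq (typeOf.compile 25) <|
    .seq (.instr (.store 24 25)) <|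
    assign 10 (.arith .add (.var 10) (.const 1))

/-- The number of unordered pairs of types, including two artificial types. -/
def pairCount : Expression :=
  .arith .div (.arith .mul (.arith .add (.var 3) (.const 2)) (.arith .add (.var 3) (.const 3))) (.const 2)

def decisionProgram (σ : StabilityNotion) : Prog :=
  .seq (assign 3 typeCount) <|
  .seq (assign 4 (.arith .add (.var 0) (.const 1))) <|
  .seq (assign 8 (.arith .mul (.arith .mul (.var 1) (.var 0)) (.var 0))) <|
  .seq (assign 5 (.arith .add (.var 3) (.const 1))) <|
  .seq (assign 6 (.arith .add (.var 8) (.var 4))) <|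
  .seq (assign 7 pairCount) <|
  .seq (assign 9 (.arith .add (.var 6) (.var 7))) <|
  .seq fillTypes <|
  assign 0 (answer σ)

/-- The memory is `μ` and the first 24 registers are `ρ`. -/
structure State.Holds (s : State) (μ ρ : ℕ → ℕ) : Prop where
  mem : s.mem = μ
  reg : ∀ r < 24, s.reg r = ρ r

theorem Runs.seq_add {w : ℕ} {p q : Prog} {s : State} {T T' : ℕ} {Q : State → Prop}
    (h : Runs w p s T fun s' => Runs w q s' T' Q) : Runs w (.seq p q) s (T + T') Q :=
  Runs.seq (h.mono le_rfl fun _ h => h.mono (by omega) fun _ h => h) (by omega)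

section

variable {w V : ℕ} {μ ρ : ℕ → ℕ} {s : State}

theorem assign_runs (hs : s.Holds μ ρ) (hb : Bounded V μ ρ) {e : Expression} (r v : ℕ)
    (hv : e.eval μ ρ = v) (hw : e.WellFormed) (hf : e.ScratchFree μ ρ) (hV : V ^ e.width < 2 ^ w) :
    Runs w (assign r e) s (e.cost ρ + 1) fun s' => s'.Holds μ (Function.update ρ r v) := by
  obtain ⟨rfl, hs⟩ := hs
  refine Runs.seq_add ((e.compile_runs 24 s ρ hw le_rfl hs (fun _ _ => rfl) hb hf hV).mono le_rfl ?_)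
  rintro s' ⟨h1, h2, h3⟩
  refine Runs.instr (i := .copy r 24) (State.setReg_eq (w := w) s' ?_) le_rfl ⟨h1, fun x hx => ?_⟩
  · rw [h3]; exact (eval_le e hb hw).trans_lt hV
  · simp only [Function.update_apply]
    split_ifs
    · rw [h3, hv]
    · rw [h2 x hx, hs x hx]

theorem overlay_succ (o l : ℕ) (g : ℕ → ℕ) :
    overlay μ o (l + 1) g = Function.update (overlay μ o l g) (o + l) (g l) := by
  funext x
  rw [Function.update_apply]
  split_ifs with h
  · rw [overlay, if_pos (by omega)]
    congr 1; omega
  · unfold overlay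
    congr 1
    rw [eq_iff_iff]; omega

theorem Bounded.overlay_of_le (h : Bounded V μ ρ) (o l : ℕ) {g : ℕ → ℕ} (hg : ∀ x, g x ≤ V ^ 8) :
    Bounded V (overlay μ o l g) ρ :=
  ⟨h.two_le, h.env, fun x => by
    unfold overlay
    split_ifs
    · exact hg _
    · exact h.mem x⟩

end

section

variable {n ℓ : ℕ} {T : Profile n ℓ} {μ ρ : ℕ → ℕ}

theorem Expression.Input.overlay (h : Input T μ ρ) {o : ℕ} (ho : ℓ * n * n ≤ o) (l : ℕ) (g : ℕ → ℕ) :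
    Input T (MultilayerMatching.overlay μ o l g) ρ :=
  ⟨h.reg₀, h.reg₁, fun i a b => by
    rw [MultilayerMatching.overlay, if_neg (by have := address_lt i a b; omega)]
    exact h.mem i a b⟩

/-- The type of an agent, given by its number, and `leaderCount T` for other numbers. -/
noncomputable def typeTable (T : Profile n ℓ) (x : ℕ) : ℕ :=
  if h : x < n then typeIndex T ⟨x, h⟩ else leaderCount T

theorem typeTable_le (T : Profile n ℓ) (x : ℕ) : typeTable T x ≤ n := by
  unfold typeTable
  split_ifs with h
  · exact (typeIndex_lt T _).le.trans (leaderCount_le T)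
  · exact leaderCount_le T

theorem eval_typeOf_eq_typeTable (h : Input T μ ρ) (h3 : ρ 3 = leaderCount T) :
    typeOf.eval μ ρ = typeTable T (ρ 10) := by
  unfold typeTable
  split_ifs with hx
  · exact eval_typeOf h (a := ⟨ρ 10, hx⟩) rfl
  · rw [typeOf, eval, eval_var, eval_var, h.reg₀, if_neg hx, eval_var, h3]

/-- One type index costs a multiple of `n^3 ℓ`, and there are `n + 1` rounds; the last one, for the
number `n`, writes the type of being unmatched. The exponents of `A` and `B` are there only to match
the bound for the main expression. -/
theorem fillTypes_runs {w V : ℕ} {s : State} {N L A B : ℕ} (hs : s.Holds μ ρ) (hI : Input T μ ρ)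
    (hb : Bounded V μ ρ) (hz : Sizes N L A B ρ) (h3 : ρ 3 = leaderCount T) (h4 : ρ 4 = n + 1)
    (h8 : ρ 8 = ℓ * n * n) (h10 : ρ 10 = 0) (hn : n + 1 ≤ V ^ 8)
    (hV : V ^ (typeOf.width + 12) < 2 ^ w) :
    Runs w fillTypes s ((typeOf.factor + 10) * monomial N L A B (4, 1, 1, 2)) fun s' =>
      s'.Holds (overlay μ (ρ 8) (n + 1) (typeTable T)) (Function.update ρ 10 (n + 1)) := by
  have hV1 : V ^ typeOf.width < 2 ^ w := (hb.pow_le_pow (by omega)).trans_lt hV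
  have hV2 : V ^ 9 < 2 ^ w := (hb.pow_le_pow (by omega)).trans_lt hV
  set Y := monomial N L A B (3, 1, 1, 2) with hY
  have hY1 : 1 ≤ Y := hz.one_le_monomial _
  have hZ : monomial N L A B (4, 1, 1, 2) = N * Y := by
    rw [show ((4, 1, 1, 2) : Exponents) = (1, 0, 0, 0) + (3, 1, 1, 2) from rfl, monomial_add]
    simp [monomial, hY]
  have hN : n + 1 ≤ N := h4 ▸ hz.reg₄
  have hcost : typeOf.cost ρ ≤ typeOf.factor * Y := hz.cost_le_of_le rfl typeOf_exponents
  refine (Runs.for_loop (x := 10) (y := 4) (N := n + 1) (B := (typeOf.factor + 8) * Y)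
    (I := fun j s => s.Holds (overlay μ (ρ 8) j (typeTable T)) (Function.update ρ 10 j))
    (fun j s h => ⟨?_, ?_⟩) (fun j s hj h => ?_) 0 (Nat.zero_le _) s ?_).mono ?_ fun _ h => h
  · rw [h.reg 10 (by omega), Function.update_self]
  · rw [h.reg 4 (by omega), Function.update_of_ne (by omega), h4]
  · set μ' := overlay μ (ρ 8) j (typeTable T) with hμ'
    set ρ' := Function.update ρ 10 j with hρ'
    have hI' : Input T μ' ρ' := (hI.overlay (by omega) _ _).update (by omega) _
    have hb' : Bounded V μ' ρ' := (Bounded.overlay_of_le hb _ _ fun x =>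
      (typeTable_le T x).trans (by omega)).update _ (by omega)
    have hlow : ∀ r < 10, ρ' r = ρ r := fun r hr => Function.update_of_ne (by omega) _ _
    have h10' : ρ' 10 = j := Function.update_self ..
    obtain ⟨hm, hr⟩ := h
    refine Runs.mono (T := 3 + (typeOf.factor * Y + (1 + 4))) ?_ ?_ fun _ h => h
    · refine Runs.seq_add ((Expression.compile_runs (ρ₀ := ρ) _ 24 s ρ' rfl le_rfl hr hlow (hm ▸ hb')
        (AnyFree.scratchFree rfl _ _) hV2).mono le_rfl ?_)
      rintro s₁ ⟨m₁, r₁, v₁⟩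
      rw [hm] at m₁ v₁
      refine Runs.seq_add ((Expression.compile_runs (ρ₀ := ρ) typeOf 25 s₁ ρ' rfl (by omega)
        (fun r h => (r₁ r h).trans (hr r h)) hlow (m₁ ▸ hb') (AnyFree.scratchFree rfl _ _)
        hV1).mono hcost ?_)
      rintro s₂ ⟨m₂, r₂, v₂⟩
      rw [m₁] at m₂ v₂
      refine Runs.seq_add (Runs.instr (i := .store 24 25) rfl le_rfl ?_)
      have hnext : overlay μ (ρ 8) (j + 1) (typeTable T) =
          Function.update s₂.mem (s₂.reg 24) (s₂.reg 25) := by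
        rw [overlay_succ, m₂, r₂ 24 (by omega), v₁, v₂,
          eval_typeOf_eq_typeTable hI' ((hlow 3 (by omega)).trans h3), h10', eval_add, eval_var,
          eval_var, hlow 8 (by omega), h10']
      rw [hnext]
      refine (assign_runs (V := V) (ρ := ρ') ⟨rfl, fun r h => ?_⟩ ?_ 10 (j + 1) ?_ rfl
        (AnyFree.scratchFree rfl _ _) hV2).mono ?_ fun s' h => ?_
      · exact (r₂ r (by omega)).trans ((r₁ r h).trans (hr r h))
      · rw [← hnext]
        exact (Bounded.overlay_of_le hb _ _ fun x => (typeTable_le T x).trans (by omega)).update _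
          (by omega)
      · rw [eval_add, eval_var, eval_const, h10']
      · exact le_rfl
      · rwa [hρ', Function.update_idem] at h
    · rw [add_mul]; omega
  · refine ⟨?_, fun r h => ?_⟩
    · rw [overlay_zero fun j hj => absurd hj (Nat.not_lt_zero _)]; exact hs.mem
    · rw [← h10, Function.update_eq_self]; exact hs.reg r h
  · rw [hZ]
    calc (n + 1 - 0) * ((typeOf.factor + 8) * Y + 1) + 1
        ≤ N * ((typeOf.factor + 8) * Y + Y) + N * Y := by
          refine Nat.add_le_add (Nat.mul_le_mul (by omega) (by omega)) ?_
          exact Nat.mul_pos (by omega) hY1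
      _ = _ := by ring

end

end MultilayerMatching

/-! ### The input state, and correctness and running time of the whole program. -/

namespace MultilayerMatching

open Expression

variable {n ℓ : ℕ}

theorem address_inj {i i' : Fin ℓ} {a b a' b' : Fin n}
    (h : ((i : ℕ) * n + a) * n + b = ((i' : ℕ) * n + a') * n + b') : i = i' ∧ a = a' ∧ b = b' := by
  have key : ∀ {x y : ℕ} {c d : Fin n}, x * n + c = y * n + d → x = y ∧ c = d := by
    intro x y c d h
    have hn : 0 < n := c.pos
    have h1 := congrArg (· / n) h
    simp only [mul_comm _ n, Nat.mul_add_div hn, Nat.div_eq_of_lt c.2, Nat.div_eq_of_lt d.2,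
      add_zero] at h1
    subst h1
    exact ⟨rfl, Fin.ext (by omega)⟩
  obtain ⟨h1, rfl⟩ := key h
  obtain ⟨h2, rfl⟩ := key h1
  exact ⟨Fin.ext h2, rfl, rfl⟩

theorem input_inputState (T : Profile n ℓ) (α : ℕ) :
    Input T (inputState T α).mem (inputState T α).reg := by
  refine ⟨rfl, rfl, fun i a b => ?_⟩
  simp only [inputState]
  split_ifs with h
  · obtain ⟨i', a', b', h1, h2⟩ := h
    obtain ⟨rfl, rfl, rfl⟩ := address_inj h1
    simpa using h2
  · simp only [lt_self_iff_false, false_iff]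
    exact fun hb => h ⟨i, a, b, rfl, hb⟩

theorem inputState_mem_le (T : Profile n ℓ) (α x : ℕ) : (inputState T α).mem x ≤ 1 := by
  simp only [inputState]
  split_ifs <;> simp

theorem inputState_mem_eq_zero (T : Profile n ℓ) (α : ℕ) {x : ℕ} (hx : ℓ * n * n ≤ x) :
    (inputState T α).mem x = 0 := by
  simp only [inputState]
  rw [if_neg]
  rintro ⟨i, a, b, rfl, -⟩
  have := address_lt i a b
  omega

theorem Expression.Sizes.update {N L A B : ℕ} {ρ : ℕ → ℕ} (h : Sizes N L A B ρ) (r v : ℕ)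
    (hN : r = 0 ∨ r = 4 ∨ r = 5 → v ≤ N) (hL : r = 1 → v ≤ L) (hB : r = 5 → 3 ^ v ≤ B)
    (hA : r = 7 → v ≤ B ∧ 3 ^ v ≤ A) : Sizes N L A B (Function.update ρ r v) := by
  obtain ⟨h1, h2, h3, h4, h5, h6, h7, h8, h9⟩ := h
  refine ⟨h1, h2, ?_, ?_, ?_, ?_, ?_, ?_, ?_⟩ <;> rw [Function.update_apply] <;> split_ifs with hr <;>
    first | assumption | (subst hr; simp_all)

/-- The factor in the running time of the program. -/
def decisionFactor (σ : StabilityNotion) : ℕ :=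
  typeCount.factor + typeOf.factor + (answer σ).factor + 100

/-- An exponent bounding all numbers that the program computes. -/
def decisionWidth (σ : StabilityNotion) : ℕ :=
  typeCount.width + typeOf.width + (answer σ).width + 50

/-- Memory layout: the approval matrices, then from `ρ 8` on the `n + 1` type indices, from `ρ 6` on
the pattern of length `ρ 7`, and from `ρ 9` on the set for Hall's condition of length `ρ 5`. The
environments `ρ₁`, …, `ρ₈` follow the successive assignments. -/
theorem decisionProgram_runs (σ : StabilityNotion) (T : Profile n ℓ) (α w : ℕ) (hn : 1 ≤ n)
    (hα : 1 ≤ α) (hαℓ : α ≤ ℓ) (hw : (n * ℓ + 1) ^ decisionWidth σ < 2 ^ w) :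
    Runs w (decisionProgram σ) (inputState T α)
      (decisionFactor σ * monomial (n + 1) ℓ (3 ^ ((leaderCount T + 2) * (leaderCount T + 3) / 2))
        (3 ^ (leaderCount T + 1)) (4, 1, 1, 2))
      fun s => (s.reg 0 = 0 ∨ s.reg 0 = 1) ∧ (0 < s.reg 0 ↔ ∃ M : Matching n, σ.IsStable T α M) := by
  obtain ⟨τ, hτ⟩ : ∃ τ, τ = leaderCount T := ⟨_, rfl⟩
  -- `V` exceeds both `n` and `ℓ`. The largest address stored in a register is at most `V ^ 2 + V +
  -- V ^ 3 ≤ V ^ 4`, well within the bound `V ^ 8` of `Bounded`.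
  obtain ⟨V, hV⟩ : ∃ V, V = n * ℓ + 1 := ⟨_, rfl⟩
  obtain ⟨m, hm⟩ : ∃ m, m = (τ + 2) * (τ + 3) / 2 := ⟨_, rfl⟩
  obtain ⟨N, hN⟩ : ∃ N, N = n + 1 := ⟨_, rfl⟩
  obtain ⟨A, hA⟩ : ∃ A, A = 3 ^ m := ⟨_, rfl⟩
  obtain ⟨B, hB⟩ : ∃ B, B = 3 ^ (τ + 1) := ⟨_, rfl⟩
  obtain ⟨Z, hZ⟩ : ∃ Z, Z = monomial N ℓ A B (4, 1, 1, 2) := ⟨_, rfl⟩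
  rw [← hV] at hw
  rw [← hτ, ← hm, ← hN, ← hA, ← hB, ← hZ]
  have hτn : τ ≤ n := hτ ▸ leaderCount_le T
  have hnV : n + 1 ≤ V := by nlinarith
  have hℓV : ℓ + 1 ≤ V := by nlinarith
  have hV2 : 2 ≤ V := by omega
  have pV : ∀ k ≤ 8, V ^ k ≤ V ^ 8 := fun k hk => Nat.pow_le_pow_right (by omega) hk
  have v1 : V ≤ V ^ 8 := by simpa using pV 1 (by omega)
  have e2 : ℓ * n * n ≤ V ^ 2 := by
    calc ℓ * n * n = (n * ℓ) * n := by ring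
      _ ≤ V * V := Nat.mul_le_mul (by omega) (by omega)
      _ = V ^ 2 := (sq V).symm
  have e3 : V ^ 2 + V ≤ V ^ 3 := by
    have : V ^ 2 * 2 ≤ V ^ 3 := by rw [pow_succ V 2]; exact Nat.mul_le_mul_left _ hV2
    have : V * 2 ≤ V ^ 2 := by rw [sq]; exact Nat.mul_le_mul_left _ hV2
    omega
  have e4 : m ≤ V ^ 3 := by
    have h1 : (τ + 2) * (τ + 3) ≤ (V + 1) * (V * 2) := Nat.mul_le_mul (by omega) (by omega)
    have h2 : (V + 1) * (V * 2) = (V ^ 2 + V) * 2 := by ring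
    omega
  have e5 : V ^ 3 * 2 ≤ V ^ 4 := by rw [pow_succ V 3]; exact Nat.mul_le_mul_left _ hV2
  have p2 := pV 2 (by omega)
  have p3 := pV 3 (by omega)
  have p4 := pV 4 (by omega)
  have hmB : m ≤ B := by rw [hm, hB]; exact half_mul_le_three_pow τ
  have hwid : ∀ k ≤ decisionWidth σ, V ^ k < 2 ^ w := fun k hk =>
    (Nat.pow_le_pow_right (by omega) hk).trans_lt hw
  have hw50 : ∀ k ≤ 50, V ^ k < 2 ^ w := fun k hk => hwid k (hk.trans (Nat.le_add_left _ _))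
  obtain ⟨μ, ρ₀, hs₀, hI₀, r2, rz, hμ1, hμ0, hρb⟩ : ∃ μ ρ, (inputState T α).Holds μ ρ ∧
      Input T μ ρ ∧ ρ 2 = α ∧ (∀ r, 3 ≤ r → ρ r = 0) ∧ (∀ x, μ x ≤ 1) ∧
      (∀ x, ℓ * n * n ≤ x → μ x = 0) ∧ ∀ r, ρ r ≤ V ^ 8 := by
    refine ⟨_, _, ⟨rfl, fun _ _ => rfl⟩, input_inputState T α, rfl, fun r hr => ?_,
      inputState_mem_le T α, fun x => inputState_mem_eq_zero T α, fun r => ?_⟩ <;>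
      simp only [inputState]
    · rw [if_neg (by omega), if_neg (by omega), if_neg (by omega)]
    · split_ifs <;> omega
  generalize inputState T α = s₀ at *
  have r0 := hI₀.reg₀
  have r1 := hI₀.reg₁
  have hb₀ : Bounded V μ ρ₀ := ⟨hV2, fun r _ => hρb r, fun x => (hμ1 x).trans (by omega)⟩
  have h3A : ∀ k, 1 ≤ 3 ^ k := fun k => Nat.one_le_pow _ _ (by norm_num)
  have hz₀ : Sizes N ℓ A B ρ₀ := by
    rw [hA, hB]
    refine ⟨by omega, by omega, by rw [r0]; omega, r1.le, ?_, ?_, ?_, ?_, ?_⟩ <;>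
      rw [rz _ (by omega)] <;> first | exact Nat.zero_le _ | exact h3A _
  have hZ1 : 1 ≤ Z := hZ ▸ hz₀.one_le_monomial _
  obtain ⟨ρ₁, hρ₁⟩ : ∃ ρ, ρ = Function.update ρ₀ 3 τ := ⟨_, rfl⟩
  obtain ⟨ρ₂, hρ₂⟩ : ∃ ρ, ρ = Function.update ρ₁ 4 (n + 1) := ⟨_, rfl⟩
  obtain ⟨ρ₃, hρ₃⟩ : ∃ ρ, ρ = Function.update ρ₂ 8 (ℓ * n * n) := ⟨_, rfl⟩
  obtain ⟨ρ₄, hρ₄⟩ : ∃ ρ, ρ = Function.update ρ₃ 5 (τ + 1) := ⟨_, rfl⟩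
  obtain ⟨ρ₅, hρ₅⟩ : ∃ ρ, ρ = Function.update ρ₄ 6 (ℓ * n * n + (n + 1)) := ⟨_, rfl⟩
  obtain ⟨ρ₆, hρ₆⟩ : ∃ ρ, ρ = Function.update ρ₅ 7 m := ⟨_, rfl⟩
  obtain ⟨ρ₇, hρ₇⟩ : ∃ ρ, ρ = Function.update ρ₆ 9 (ℓ * n * n + (n + 1) + m) := ⟨_, rfl⟩
  obtain ⟨ρ₈, hρ₈⟩ : ∃ ρ, ρ = Function.update ρ₇ 10 (n + 1) := ⟨_, rfl⟩
  have hb₁ : Bounded V μ ρ₁ := hρ₁ ▸ hb₀.update _ (by omega)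
  have hb₂ : Bounded V μ ρ₂ := hρ₂ ▸ hb₁.update _ (by omega)
  have hb₃ : Bounded V μ ρ₃ := hρ₃ ▸ hb₂.update _ (by omega)
  have hb₄ : Bounded V μ ρ₄ := hρ₄ ▸ hb₃.update _ (by omega)
  have hb₅ : Bounded V μ ρ₅ := hρ₅ ▸ hb₄.update _ (by omega)
  have hb₆ : Bounded V μ ρ₆ := hρ₆ ▸ hb₅.update _ (by omega)
  have hb₇ : Bounded V μ ρ₇ := hρ₇ ▸ hb₆.update _ (by omega)
  have hz₁ : Sizes N ℓ A B ρ₁ := hρ₁ ▸ hz₀.update _ _ (by omega) (by omega) (by omega) (by omega)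
  have hz₂ : Sizes N ℓ A B ρ₂ := hρ₂ ▸ hz₁.update _ _ (by omega) (by omega) (by omega) (by omega)
  have hz₃ : Sizes N ℓ A B ρ₃ := hρ₃ ▸ hz₂.update _ _ (by omega) (by omega) (by omega) (by omega)
  have hz₄ : Sizes N ℓ A B ρ₄ := hρ₄ ▸
    hz₃.update _ _ (by omega) (by omega) (fun _ => hB.ge) (by omega)
  have hz₅ : Sizes N ℓ A B ρ₅ := hρ₅ ▸ hz₄.update _ _ (by omega) (by omega) (by omega) (by omega)
  have hz₆ : Sizes N ℓ A B ρ₆ := hρ₆ ▸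
    hz₅.update _ _ (by omega) (by omega) (by omega) (fun _ => ⟨hmB, hA.ge⟩)
  have hz₇ : Sizes N ℓ A B ρ₇ := hρ₇ ▸ hz₆.update _ _ (by omega) (by omega) (by omega) (by omega)
  have hz₈ : Sizes N ℓ A B ρ₈ := hρ₈ ▸ hz₇.update _ _ (by omega) (by omega) (by omega) (by omega)
  have hI₇ : Input T μ ρ₇ := ⟨by simp [hρ₇, hρ₆, hρ₅, hρ₄, hρ₃, hρ₂, hρ₁, r0],
    by simp [hρ₇, hρ₆, hρ₅, hρ₄, hρ₃, hρ₂, hρ₁, r1], hI₀.mem⟩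
  have k8 : ρ₇ 8 = ℓ * n * n := by simp [hρ₇, hρ₆, hρ₅, hρ₄, hρ₃]
  have hVo : V ^ (typeOf.width + 12) < 2 ^ w := hwid _ (by unfold decisionWidth; omega)
  have hprog : Runs w (decisionProgram σ) s₀
      ((typeCount.cost ρ₀ + 1) + (4 + (6 + (4 + (4 + (10 + (4 +
        ((typeOf.factor + 10) * Z + ((answer σ).cost ρ₈ + 1)))))))))
      fun s => ∃ v, v = (answer σ).eval (overlay μ (ℓ * n * n) (n + 1) (typeTable T)) ρ₈ ∧
        s.reg 0 = v := by
    refine Runs.seq_add ((assign_runs hs₀ hb₀ 3 τ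
      ((eval_typeCount hI₀).trans hτ.symm) rfl (AnyFree.scratchFree rfl _ _)
      (hwid _ (by unfold decisionWidth; omega))).mono le_rfl fun s₁ hs₁ => ?_)
    rw [← hρ₁] at hs₁
    refine Runs.seq_add ((assign_runs hs₁ hb₁ 4 (n + 1) ?_ rfl (AnyFree.scratchFree rfl _ _)
      (hw50 _ (by decide))).mono (by simp [cost]) fun s₂ hs₂ => ?_)
    · simp [eval_add, eval_var, eval_const, hρ₁, r0]
    rw [← hρ₂] at hs₂
    refine Runs.seq_add ((assign_runs hs₂ hb₂ 8 (ℓ * n * n) ?_ rfl (AnyFree.scratchFree rfl _ _)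
      (hw50 _ (by decide))).mono (by simp [cost]) fun s₃ hs₃ => ?_)
    · simp [eval_mul, eval_var, hρ₂, hρ₁, r0, r1]
    rw [← hρ₃] at hs₃
    refine Runs.seq_add ((assign_runs hs₃ hb₃ 5 (τ + 1) ?_ rfl (AnyFree.scratchFree rfl _ _)
      (hw50 _ (by decide))).mono (by simp [cost]) fun s₄ hs₄ => ?_)
    · simp [eval_add, eval_var, eval_const, hρ₃, hρ₂, hρ₁]
    rw [← hρ₄] at hs₄
    refine Runs.seq_add ((assign_runs hs₄ hb₄ 6 (ℓ * n * n + (n + 1)) ?_ rfl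
      (AnyFree.scratchFree rfl _ _) (hw50 _ (by decide))).mono (by simp [cost]) fun s₅ hs₅ => ?_)
    · simp [eval_add, eval_var, hρ₄, hρ₃, hρ₂]
    rw [← hρ₅] at hs₅
    refine Runs.seq_add ((assign_runs hs₅ hb₅ 7 m ?_ rfl (AnyFree.scratchFree rfl _ _)
      (hw50 _ (by decide))).mono (by simp [cost, pairCount]) fun s₆ hs₆ => ?_)
    · simp [pairCount, eval_add, eval_mul, eval_div, eval_var, eval_const, hρ₅, hρ₄, hρ₃, hρ₂, hρ₁, hm]
    rw [← hρ₆] at hs₆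
    refine Runs.seq_add ((assign_runs hs₆ hb₆ 9 (ℓ * n * n + (n + 1) + m) ?_ rfl
      (AnyFree.scratchFree rfl _ _) (hw50 _ (by decide))).mono (by simp [cost]) fun s₇ hs₇ => ?_)
    · simp [eval_add, eval_var, hρ₆, hρ₅]
    rw [← hρ₇] at hs₇
    refine Runs.seq_add ((fillTypes_runs hs₇ hI₇ hb₇ hz₇ ?_ ?_ k8 ?_ (by omega) hVo).mono
      (by rw [hZ]) fun s₈ hs₈ => ?_)
    · simp [hρ₇, hρ₆, hρ₅, hρ₄, hρ₃, hρ₂, hρ₁, hτ]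
    · simp [hρ₇, hρ₆, hρ₅, hρ₄, hρ₃, hρ₂]
    · simp [hρ₇, hρ₆, hρ₅, hρ₄, hρ₃, hρ₂, hρ₁, rz]
    rw [k8, ← hρ₈] at hs₈
    have hb₈ : Bounded V (overlay μ (ℓ * n * n) (n + 1) (typeTable T)) ρ₈ :=
      hρ₈ ▸ (Bounded.overlay_of_le hb₇ _ _ fun x =>
        (typeTable_le T x).trans (by omega)).update _ (by omega)
    refine (assign_runs hs₈ hb₈ 0 _ rfl (answer_wellFormed σ)
      (scratchFree_answer σ ?_ fun x hx => ?_) (hwid _ (by unfold decisionWidth; omega))).mono le_rfl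
      fun s hs => ⟨_, rfl, ?_⟩
    · simp [hρ₈, hρ₇, hρ₆, hρ₅]
    · have k6 : ρ₈ 6 = ℓ * n * n + (n + 1) := by simp [hρ₈, hρ₇, hρ₆, hρ₅]
      have hx : ρ₈ 6 ≤ x := hx
      rw [k6] at hx
      rw [overlay, if_neg (by omega)]
      exact hμ0 x (by omega)
    · rw [hs.reg 0 (by omega), Function.update_self]
  refine hprog.mono ?_ fun s hs => ?_
  · have c1 : typeCount.cost ρ₀ ≤ typeCount.factor * Z := hZ ▸ hz₀.cost_le_of_le rfl typeCount_exponents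
    have c2 : (answer σ).cost ρ₈ ≤ (answer σ).factor * Z :=
      hZ ▸ hz₈.cost_le_of_le (answer_measured σ) (answer_exponents σ)
    rw [decisionFactor]
    simp only [add_mul]
    omega
  · obtain ⟨v, hv, hs⟩ := hs
    rw [hs]
    constructor
    · rw [hv, answer, eval]
      split_ifs <;> simp
    · rw [hv]
      have k8' : ρ₈ 8 = ℓ * n * n := by simp [hρ₈, k8]
      have k6 : ρ₈ 6 = ℓ * n * n + (n + 1) := by simp [hρ₈, hρ₇, hρ₆, hρ₅]
      have ht : ∀ x < n + 1, overlay μ (ℓ * n * n) (n + 1) (typeTable T) (ρ₈ 8 + x) =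
          typeTable T x := fun x hx => by rw [k8', overlay_apply hx]
      refine pos_answer (τ := τ) (tp := typeIndex T) (hρ₈ ▸ (hI₇.overlay le_rfl _ _).update (by omega) _)
        ?_ ?_ ?_ ?_ ?_ k8'.ge ?_ ?_ (fun a => ?_) ?_ (typeIndex_eq_iff T)
        (fun a => hτ ▸ typeIndex_lt T a) hαℓ σ
      · simp [hρ₈, hρ₇, hρ₆, hρ₅, hρ₄, hρ₃, hρ₂, hρ₁, r2]
      · simp [hρ₈, hρ₇, hρ₆, hρ₅, hρ₄, hρ₃, hρ₂, hρ₁]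
      · simp [hρ₈, hρ₇, hρ₆, hρ₅, hρ₄, hρ₃, hρ₂]
      · simp [hρ₈, hρ₇, hρ₆, hρ₅, hρ₄]
      · simp [hρ₈, hρ₇, hρ₆, hm]
      · rw [k8', k6]; omega
      · rw [k6, ← hm]; simp [hρ₈, hρ₇]
      · rw [ht a (by omega), typeTable, dif_pos a.2]
      · rw [ht n (by omega), typeTable, dif_neg (by omega), hτ]

end MultilayerMatching

theorem mainTheorem11 (σ : MultilayerMatching.StabilityNotion) :
    MultilayerMatching.SolvableInTime σ
      (fun {n ℓ} T => 2 ^ ((MultilayerMatching.numTypes T + 1) ^ 2) * n ^ 4 * ℓ) := by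
  open MultilayerMatching in
  -- The factor 16 comes from `(n + 1) ^ 4 ≤ (2 * n) ^ 4`, and `2 ^ 41` from the exponential factor.
  -- The additional 1 in the word length makes the bound on values strict.
  refine ⟨decisionProgram σ, decisionWidth σ + 1, decisionFactor σ * (16 * 2 ^ 41),
    fun n ℓ T α w hn hα hαℓ hw => ?_⟩
  have hlog : n * ℓ + 1 ≤ 2 ^ (Nat.log 2 (n * ℓ) + 1) := Nat.lt_pow_succ_log_self (by norm_num) _
  have hwidth : (n * ℓ + 1) ^ decisionWidth σ < 2 ^ w :=
    calc (n * ℓ + 1) ^ decisionWidth σ < (n * ℓ + 1) ^ (decisionWidth σ + 1) :=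
          Nat.pow_lt_pow_right (by nlinarith) (Nat.lt_succ_self _)
      _ ≤ (2 ^ (Nat.log 2 (n * ℓ) + 1)) ^ (decisionWidth σ + 1) := Nat.pow_le_pow_left hlog _
      _ = 2 ^ ((decisionWidth σ + 1) * (Nat.log 2 (n * ℓ) + 1)) := by rw [← pow_mul, mul_comm]
      _ ≤ 2 ^ w := Nat.pow_le_pow_right (by norm_num) hw
  obtain ⟨t, s, h1, h2, h3, h4⟩ := decisionProgram_runs σ T α w hn hα hαℓ hwidth
  refine ⟨t, s, h1, h2.trans ?_, ?_⟩
  · rw [mul_assoc (decisionFactor σ)]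
    refine Nat.mul_le_mul_left _ ?_
    have hτ := leaderCount_le_numTypes T
    have h5 := three_pow_mul_le (leaderCount T)
    have h6 : 2 ^ ((leaderCount T + 1) ^ 2) ≤ 2 ^ ((numTypes T + 1) ^ 2) :=
      Nat.pow_le_pow_right (by norm_num) (Nat.pow_le_pow_left (by omega) 2)
    have h7 : (n + 1) ^ 4 ≤ 16 * n ^ 4 :=
      calc (n + 1) ^ 4 ≤ (2 * n) ^ 4 := Nat.pow_le_pow_left (by omega) 4
        _ = 16 * n ^ 4 := by ring
    simp only [Expression.monomial, pow_one]
    rw [mul_assoc _ (3 ^ _)]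
    calc (n + 1) ^ 4 * ℓ * _ ≤ 16 * n ^ 4 * ℓ * (2 ^ 41 * 2 ^ ((numTypes T + 1) ^ 2)) :=
          Nat.mul_le_mul (Nat.mul_le_mul_right _ h7) (h5.trans (Nat.mul_le_mul_left _ h6))
      _ = _ := by ring
  · split_ifs with h
    · have := h4.2 h; omega
    · have := mt h4.1 h; omega
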